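/- For $\varepsilon,b\in\mathbb{R}$ consider the four-level control system $i\dot U_f(t)=(H_0+f(t)H_1)U_f(t)$, $U_f(0)=I$, with $$H_0=\operatorname{diag}(1+\varepsilon,1,2,2),\qquad H_1=\begin{pmatrix}0&1&0&0\\1&0&1&0\\0&1&0&b\\0&0&b&0\end{pmatrix}.$$ For $\varepsilon>0$ let $T=\pi/\varepsilon$ and, for $\theta\in\mathbb{R}$, $$|\Psi_0\rangle=\tfrac1{\sqrt2}\,[e^{i\theta},0,0,e^{-i\theta}]^{\rm T},\qquad |\Psi_g\rangle=\tfrac1{\sqrt2}\,[e^{-iT(1+\varepsilon)},0,0,e^{-2iT}]^{\rm T},$$ and let $\mathfrak F(f)=|\langle\Psi_g|U_f(T)|\Psi_0\rangle|^2$ for real controls $f\in L^2(0,T)$. For continuous $g$ let $\Pi[g]$ be the operator $\alpha\mapsto\big(\int_0^Tg\alpha\big)\,g$ on $L^2(0,T)$. 1. For all $\varepsilon>0$ and $b,\theta\in\mathbb{R}$: each $f\in L^2(0,T)$ has exactly one propagator $U_f$ on $[0,T]$; $\mathfrak F$ is of class $C^2$ on $L^2(0,T)$; $f\equiv0$ is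 a critical point of $\mathfrak F$, with $\mathfrak F(0)=\cos^2\theta$. The Hessian of $\mathfrak F$ at $0$ is the operator with bilinear form $$-b^2\cos^2\theta\int_0^T\!\alpha\int_0^T\!\beta-\iint_{0<\sigma<\tau<T}\cos\theta\,\big[\cos\theta\cos(\varepsilon(\tau-\sigma))-\sin\theta\sin(\varepsilon(\tau-\sigma))\big]\big[\alpha(\sigma)\beta(\tau)+\beta(\sigma)\alpha(\tau)\big]\,d\sigma\,d\tau,$$ and it equals $$a_0\Pi[1]+\sum_{k\ge1}a_k\big(\Pi[\sin(2k\varepsilon\,\cdot)]+\Pi[\cos(2k\varepsilon\,\cdot)]\big)-\cos^2\theta\,\big(\Pi[\sin(\varepsilon\,\cdot)]+\Pi[\cos(\varepsilon\,\cdot)]\big),$$ with convergence in operator norm, where $$a_0=\tfrac1\pi\sin(2\theta)-b^2\cos^2\theta,\qquad a_k=-\frac{2\sin(2\theta)}{\pi(4k^2-1)}\quad(k\ge1).$$ All $a_k$, $k\ge0$, are negative if and only if $b^2\cos^2\theta>\frac1\pi\sin(2\theta)>0$. In that case the Hessian is strictly negative definite ($\langle\mathrm{Hess}\,\alpha,\alpha\rangle<0$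 for $\alpha\ne0$), it has infinite rank, and $0$ is a strict local maximum of the restriction of $\mathfrak F$ to every finite-dimensional subspace of $L^2(0,T)$. 2. For $b=3$ the condition holds for every $\theta\in(0,\pi/3]$. So for all these $\theta$ and all $\varepsilon>0$ the Hessian at $0$ is strictly negative definite of infinite rank and $0$ is a trap: a strict local maximum over every finite-dimensional subspace, with $\mathfrak F(0)=\cos^2\theta\in[\frac14,1)$; every value in $[\frac14,1)$ occurs for some $\theta\in(0,\pi/3]$. 3. Let $b\notin\{0,1,-1\}$ (for instance $b=3$). There are $T_c>0$ and $\varepsilon_0>0$ such that for all $0\le\varepsilon<\varepsilon_0$ and all times $T'>T_c$ the system $(H_0,H_1)$ is controllable in time exactly $T'$ up to global phase: every $V\in\mathbf U(4)$ with $\det V=e^{-iT'\operatorname{tr}H_0}$ equals $U_f(T')$ for some real $f\in L^2(0,T')$. Moreover $T_c<\pi/\varepsilon$ for $0<\varepsilon<\varepsilon_0$, so that the system is controllable in time exactly $T=\pi/\varepsilon$. -/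

import Mathlib

open MeasureTheory Set Matrix
open scoped Topology InnerProductSpace

noncomputable section

/-- The real Hilbert space `L²(0,T)` of control fields. -/
abbrev ControlSpace (T : ℝ) : Type := Lp ℝ 2 (volume.restrict (Ioo (0 : ℝ) T))

/-- `U` is the propagator on `[0,T]` of `i U' = (H₀ + f(t) H₁) U`, `U(0) = 1`: it is continuous and
solves the equation in integrated form (that is, it is absolutely continuous and solves the
differential equation almost everywhere), the integral being taken entry by entry. -/
def IsPropagator {n : ℕ} (H₀ H₁ : Matrix (Fin n) (Fin n) ℂ) (T : ℝ) (f : ControlSpace T)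
    (U : ℝ → Matrix (Fin n) (Fin n) ℂ) : Prop :=
  ContinuousOn U (Icc 0 T) ∧
    ∀ t ∈ Icc 0 T, ∀ j k : Fin n,
      U t j k = (1 : Matrix (Fin n) (Fin n) ℂ) j k
        - Complex.I * ∫ s in (0 : ℝ)..t, ((H₀ + ((f s : ℝ) : ℂ) • H₁) * U s) j k

/-- The propagator `t ↦ U_f(t)` on `[0,T]`, for a control `f ∈ L²(0,T)`. -/
def propagator {n : ℕ} (H₀ H₁ : Matrix (Fin n) (Fin n) ℂ) (T : ℝ) (f : ControlSpace T) :
    ℝ → Matrix (Fin n) (Fin n) ℂ :=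
  Classical.epsilon (IsPropagator H₀ H₁ T f)

/-- The pure-state transfer fidelity `f ↦ |⟨Ψ_g | U_f(T) Ψ₀⟩|²` on `L²(0,T)`. -/
def pureFidelity {n : ℕ} (H₀ H₁ : Matrix (Fin n) (Fin n) ℂ) (ψ₀ ψg : Fin n → ℂ) (T : ℝ)
    (f : ControlSpace T) : ℝ :=
  ‖star ψg ⬝ᵥ (propagator H₀ H₁ T f T *ᵥ ψ₀)‖ ^ 2

/-- The Hessian of a functional on a real Hilbert space, as an operator: the derivative of its
gradient, so that `⟪hessian F x α, β⟫ = D²F(x)(α, β)` when `F` is twice differentiable at `x`. -/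
def hessian {E : Type*} [NormedAddCommGroup E] [InnerProductSpace ℝ E] [CompleteSpace E]
    (F : E → ℝ) (x : E) : E →L[ℝ] E :=
  fderiv ℝ (gradient F) x

/-- Strict negative definiteness of (the quadratic form of) an operator. -/
def IsNegDef {E : Type*} [NormedAddCommGroup E] [InnerProductSpace ℝ E] (A : E →L[ℝ] E) : Prop :=
  ∀ α : E, α ≠ 0 → ⟪A α, α⟫_ℝ < 0

/-- The restriction of `F` to every finite-dimensional subspace has a strict local maximum at `0`. -/
def IsStrictLocalMaxOnFinDim {E : Type*} [NormedAddCommGroup E] [InnerProductSpace ℝ E]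
    (F : E → ℝ) : Prop :=
  ∀ V : Submodule ℝ E, FiniteDimensional ℝ V → ∀ᶠ v : V in 𝓝[≠] 0, F (v : E) < F 0

/-- The operator has infinite rank. -/
def HasInfiniteRank {E : Type*} [NormedAddCommGroup E] [InnerProductSpace ℝ E]
    (A : E →L[ℝ] E) : Prop :=
  ¬ FiniteDimensional ℝ (LinearMap.range (A : E →ₗ[ℝ] E))

theorem memLp_of_continuous_Ioo (T : ℝ) {g : ℝ → ℝ} (hg : Continuous g) :
    MemLp g 2 (volume.restrict (Ioo (0 : ℝ) T)) := by
  obtain ⟨C, hC⟩ := (isCompact_Icc (a := (0 : ℝ)) (b := T)).exists_bound_of_continuousOn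
    hg.continuousOn
  refine MemLp.of_bound hg.aestronglyMeasurable C ?_
  filter_upwards [ae_restrict_mem measurableSet_Ioo] with x hx
  exact hC x (Ioo_subset_Icc_self hx)

/-- The unnormalized projection `Π[g]` on `L²(0,T)` for continuous `g`:
`Π[g] α = (∫₀ᵀ g(τ) α(τ) dτ) g`. -/
def unnormProj (T : ℝ) (g : C(ℝ, ℝ)) : ControlSpace T →L[ℝ] ControlSpace T :=
  let v : ControlSpace T := (memLp_of_continuous_Ioo T g.continuous).toLp g
  InnerProductSpace.rankOne ℝ v v

/-- The function `t ↦ sin (ω t)`. -/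
def sinMap (ω : ℝ) : C(ℝ, ℝ) := ⟨fun t => Real.sin (ω * t), by fun_prop⟩

/-- The function `t ↦ cos (ω t)`. -/
def cosMap (ω : ℝ) : C(ℝ, ℝ) := ⟨fun t => Real.cos (ω * t), by fun_prop⟩

/-- The four-level drift Hamiltonian. -/
def trapH₀ (ε : ℝ) : Matrix (Fin 4) (Fin 4) ℂ :=
  Matrix.diagonal ![1 + (ε : ℂ), 1, 2, 2]

/-- The four-level control Hamiltonian. -/
def trapH₁ (b : ℝ) : Matrix (Fin 4) (Fin 4) ℂ :=
  !![0, 1, 0, 0;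
     1, 0, 1, 0;
     0, 1, 0, (b : ℂ);
     0, 0, (b : ℂ), 0]

/-- The target time. -/
def trapTime (ε : ℝ) : ℝ := Real.pi / ε

/-- The initial state `2^{-1/2} (e^{iθ}, 0, 0, e^{-iθ})`. -/
def trapInitial (θ : ℝ) : Fin 4 → ℂ :=
  ((1 / Real.sqrt 2 : ℝ) : ℂ) •
    ![Complex.exp (Complex.I * θ), 0, 0, Complex.exp (-Complex.I * θ)]

/-- The target state `2^{-1/2} (e^{-iT(1+ε)}, 0, 0, e^{-2iT})`, `T = π/ε`. -/
def trapTarget (ε : ℝ) : Fin 4 → ℂ :=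
  ((1 / Real.sqrt 2 : ℝ) : ℂ) •
    ![Complex.exp (-Complex.I * trapTime ε * (1 + ε)), 0, 0,
      Complex.exp (-Complex.I * 2 * trapTime ε)]

/-- The fidelity functional of the four-level transfer problem on `L²(0, π/ε)`. -/
def trapFidelity (ε b θ : ℝ) : ControlSpace (trapTime ε) → ℝ :=
  pureFidelity (trapH₀ ε) (trapH₁ b) (trapInitial θ) (trapTarget ε) (trapTime ε)

/-- The coefficients `a_k` of the eigen-expansion. -/
def trapCoeff (b θ : ℝ) (k : ℕ) : ℝ :=
  if k = 0 then 1 / Real.pi * Real.sin (2 * θ) - b ^ 2 * Real.cos θ ^ 2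
  else -(2 * Real.sin (2 * θ) / (Real.pi * (4 * (k : ℝ) ^ 2 - 1)))

/-- Controllability in time exactly `T`: every unitary that has the determinant
`exp (-i T tr H₀)` is reached at time `T`. When `tr H₁ = 0` every propagator at time `T` has that
determinant, so this is the controllability of all unitaries with the global phase neglected. -/
def ControllableInTime {n : ℕ} (H₀ H₁ : Matrix (Fin n) (Fin n) ℂ) (T : ℝ) : Prop :=
  ∀ V ∈ Matrix.unitaryGroup (Fin n) ℂ, V.det = Complex.exp (-Complex.I * T * H₀.trace) →
    ∃ (f : ControlSpace T) (U : ℝ → Matrix (Fin n) (Fin n) ℂ),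
      IsPropagator H₀ H₁ T f U ∧ U T = V

end

/-! The integrated Schrödinger equation reads `u = ψ + K₀ u + K₁(f) u`, with operators of Volterra
type on `C([0,T], ℂⁿ)`. Iterates of a Volterra operator decay factorially, so `1 - K₀ - K₁(f)` is
invertible for every `f ∈ L²` (`IsVolterra.isUnit_one_sub`). This one fact gives existence and
uniqueness of propagators and smoothness of the fidelity, because operator inversion is smooth;
differentiating the resolvent produces the Dyson terms.

At `f = 0` the target is the free evolution of `(1,0,0,1)/√2`, so the zeroth-order amplitude is `cos
θ`. The control moves levels 0 and 3 into levels 1 and 2, which the target does not see: the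
first-order amplitude vanishes, `0` is critical, and the Hessian is `cos θ` times the second-order
amplitude, real part taken and symmetrised. Only the excursions 0→1→0 and 3→2→3 contribute. Since
`E₀ - E₁ = ε` and `E₃ = E₂`, they give a kernel in `ε|τ-σ|` and a constant with weight `b²`. The
cosine part of the kernel has rank at most two. The remaining part contains `sin(ε|τ-σ|)`, and
because `εT = π` it is expanded by the Fourier series of `|sin|` on the circle of length `π`
(`hasSum_cos_sub_sin`), which yields the coefficients `a_k`. The functions `1`, `sin 2kε·`, `cos
2kε·` are the complete trigonometric system of period `T`; hence if all `a_k` are negative, the form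
vanishes only at `0` (`isNegDef_hessian_trapFidelity`). As `a_k → 0` there is no uniform gap on
`L²`, but compactness of the unit sphere gives one on each finite-dimensional subspace, and Taylor's
formula gives a strict maximum there.

For controllability, take `ε = 0` first. Commutators with the drift separate the 1–2 transition from
the degenerate transitions 0–1 and 2–3, and `b(b²-1) ≠ 0` separates those two; all traceless
matrices are generated (`traceless_mem_of_ad_invariant`). Among smooth families of reached
unitaries, with durations as parameters and a phase adjoined, one picks a maximal space of
directions of motion. Maximality makes it absorb every further direction, so it contains all
skew-adjoint elements at every rate of change of time (`exists_isReachDirection_full`). The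
surjective form of the inverse function theorem, with `ε` kept as a coordinate, gives a ball reached
at one fixed time uniformly for small `ε` (`exists_reached_ball`). The determinant removes the
phase. The ball is a translate `g·B`, with `B` a conjugation-invariant neighbourhood of `1` in the
special unitary group; some power of `B` is the whole group, so a fixed multiple of the time
suffices, and any surplus time is spent with zero control. -/

noncomputable section

/-! ### Volterra operators driven by `L²` controls -/

section Volterra

variable {T : ℝ}

/-- A property that holds almost everywhere on `(0,T)` gives equality of the primitives. -/
theorem intervalIntegral_congr_ae_Ioo {E : Type*} [NormedAddCommGroup E] [NormedSpace ℝ E]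
    {g h : ℝ → E} (hgh : g =ᵐ[volume.restrict (Ioo (0 : ℝ) T)] h) {s t : ℝ}
    (hs : s ∈ Icc 0 T) (ht : t ∈ Icc 0 T) :
    ∫ x in s..t, g x = ∫ x in s..t, h x := by
  rw [restrict_Ioo_eq_restrict_Ioc] at hgh
  refine intervalIntegral.integral_congr_ae ?_
  rw [Filter.EventuallyEq, ae_restrict_iff' measurableSet_Ioc] at hgh
  filter_upwards [hgh] with x hx hxs
  refine hx ⟨?_, ?_⟩
  · exact lt_of_le_of_lt (le_min hs.1 ht.1) hxs.1
  · exact hxs.2.trans (max_le hs.2 ht.2)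

namespace ControlSpace

theorem memLp_Ioc (f : ControlSpace T) {t : ℝ} (ht : t ≤ T) :
    MemLp (f : ℝ → ℝ) 2 (volume.restrict (Ioc 0 t)) := by
  refine (Lp.memLp f).mono_measure ?_
  rw [restrict_Ioo_eq_restrict_Ioc]
  exact Measure.restrict_mono (Ioc_subset_Ioc_right ht) le_rfl

theorem intervalIntegrable (f : ControlSpace T) {s t : ℝ} (hs : s ∈ Icc 0 T) (ht : t ∈ Icc 0 T) :
    IntervalIntegrable (f : ℝ → ℝ) volume s t := by
  have h : IntegrableOn (f : ℝ → ℝ) (Ioc 0 T) :=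
    (f.memLp_Ioc le_rfl).integrable (by norm_num)
  rw [intervalIntegrable_iff]
  refine h.mono_set ?_
  rw [uIoc]
  exact Ioc_subset_Ioc (le_min hs.1 ht.1) (max_le hs.2 ht.2)

theorem integral_sq_eq (hT : 0 ≤ T) (f : ControlSpace T) :
    ∫ s in (0 : ℝ)..T, f s ^ 2 = ‖f‖ ^ 2 := by
  rw [← real_inner_self_eq_norm_sq, L2.inner_def, intervalIntegral.integral_of_le hT,
    integral_Ioc_eq_integral_Ioo]
  simp [pow_two]

theorem intervalIntegrable_sq (f : ControlSpace T) {s t : ℝ} (hs : s ∈ Icc 0 T)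
    (ht : t ∈ Icc 0 T) : IntervalIntegrable (fun x => f x ^ 2) volume s t := by
  have h : IntegrableOn (fun x => f x ^ 2) (Ioc 0 T) := (f.memLp_Ioc le_rfl).integrable_sq
  rw [intervalIntegrable_iff]
  refine h.mono_set ?_
  rw [uIoc]
  exact Ioc_subset_Ioc (le_min hs.1 ht.1) (max_le hs.2 ht.2)

/-- Cauchy–Schwarz against a continuous function, on `[0,t]`. -/
theorem integral_abs_mul_sq_le (f : ControlSpace T) {v : ℝ → ℝ} (hv : Continuous v)
    (hv0 : ∀ s, 0 ≤ v s) {t : ℝ} (ht : t ∈ Icc 0 T) :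
    (∫ s in (0 : ℝ)..t, |f s| * v s) ^ 2 ≤ ‖f‖ ^ 2 * ∫ s in (0 : ℝ)..t, v s ^ 2 := by
  have h0 : (0 : ℝ) ∈ Icc 0 T := ⟨le_rfl, ht.1.trans ht.2⟩
  have hvm : MemLp v 2 (volume.restrict (Ioc 0 t)) := by
    rw [← restrict_Ioo_eq_restrict_Ioc]
    exact memLp_of_continuous_Ioo t hv
  have key := integral_mul_le_Lp_mul_Lq_of_nonneg (μ := volume.restrict (Ioc 0 t))
    (f := fun s => |f s|) (g := v) Real.HolderConjugate.two_two
    (Filter.Eventually.of_forall fun s => abs_nonneg _)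
    (Filter.Eventually.of_forall hv0) (by simpa using! (f.memLp_Ioc ht.2).abs) (by simpa using hvm)
  simp only [Real.rpow_two, sq_abs, ← Real.sqrt_eq_rpow,
    ← intervalIntegral.integral_of_le ht.1] at key
  have hf2 : ∫ s in (0 : ℝ)..t, f s ^ 2 ≤ ‖f‖ ^ 2 := by
    rw [← integral_sq_eq (ht.1.trans ht.2)]
    exact intervalIntegral.integral_mono_interval le_rfl ht.1 ht.2
      (Filter.Eventually.of_forall fun s => sq_nonneg _)
      (f.intervalIntegrable_sq h0 ⟨ht.1.trans ht.2, le_rfl⟩)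
  have hv2 : 0 ≤ ∫ s in (0 : ℝ)..t, v s ^ 2 :=
    intervalIntegral.integral_nonneg ht.1 fun s _ => sq_nonneg _
  have hf0 : 0 ≤ ∫ s in (0 : ℝ)..t, f s ^ 2 :=
    intervalIntegral.integral_nonneg ht.1 fun s _ => sq_nonneg _
  calc (∫ s in (0 : ℝ)..t, |f s| * v s) ^ 2
      ≤ (√(∫ s in (0 : ℝ)..t, f s ^ 2) * √(∫ s in (0 : ℝ)..t, v s ^ 2)) ^ 2 := by
        refine pow_le_pow_left₀ ?_ key 2
        exact intervalIntegral.integral_nonneg ht.1 fun s _ => mul_nonneg (abs_nonneg _) (hv0 s)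
    _ = (∫ s in (0 : ℝ)..t, f s ^ 2) * ∫ s in (0 : ℝ)..t, v s ^ 2 := by
        rw [mul_pow, Real.sq_sqrt hf0, Real.sq_sqrt hv2]
    _ ≤ _ := mul_le_mul_of_nonneg_right hf2 hv2

end ControlSpace

variable {E : Type*} [NormedAddCommGroup E]

theorem IccExtend_continuousMap (hT : 0 ≤ T) (u : C(Icc (0 : ℝ) T, E)) :
    Continuous (IccExtend hT u) := u.continuous.Icc_extend'

theorem norm_IccExtend_le (hT : 0 ≤ T) (u : C(Icc (0 : ℝ) T, E)) (s : ℝ) :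
    ‖IccExtend hT u s‖ ≤ ‖u‖ := u.norm_coe_le_norm _

variable [NormedSpace ℝ E]

theorem ControlSpace.intervalIntegrable_smul (f : ControlSpace T) {v : ℝ → E} (hv : Continuous v)
    {s t : ℝ} (hs : s ∈ Icc 0 T) (ht : t ∈ Icc 0 T) :
    IntervalIntegrable (fun x => f x • v x) volume s t :=
  (f.intervalIntegrable hs ht).smul_continuousOn hv.continuousOn

theorem ControlSpace.norm_integral_smul_sq_le (f : ControlSpace T) {v : ℝ → E} (hv : Continuous v)
    {t : ℝ} (ht : t ∈ Icc 0 T) :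
    ‖∫ s in (0 : ℝ)..t, f s • v s‖ ^ 2 ≤ ‖f‖ ^ 2 * ∫ s in (0 : ℝ)..t, ‖v s‖ ^ 2 := by
  refine le_trans ?_ (f.integral_abs_mul_sq_le hv.norm (fun s => norm_nonneg _) ht)
  refine pow_le_pow_left₀ (norm_nonneg _) ?_ 2
  refine (intervalIntegral.norm_integral_le_integral_norm ht.1).trans_eq ?_
  simp [norm_smul]

/-- The primitive of `f • u`, as a function on `[0,T]`. -/
def primitiveFun (hT : 0 ≤ T) (f : ControlSpace T) (u : C(Icc (0 : ℝ) T, E)) :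
    C(Icc (0 : ℝ) T, E) where
  toFun t := ∫ s in (0 : ℝ)..t, f s • IccExtend hT u s
  continuous_toFun := by
    have h := f.intervalIntegrable_smul (IccExtend_continuousMap hT u) ⟨le_rfl, hT⟩ ⟨hT, le_rfl⟩
    have := intervalIntegral.continuousOn_primitive_interval' h (left_mem_uIcc)
    rw [uIcc_of_le hT] at this
    exact continuousOn_iff_continuous_domRestrict.1 this

theorem primitiveFun_norm_le (hT : 0 ≤ T) (f : ControlSpace T) (u : C(Icc (0 : ℝ) T, E)) :
    ‖primitiveFun hT f u‖ ≤ √T * ‖f‖ * ‖u‖ := by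
  rw [ContinuousMap.norm_le _ (by positivity)]
  intro t
  have h := f.norm_integral_smul_sq_le (IccExtend_continuousMap hT u) t.2
  refine le_of_sq_le_sq (a := ‖primitiveFun hT f u t‖) ?_ (by positivity)
  refine h.trans ?_
  have : ∫ s in (0 : ℝ)..t, ‖IccExtend hT u s‖ ^ 2 ≤ T * ‖u‖ ^ 2 := by
    calc ∫ s in (0 : ℝ)..t, ‖IccExtend hT u s‖ ^ 2
        ≤ ∫ s in (0 : ℝ)..t, ‖u‖ ^ 2 := by
          refine intervalIntegral.integral_mono_on t.2.1 ?_ (by simp) fun s _ =>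
            pow_le_pow_left₀ (norm_nonneg _) (norm_IccExtend_le hT u s) 2
          exact ((IccExtend_continuousMap hT u).norm.pow 2).intervalIntegrable _ _
      _ = t * ‖u‖ ^ 2 := by simp
      _ ≤ _ := by gcongr; exact t.2.2
  calc _ ≤ ‖f‖ ^ 2 * (T * ‖u‖ ^ 2) := by gcongr
    _ = (√T * ‖f‖ * ‖u‖) ^ 2 := by rw [mul_pow, mul_pow, Real.sq_sqrt hT]; ring

/-- The bilinear map `(f,u) ↦ (t ↦ ∫₀ᵗ f u)`. -/
def primitive (hT : 0 ≤ T) :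
    ControlSpace T →L[ℝ] C(Icc (0 : ℝ) T, E) →L[ℝ] C(Icc (0 : ℝ) T, E) :=
  LinearMap.mkContinuous₂
    (LinearMap.mk₂ ℝ (primitiveFun hT)
      (fun f g u => by
        ext t
        have h0 : (0 : ℝ) ∈ Icc 0 T := ⟨le_rfl, hT⟩
        have hu := IccExtend_continuousMap hT u
        refine (intervalIntegral_congr_ae_Ioo (h := fun s => f s • IccExtend hT u s
          + g s • IccExtend hT u s) ?_ h0 t.2).trans
          (intervalIntegral.integral_add (f.intervalIntegrable_smul hu h0 t.2)
            (g.intervalIntegrable_smul hu h0 t.2))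
        filter_upwards [Lp.coeFn_add f g] with s hs
        rw [hs, Pi.add_apply, add_smul])
      (fun c f u => by
        ext t
        have h0 : (0 : ℝ) ∈ Icc 0 T := ⟨le_rfl, hT⟩
        refine (intervalIntegral_congr_ae_Ioo (h := fun s => c • f s • IccExtend hT u s) ?_
          h0 t.2).trans (intervalIntegral.integral_smul _ _)
        filter_upwards [Lp.coeFn_smul c f] with s hs
        rw [hs, Pi.smul_apply, smul_assoc])
      (fun f u v => by
        ext t
        have h0 : (0 : ℝ) ∈ Icc 0 T := ⟨le_rfl, hT⟩
        have hu := IccExtend_continuousMap hT u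
        have hv := IccExtend_continuousMap hT v
        refine Eq.trans ?_ (intervalIntegral.integral_add (f.intervalIntegrable_smul hu h0 t.2)
            (f.intervalIntegrable_smul hv h0 t.2))
        refine intervalIntegral.integral_congr fun s _ => ?_
        simp [IccExtend])
      (fun c f u => by
        ext t
        refine Eq.trans ?_ (intervalIntegral.integral_smul c _)
        refine intervalIntegral.integral_congr fun s _ => ?_
        simp [IccExtend, smul_comm c]))
    (√T) (primitiveFun_norm_le hT)

theorem primitive_apply (hT : 0 ≤ T) (f : ControlSpace T) (u : C(Icc (0 : ℝ) T, E))
    (t : Icc (0 : ℝ) T) :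
    primitive hT f u t = ∫ s in (0 : ℝ)..t, f s • IccExtend hT u s := rfl

/-- Operators on `C([0,T],E)` of Volterra type, in the square-integral sense. -/
def IsVolterra (hT : 0 ≤ T) (K : C(Icc (0 : ℝ) T, E) →L[ℝ] C(Icc (0 : ℝ) T, E)) : Prop :=
  ∃ C : ℝ, 0 ≤ C ∧ ∀ u t, ‖K u t‖ ^ 2 ≤ C * ∫ s in (0 : ℝ)..t, ‖IccExtend hT u s‖ ^ 2

theorem isVolterra_primitive (hT : 0 ≤ T) (f : ControlSpace T) :
    IsVolterra hT (primitive (E := E) hT f) :=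
  ⟨‖f‖ ^ 2, sq_nonneg _, fun u t =>
    f.norm_integral_smul_sq_le (IccExtend_continuousMap hT u) t.2⟩

/-- The bound is on squares, as Cauchy–Schwarz against an `L²` control dictates, so the sum costs a
factor 2 through `(x+y)² ≤ 2x² + 2y²`. -/
theorem IsVolterra.add {hT : 0 ≤ T} {K L : C(Icc (0 : ℝ) T, E) →L[ℝ] C(Icc (0 : ℝ) T, E)}
    (hK : IsVolterra hT K) (hL : IsVolterra hT L) : IsVolterra hT (K + L) := by
  obtain ⟨C, hC, hK⟩ := hK
  obtain ⟨D, hD, hL⟩ := hL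
  refine ⟨2 * (C + D), by positivity, fun u t => ?_⟩
  have h := norm_add_le (K u t) (L u t)
  have h1 := hK u t
  have h2 := hL u t
  have h3 : ‖(K + L) u t‖ = ‖K u t + L u t‖ := rfl
  rw [h3]
  nlinarith [norm_nonneg (K u t + L u t), sq_nonneg (‖K u t‖ - ‖L u t‖)]

/-- Application of a fixed operator at every time. -/
def postComp (T : ℝ) (B : E →L[ℝ] E) : C(Icc (0 : ℝ) T, E) →L[ℝ] C(Icc (0 : ℝ) T, E) :=
  B.compLeftContinuous ℝ _

theorem IsVolterra.postComp {hT : 0 ≤ T} {K : C(Icc (0 : ℝ) T, E) →L[ℝ] C(Icc (0 : ℝ) T, E)}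
    (hK : IsVolterra hT K) (B : E →L[ℝ] E) : IsVolterra hT (postComp T B * K) := by
  obtain ⟨C, hC, hK⟩ := hK
  refine ⟨‖B‖ ^ 2 * C, by positivity, fun u t => ?_⟩
  calc ‖B (K u t)‖ ^ 2 ≤ (‖B‖ * ‖K u t‖) ^ 2 := by gcongr; exact B.le_opNorm _
    _ = ‖B‖ ^ 2 * ‖K u t‖ ^ 2 := by ring
    _ ≤ ‖B‖ ^ 2 * (C * ∫ s in (0 : ℝ)..t, ‖IccExtend hT u s‖ ^ 2) := by gcongr; exact hK u t
    _ = _ := by ring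

/-- Each application of `K` integrates the previous squared bound once more, and iterated
integration of powers of `s` produces the factorial. -/
theorem IsVolterra.norm_pow_apply_sq_le {hT : 0 ≤ T}
    {K : C(Icc (0 : ℝ) T, E) →L[ℝ] C(Icc (0 : ℝ) T, E)} {C : ℝ} (hC : 0 ≤ C)
    (hK : ∀ u t, ‖K u t‖ ^ 2 ≤ C * ∫ s in (0 : ℝ)..t, ‖IccExtend hT u s‖ ^ 2) (n : ℕ)
    (u : C(Icc (0 : ℝ) T, E)) (t : Icc (0 : ℝ) T) :
    ‖(K ^ n) u t‖ ^ 2 ≤ C ^ n * (t : ℝ) ^ n / n.factorial * ‖u‖ ^ 2 := by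
  induction n generalizing t with
  | zero => simpa using pow_le_pow_left₀ (norm_nonneg _) (u.norm_coe_le_norm t) 2
  | succ n ih =>
    rw [pow_succ' K, mul_apply_eq_comp]
    refine (hK _ t).trans ?_
    have h : ∫ s in (0 : ℝ)..t, ‖IccExtend hT ((K ^ n) u) s‖ ^ 2
        ≤ ∫ s in (0 : ℝ)..t, C ^ n * s ^ n / n.factorial * ‖u‖ ^ 2 := by
      refine intervalIntegral.integral_mono_on t.2.1 ?_ ?_ fun s hs => ?_
      · exact ((IccExtend_continuousMap hT _).norm.pow 2).intervalIntegrable _ _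
      · exact Continuous.intervalIntegrable (by fun_prop) _ _
      · have hs' : s ∈ Icc 0 T := ⟨hs.1, hs.2.trans t.2.2⟩
        rw [IccExtend_of_mem hT _ hs']
        exact ih ⟨s, hs'⟩
    have h2 : ∫ s in (0 : ℝ)..t, C ^ n * s ^ n / n.factorial * ‖u‖ ^ 2
        = C ^ n * ((t : ℝ) ^ (n + 1) / (n + 1)) / n.factorial * ‖u‖ ^ 2 := by
      rw [intervalIntegral.integral_mul_const, intervalIntegral.integral_div,
        intervalIntegral.integral_const_mul, integral_pow]
      simp
    calc C * ∫ s in (0 : ℝ)..t, ‖IccExtend hT ((K ^ n) u) s‖ ^ 2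
        ≤ C * (C ^ n * ((t : ℝ) ^ (n + 1) / (n + 1)) / n.factorial * ‖u‖ ^ 2) := by
          rw [← h2]; gcongr
      _ = _ := by
          rw [Nat.factorial_succ]; push_cast
          field_simp
          ring

/-- Factorial decay makes some power `K ^ n` a contraction, although `K` itself may be large;
neither the control nor the time has to be small. -/
theorem IsVolterra.isUnit_one_sub [CompleteSpace E] {hT : 0 ≤ T}
    {K : C(Icc (0 : ℝ) T, E) →L[ℝ] C(Icc (0 : ℝ) T, E)} (hK : IsVolterra hT K) :
    IsUnit (1 - K) := by
  obtain ⟨C, hC, hK⟩ := hK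
  obtain ⟨n, hn⟩ : ∃ n : ℕ, (C * T) ^ n / n.factorial < 1 / 4 :=
    ((FloorSemiring.tendsto_pow_div_factorial_atTop (C * T)).eventually
      (gt_mem_nhds (by norm_num))).exists
  have hnorm : ‖K ^ n‖ < 1 := by
    refine lt_of_le_of_lt (b := 1 / 2) ?_ (by norm_num)
    refine ContinuousLinearMap.opNorm_le_bound _ (by norm_num) fun u => ?_
    rw [ContinuousMap.norm_le _ (by positivity)]
    intro t
    refine le_of_sq_le_sq ?_ (by positivity)
    refine (IsVolterra.norm_pow_apply_sq_le hC hK n u t).trans ?_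
    rw [mul_pow]
    refine mul_le_mul_of_nonneg_right ?_ (sq_nonneg _)
    calc C ^ n * (t : ℝ) ^ n / n.factorial ≤ C ^ n * T ^ n / n.factorial := by
          have := t.2.1
          have := t.2.2
          gcongr
      _ ≤ (1 / 2) ^ 2 := by rw [← mul_pow]; norm_num; linarith
  have h1 : IsUnit (1 - K ^ n) := isUnit_one_sub_of_norm_lt_one (R := C(Icc (0 : ℝ) T, E) →L[ℝ] C(Icc (0 : ℝ) T, E)) hnorm
  -- `1 - K ^ n` is `1 - K` times a geometric sum; the factors commute, so invertibility passes to
  -- `1 - K`.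
  rw [← mul_neg_geom_sum] at h1
  refine (Commute.isUnit_mul_iff ?_).1 h1 |>.1
  refine Commute.sum_right _ _ _ fun i _ => Commute.pow_right ?_ _
  exact (Commute.one_left _).sub_left (Commute.refl _)

end Volterra

/-! ### First and second derivatives of a resolvent and of a fidelity -/

section ResolventCalculus

variable {H X : Type*} [NormedAddCommGroup H] [InnerProductSpace ℝ H]
  [NormedAddCommGroup X] [NormedSpace ℝ X]

/-- The resolvent `(1 - K₀ - K₁ f)⁻¹` of an affine family of operators. -/
def affineResolvent (K₀ : X →L[ℝ] X) (K₁ : H →L[ℝ] X →L[ℝ] X) (f : H) : X →L[ℝ] X :=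
  Ring.inverse (1 - (K₀ + K₁ f))

variable {K₀ : X →L[ℝ] X} {K₁ : H →L[ℝ] X →L[ℝ] X}

theorem hasFDerivAt_affine (f : H) :
    HasFDerivAt (fun f => 1 - (K₀ + K₁ f)) (-K₁) f := by
  simpa using! ((hasFDerivAt_const (1 - K₀) f).sub K₁.hasFDerivAt).congr_of_eventuallyEq
    (f₁ := fun f => 1 - (K₀ + K₁ f)) (.of_forall fun f => by simp [sub_sub])

variable [CompleteSpace X]

/-- This is `d(A⁻¹) = -A⁻¹ dA A⁻¹`, whose sign cancels against the minus in `1 - K₀ - K₁ f`: the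
first Dyson term. -/
theorem hasFDerivAt_affineResolvent_apply {f : H} (hf : IsUnit (1 - (K₀ + K₁ f))) (y : X) :
    ∃ D : H →L[ℝ] X, HasFDerivAt (fun f => affineResolvent K₀ K₁ f y) D f ∧
      ∀ α, D α = affineResolvent K₀ K₁ f (K₁ α (affineResolvent K₀ K₁ f y)) := by
  obtain ⟨w, hw⟩ := hf
  have h1 := hasFDerivAt_ringInverse (𝕜 := ℝ) w
  rw [hw] at h1
  have h2 := h1.comp f (hasFDerivAt_affine (K₀ := K₀) (K₁ := K₁) f)
  have h3 := (ContinuousLinearMap.apply ℝ X y).hasFDerivAt.comp f h2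
  refine ⟨_, h3, fun α => ?_⟩
  simp [affineResolvent, ← hw, ContinuousLinearMap.mulLeftRight_apply]

theorem hasFDerivAt_affineResolvent_apply_apply {f : H} (hf : IsUnit (1 - (K₀ + K₁ f))) (β : H)
    (y : X) :
    ∃ D : H →L[ℝ] X,
      HasFDerivAt (fun f => affineResolvent K₀ K₁ f (K₁ β (affineResolvent K₀ K₁ f y))) D f ∧
      ∀ α, D α = affineResolvent K₀ K₁ f (K₁ α (affineResolvent K₀ K₁ f
          (K₁ β (affineResolvent K₀ K₁ f y)))) +
        affineResolvent K₀ K₁ f (K₁ β (affineResolvent K₀ K₁ f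
          (K₁ α (affineResolvent K₀ K₁ f y)))) := by
  obtain ⟨D, hD, hD'⟩ := hasFDerivAt_affineResolvent_apply hf y
  obtain ⟨w, hw⟩ := hf
  have h1 := hasFDerivAt_ringInverse (𝕜 := ℝ) w
  rw [hw] at h1
  have h2 : HasFDerivAt (affineResolvent K₀ K₁) _ f :=
    h1.comp f (hasFDerivAt_affine (K₀ := K₀) (K₁ := K₁) f)
  have h3 := h2.clm_apply ((K₁ β).hasFDerivAt.comp f hD)
  refine ⟨_, h3, fun α => ?_⟩
  simp [hD', affineResolvent, ← hw, ContinuousLinearMap.mulLeftRight_apply, add_comm]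

theorem contDiff_affineResolvent (hK : ∀ f, IsUnit (1 - (K₀ + K₁ f))) {n : WithTop ℕ∞} :
    ContDiff ℝ n (affineResolvent K₀ K₁) := by
  rw [contDiff_iff_contDiffAt]
  intro f
  obtain ⟨w, hw⟩ := hK f
  have h1 := contDiffAt_ringInverse ℝ (n := n) w
  rw [hw] at h1
  exact h1.comp f (contDiffAt_const.sub (contDiffAt_const.add K₁.contDiff.contDiffAt))

variable (K₀ K₁) in
/-- The squared modulus of a functional of the solution `(1 - K₀ - K₁ f)⁻¹ y`. -/
def resolventFidelity (L : X →L[ℝ] ℂ) (y : X) (f : H) : ℝ :=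
  ‖L (affineResolvent K₀ K₁ f y)‖ ^ 2

theorem contDiff_resolventFidelity (hK : ∀ f, IsUnit (1 - (K₀ + K₁ f))) (L : X →L[ℝ] ℂ) (y : X)
    {n : WithTop ℕ∞} : ContDiff ℝ n (resolventFidelity K₀ K₁ L y) := by
  refine ContDiff.norm_sq ℝ (L.contDiff.comp ?_)
  exact (contDiff_affineResolvent hK).clm_apply contDiff_const

theorem fderiv_resolventFidelity (hK : ∀ f, IsUnit (1 - (K₀ + K₁ f))) (L : X →L[ℝ] ℂ) (y : X)
    (f β : H) :
    fderiv ℝ (resolventFidelity K₀ K₁ L y) f β =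
      2 * ⟪L (affineResolvent K₀ K₁ f y),
        L (affineResolvent K₀ K₁ f (K₁ β (affineResolvent K₀ K₁ f y)))⟫_ℝ := by
  obtain ⟨D, hD, hD'⟩ := hasFDerivAt_affineResolvent_apply (hK f) y
  have h := (L.hasFDerivAt.comp f hD).norm_sq
  have h2 : fderiv ℝ (resolventFidelity K₀ K₁ L y) f = _ := h.fderiv
  rw [h2]
  simp [hD']
  ring

variable [CompleteSpace H]

/-- The derivative of a squared modulus pairs the amplitude with its first variation; the hypothesis
says that this variation vanishes. -/
theorem hasGradientAt_resolventFidelity_zero (hK : ∀ f, IsUnit (1 - (K₀ + K₁ f)))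
    {L : X →L[ℝ] ℂ} {y : X}
    (h0 : ∀ β, L (affineResolvent K₀ K₁ 0 (K₁ β (affineResolvent K₀ K₁ 0 y))) = 0) :
    HasGradientAt (resolventFidelity K₀ K₁ L y) 0 0 := by
  rw [hasGradientAt_iff_hasFDerivAt]
  have h := ((contDiff_resolventFidelity hK L y (n := 1)).differentiable
    (by norm_num) 0).hasFDerivAt
  have h2 : fderiv ℝ (resolventFidelity K₀ K₁ L y) 0 = 0 := by
    ext β
    rw [fderiv_resolventFidelity hK, h0]
    simp
  rw [h2] at h
  rwa [map_zero]

/-- The gradient is the Riesz map applied to the derivative. Over `ℝ` the conjugate-linear Riesz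
isometry is linear; `D` is that map in the form the chain rule needs. -/
theorem ContDiff.hasFDerivAt_gradient {F : H → ℝ} (hF : ContDiff ℝ 2 F) (x : H) :
    ∃ D : StrongDual ℝ H →L[ℝ] H, (∀ ℓ β, ⟪D ℓ, β⟫_ℝ = ℓ β) ∧
      HasFDerivAt (gradient F) (D.comp (fderiv ℝ (fderiv ℝ F) x)) x := by
  have hd : DifferentiableAt ℝ (fderiv ℝ F) x :=
    ((hF.fderiv_right (m := 1) (by norm_num)).differentiable (by norm_num)) x
  let D : StrongDual ℝ H →L[ℝ] H :=
    LinearMap.mkContinuous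
      { toFun := (InnerProductSpace.toDual ℝ H).symm
        map_add' := map_add _
        map_smul' := fun c x => by simp } 1 (fun x => by simp)
  exact ⟨D, fun ℓ β => InnerProductSpace.toDual_symm_apply, D.hasFDerivAt.comp x hd.hasFDerivAt⟩

theorem inner_hessian_eq {F : H → ℝ} (hF : ContDiff ℝ 2 F) (x α β : H) :
    ⟪hessian F x α, β⟫_ℝ = fderiv ℝ (fun f => fderiv ℝ F f β) x α := by
  have hd : DifferentiableAt ℝ (fderiv ℝ F) x :=
    ((hF.fderiv_right (m := 1) (by norm_num)).differentiable (by norm_num)) x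
  obtain ⟨D, hD, hg⟩ := hF.hasFDerivAt_gradient x
  have h2 : fderiv ℝ (fun f => fderiv ℝ F f β) x α = fderiv ℝ (fderiv ℝ F) x α β := by
    rw [fderiv_clm_apply hd (by fun_prop)]
    simp
  rw [hessian, hg.fderiv, h2]
  exact hD _ _

/-- When the first-order amplitude vanishes, the product of two first variations drops out of the
second derivative, leaving the amplitude paired with the symmetrised second Dyson term. -/
theorem inner_hessian_resolventFidelity_zero (hK : ∀ f, IsUnit (1 - (K₀ + K₁ f)))
    {L : X →L[ℝ] ℂ} {y : X}
    (h0 : ∀ β, L (affineResolvent K₀ K₁ 0 (K₁ β (affineResolvent K₀ K₁ 0 y))) = 0) (α β : H) :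
    ⟪hessian (resolventFidelity K₀ K₁ L y) 0 α, β⟫_ℝ =
      2 * ⟪L (affineResolvent K₀ K₁ 0 y),
        L (affineResolvent K₀ K₁ 0 (K₁ α (affineResolvent K₀ K₁ 0
          (K₁ β (affineResolvent K₀ K₁ 0 y))))) +
        L (affineResolvent K₀ K₁ 0 (K₁ β (affineResolvent K₀ K₁ 0
          (K₁ α (affineResolvent K₀ K₁ 0 y)))))⟫_ℝ := by
  rw [inner_hessian_eq (contDiff_resolventFidelity hK L y)]
  simp_rw [fderiv_resolventFidelity hK]
  obtain ⟨D, hD, hD'⟩ := hasFDerivAt_affineResolvent_apply (hK 0) y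
  obtain ⟨D2, hD2, hD2'⟩ := hasFDerivAt_affineResolvent_apply_apply (hK 0) β y
  have h4 := ((L.hasFDerivAt.comp 0 hD).inner ℝ (L.hasFDerivAt.comp 0 hD2)).const_mul 2
  refine (congrArg (fun A => A α) h4.fderiv).trans ?_
  have h5 : L (D α) = 0 := by rw [hD', h0]
  simp only [_root_.smul_apply, ContinuousLinearMap.comp_apply,
    ContinuousLinearMap.prod_apply, fderivInnerCLM_apply, Function.comp_apply, h5, hD2',
    inner_zero_left, add_zero, map_add, smul_eq_mul]

end ResolventCalculus

/-! ### Fubini on a triangle and variation of constants -/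

/-- Lebesgue measure on the square `(0,t]²`. -/
abbrev squareMeasure (t : ℝ) : Measure (ℝ × ℝ) :=
  (volume.restrict (Ioc 0 t)).prod (volume.restrict (Ioc 0 t))

/-- The open triangle below the diagonal. -/
def lowerTriangle : Set (ℝ × ℝ) := {p | p.2 < p.1}

theorem measurableSet_lowerTriangle : MeasurableSet lowerTriangle :=
  measurableSet_lt measurable_snd measurable_fst

section Triangle

variable {E : Type*} [NormedAddCommGroup E] [NormedSpace ℝ E] {F : ℝ × ℝ → E} {t : ℝ}

theorem setIntegral_lowerTriangle (ht : 0 ≤ t) (hF : Integrable F (squareMeasure t)) :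
    ∫ p in lowerTriangle, F p ∂(squareMeasure t) =
      ∫ s in (0 : ℝ)..t, ∫ r in (0 : ℝ)..s, F (s, r) := by
  rw [← integral_indicator measurableSet_lowerTriangle,
    integral_prod _ (hF.indicator measurableSet_lowerTriangle),
    intervalIntegral.integral_of_le ht]
  refine setIntegral_congr_fun measurableSet_Ioc fun s hs => ?_
  have hIoo : ∫ r in Ioc 0 s, F (s, r) = ∫ r in Ioo 0 s, F (s, r) := integral_Ioc_eq_integral_Ioo
  rw [intervalIntegral.integral_of_le hs.1.le, hIoo]
  have : ∀ r, lowerTriangle.indicator F (s, r) = (Iio s).indicator (fun r => F (s, r)) r :=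
    fun r => by by_cases h : r < s <;> simp [h, lowerTriangle]
  simp_rw [this]
  rw [setIntegral_indicator measurableSet_Iio]
  congr 2
  ext r
  simp only [mem_Ioo, mem_inter_iff, mem_Ioc, mem_Iio]
  exact ⟨fun h => ⟨h.1.1, h.2⟩, fun h => ⟨⟨h.1, h.2.le.trans hs.2⟩, h.2⟩⟩

theorem setIntegral_lowerTriangle' (ht : 0 ≤ t) (hF : Integrable F (squareMeasure t)) :
    ∫ p in lowerTriangle, F p ∂(squareMeasure t) =
      ∫ r in (0 : ℝ)..t, ∫ s in r..t, F (s, r) := by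
  rw [← integral_indicator measurableSet_lowerTriangle,
    integral_prod_symm _ (hF.indicator measurableSet_lowerTriangle),
    intervalIntegral.integral_of_le ht]
  refine setIntegral_congr_fun measurableSet_Ioc fun r hr => ?_
  rw [intervalIntegral.integral_of_le hr.2]
  have : ∀ s, lowerTriangle.indicator F (s, r) = (Ioi r).indicator (fun s => F (s, r)) s :=
    fun s => by by_cases h : r < s <;> simp [h, lowerTriangle]
  simp_rw [this]
  rw [setIntegral_indicator measurableSet_Ioi]
  congr 2
  ext s
  simp only [mem_inter_iff, mem_Ioc, mem_Ioi]
  exact ⟨fun h => ⟨h.2, h.1.2⟩, fun h => ⟨⟨hr.1.trans h.1, h.2⟩, h.1⟩⟩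

/-- The integral over the square, folded along the diagonal. -/
theorem integral_square_eq_lowerTriangle (hF : Integrable F (squareMeasure t)) :
    ∫ p, F p ∂(squareMeasure t) =
      ∫ p in lowerTriangle, (F p + F p.swap) ∂(squareMeasure t) := by
  have hswap : Integrable (fun p : ℝ × ℝ => F p.swap) (squareMeasure t) := hF.swap
  rw [integral_add hF.integrableOn hswap.integrableOn,
    ← integral_add_compl measurableSet_lowerTriangle hF]
  congr 1
  rw [← integral_indicator measurableSet_lowerTriangle.compl,
    ← integral_indicator measurableSet_lowerTriangle, ← integral_prod_swap]
  refine integral_congr_ae ?_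
  have hdiag : ∀ᵐ p ∂(squareMeasure t), p.1 ≠ p.2 := by
    have hm : MeasurableSet {p : ℝ × ℝ | p.1 = p.2} := measurableSet_eq_fun measurable_fst
      measurable_snd
    have h0 : squareMeasure t {p : ℝ × ℝ | p.1 = p.2} = 0 := by
      rw [Measure.prod_apply hm]
      refine lintegral_eq_zero_of_ae_eq_zero (.of_forall fun x => ?_)
      have : Prod.mk x ⁻¹' {p : ℝ × ℝ | p.1 = p.2} = {x} := by
        ext y
        simp [eq_comm]
      simp [this]
    simpa [ae_iff] using h0
  filter_upwards [hdiag] with p hp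
  by_cases h : p.2 < p.1
  · have h1 : p ∈ lowerTriangle := h
    have h2 : p.swap ∈ lowerTriangleᶜ := not_lt.2 (show p.2 ≤ p.1 from h.le)
    rw [indicator_of_mem h1, indicator_of_mem h2]
  · have h1 : p ∉ lowerTriangle := h
    have h2 : p.swap ∉ lowerTriangleᶜ := not_not.2
      (show p.1 < p.2 from lt_of_le_of_ne (not_lt.1 h) hp)
    rw [indicator_of_notMem h1, indicator_of_notMem h2]

end Triangle

theorem hasDerivAt_cexp_mul (c : ℂ) (s : ℝ) :
    HasDerivAt (fun s : ℝ => Complex.exp (c * s)) (c * Complex.exp (c * s)) s := by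
  have h : HasDerivAt (fun s : ℝ => c * (s : ℂ)) c s := by
    simpa using! (Complex.ofRealCLM.hasDerivAt (x := s)).const_mul c
  simpa [mul_comm] using! h.cexp

theorem integral_mul_cexp_mul (c : ℂ) (r t : ℝ) :
    ∫ s in r..t, c * Complex.exp (c * s) = Complex.exp (c * t) - Complex.exp (c * r) :=
  intervalIntegral.integral_eq_sub_of_hasDerivAt (fun s _ => hasDerivAt_cexp_mul c s)
    (Continuous.intervalIntegrable (by fun_prop) _ _)

/-- Variation of constants for a scalar linear equation with integrable inhomogeneity. -/
theorem variation_of_constants (c : ℂ) {g : ℝ → ℂ} {t : ℝ} (ht : 0 ≤ t)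
    (hg : IntervalIntegrable g volume 0 t) :
    ∫ s in (0 : ℝ)..t, Complex.exp (c * (t - s)) * g s =
      (∫ s in (0 : ℝ)..t, g s) +
        c * ∫ s in (0 : ℝ)..t, ∫ r in (0 : ℝ)..s, Complex.exp (c * (s - r)) * g r := by
  have hg' : IntervalIntegrable (fun r : ℝ => Complex.exp (-c * r) * g r) volume 0 t :=
    hg.continuousOn_mul (Continuous.continuousOn (by fun_prop))
  have h1 : IntegrableOn (fun s : ℝ => c * Complex.exp (c * s)) (Ioc 0 t) :=
    (Continuous.integrableOn_Icc (by fun_prop)).mono_set Ioc_subset_Icc_self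
  have h2 : IntegrableOn (fun r : ℝ => Complex.exp (-c * r) * g r) (Ioc 0 t) :=
    (intervalIntegrable_iff_integrableOn_Ioc_of_le ht).1 hg'
  have hsplit : ∀ s r : ℝ, Complex.exp (c * (s - r)) = Complex.exp (c * s) * Complex.exp (-c * r) :=
    fun s r => by rw [← Complex.exp_add]; ring_nf
  have hF : Integrable (fun p : ℝ × ℝ => (c * Complex.exp (c * p.1)) *
    (Complex.exp (-c * p.2) * g p.2)) (squareMeasure t) := h1.mul_prod h2
  -- After the exchange of order the inner integral is elementary, and the double integral becomes
  -- `∫ (exp (c (t - r)) - 1) g r`.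
  have h3 := (setIntegral_lowerTriangle ht hF).symm.trans (setIntegral_lowerTriangle' ht hF)
  have h4 : c * ∫ s in (0 : ℝ)..t, ∫ r in (0 : ℝ)..s, Complex.exp (c * (s - r)) * g r =
      ∫ s in (0 : ℝ)..t, ∫ r in (0 : ℝ)..s,
        (c * Complex.exp (c * s)) * (Complex.exp (-c * r) * g r) := by
    simp_rw [← intervalIntegral.integral_const_mul]
    refine intervalIntegral.integral_congr fun s _ => intervalIntegral.integral_congr fun r _ => ?_
    simp only [hsplit]
    ring
  rw [h4, h3, ← intervalIntegral.integral_add hg]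
  · refine intervalIntegral.integral_congr fun r _ => ?_
    simp only [intervalIntegral.integral_mul_const, integral_mul_cexp_mul, hsplit]
    have : Complex.exp (c * r) * Complex.exp (-c * r) = 1 := by rw [← Complex.exp_add]; simp
    linear_combination (g r) * this
  · simp only [intervalIntegral.integral_mul_const, integral_mul_cexp_mul]
    exact hg'.continuousOn_mul (Continuous.continuousOn (by fun_prop))

/-! ### The Schrödinger equation as a fixed-point equation -/

section Evolution

variable {T : ℝ} {n : ℕ}

/-- The constant control `1`. -/
def oneControl (T : ℝ) : ControlSpace T :=
  (memLp_of_continuous_Ioo T (continuous_const (y := (1 : ℝ)))).toLp fun _ => 1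

/-- The generator `v ↦ -i H v`, as a real-linear operator. -/
def matGen (H : Matrix (Fin n) (Fin n) ℂ) : (Fin n → ℂ) →L[ℝ] (Fin n → ℂ) :=
  (LinearMap.toContinuousLinearMap (-Complex.I • H).mulVecLin).restrictScalars ℝ

theorem matGen_apply (H : Matrix (Fin n) (Fin n) ℂ) (v : Fin n → ℂ) :
    matGen H v = (-Complex.I) • (H *ᵥ v) := by
  simp only [matGen, ContinuousLinearMap.coe_restrictScalars', LinearMap.coe_toContinuousLinearMap',
    mulVecLin_apply, smul_mulVec]

variable (hT : 0 ≤ T) (H₀ H₁ : Matrix (Fin n) (Fin n) ℂ)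

/-- The integrated drift term of the Schrödinger equation. -/
def driftOp : C(Icc (0 : ℝ) T, Fin n → ℂ) →L[ℝ] C(Icc (0 : ℝ) T, Fin n → ℂ) :=
  postComp T (matGen H₀) * primitive hT (oneControl T)

/-- The integrated control term of the Schrödinger equation. -/
def controlOp : ControlSpace T →L[ℝ]
    C(Icc (0 : ℝ) T, Fin n → ℂ) →L[ℝ] C(Icc (0 : ℝ) T, Fin n → ℂ) :=
  (ContinuousLinearMap.compL ℝ _ _ _ (postComp T (matGen H₁))).comp (primitive hT)

/-- The drift is treated as a control frozen at `1`, so both terms are primitives followed by a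
fixed matrix, hence of Volterra type. -/
theorem isUnit_one_sub_generator (f : ControlSpace T) :
    IsUnit (1 - (driftOp hT H₀ + controlOp hT H₁ f)) :=
  (((isVolterra_primitive hT _).postComp _).add
    ((isVolterra_primitive hT f).postComp _)).isUnit_one_sub

theorem driftOp_apply (u : C(Icc (0 : ℝ) T, Fin n → ℂ)) (t : Icc (0 : ℝ) T) (j : Fin n) :
    driftOp hT H₀ u t j = ∫ s in (0 : ℝ)..t, -Complex.I * (H₀ *ᵥ IccExtend hT u s) j := by
  have hu := IccExtend_continuousMap hT u
  have h0 : (0 : ℝ) ∈ Icc 0 T := ⟨le_rfl, hT⟩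
  have h1 : primitive hT (oneControl T) u t = ∫ s in (0 : ℝ)..t, IccExtend hT u s := by
    rw [primitive_apply]
    refine intervalIntegral_congr_ae_Ioo ?_ h0 t.2
    filter_upwards [(memLp_of_continuous_Ioo T (continuous_const (y := (1 : ℝ)))).coeFn_toLp]
      with s hs
    rw [oneControl, hs, one_smul]
  have h2 : driftOp hT H₀ u t j =
      ((ContinuousLinearMap.proj (R := ℝ) (φ := fun _ : Fin n => ℂ) j).comp (matGen H₀))
        (primitive hT (oneControl T) u t) := rfl
  rw [h2, h1, ← ContinuousLinearMap.intervalIntegral_comp_comm _ (hu.intervalIntegrable _ _)]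
  simp [matGen_apply]

theorem controlOp_apply (f : ControlSpace T) (u : C(Icc (0 : ℝ) T, Fin n → ℂ))
    (t : Icc (0 : ℝ) T) (j : Fin n) :
    controlOp hT H₁ f u t j =
      ∫ s in (0 : ℝ)..t, -Complex.I * ((f s : ℂ) * (H₁ *ᵥ IccExtend hT u s) j) := by
  have hu := IccExtend_continuousMap hT u
  have h0 : (0 : ℝ) ∈ Icc 0 T := ⟨le_rfl, hT⟩
  have h2 : controlOp hT H₁ f u t j =
      ((ContinuousLinearMap.proj (R := ℝ) (φ := fun _ : Fin n => ℂ) j).comp (matGen H₁))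
        (primitive hT f u t) := rfl
  rw [h2, primitive_apply,
    ← ContinuousLinearMap.intervalIntegral_comp_comm _ (f.intervalIntegrable_smul hu h0 t.2)]
  refine intervalIntegral.integral_congr fun s _ => ?_
  simp only [ContinuousLinearMap.comp_apply, ContinuousLinearMap.proj_apply, matGen_apply,
    mulVec_smul, Pi.smul_apply, Complex.real_smul, smul_eq_mul]

theorem affineResolvent_eq_iff (f : ControlSpace T) (y u : C(Icc (0 : ℝ) T, Fin n → ℂ)) :
    affineResolvent (driftOp hT H₀) (controlOp hT H₁) f y = u ↔
      u = y + (driftOp hT H₀ u + controlOp hT H₁ f u) := by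
  have h := isUnit_one_sub_generator hT H₀ H₁ f
  constructor
  · rintro rfl
    have := congrArg (fun A => A y) (Ring.mul_inverse_cancel _ h)
    simp only [mul_apply_eq_comp, _root_.sub_apply] at this
    exact sub_eq_iff_eq_add.1 this
  · intro hu
    have := congrArg (fun A => A u) (Ring.inverse_mul_cancel _ h)
    simp only [mul_apply_eq_comp, _root_.sub_apply] at this
    have hy : (1 - (driftOp hT H₀ + controlOp hT H₁ f)) u = y := sub_eq_iff_eq_add.2 hu
    exact (congrArg _ hy.symm).trans this

theorem generator_apply (f : ControlSpace T) (u : C(Icc (0 : ℝ) T, Fin n → ℂ))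
    (t : Icc (0 : ℝ) T) (j : Fin n) :
    (driftOp hT H₀ u + controlOp hT H₁ f u) t j =
      - Complex.I * ∫ s in (0 : ℝ)..t,
        ((H₀ + ((f s : ℝ) : ℂ) • H₁) *ᵥ IccExtend hT u s) j := by
  have hu := IccExtend_continuousMap hT u
  have h0 : (0 : ℝ) ∈ Icc 0 T := ⟨le_rfl, hT⟩
  rw [ContinuousMap.add_apply, Pi.add_apply, driftOp_apply, controlOp_apply,
    ← intervalIntegral.integral_add, ← intervalIntegral.integral_const_mul]
  · refine intervalIntegral.integral_congr fun s _ => ?_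
    simp only [add_mulVec, smul_mulVec, Pi.add_apply, Pi.smul_apply, smul_eq_mul]
    ring
  · exact Continuous.intervalIntegrable (by fun_prop) _ _
  · have := f.intervalIntegrable_smul (v := fun s => -Complex.I * (H₁ *ᵥ IccExtend hT u s) j)
      (by fun_prop) h0 t.2
    refine this.congr fun s _ => ?_
    simp only [Complex.real_smul]
    ring

/-- The solution of the Schrödinger equation with initial vector `ψ`. -/
def evolution (ψ : Fin n → ℂ) (f : ControlSpace T) : C(Icc (0 : ℝ) T, Fin n → ℂ) :=
  affineResolvent (driftOp hT H₀) (controlOp hT H₁) f (ContinuousMap.const _ ψ)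

theorem eq_evolution_iff (ψ : Fin n → ℂ) (f : ControlSpace T)
    (u : C(Icc (0 : ℝ) T, Fin n → ℂ)) :
    evolution hT H₀ H₁ ψ f = u ↔ ∀ t : Icc (0 : ℝ) T, ∀ j, u t j = ψ j -
      Complex.I * ∫ s in (0 : ℝ)..t, ((H₀ + ((f s : ℝ) : ℂ) • H₁) *ᵥ IccExtend hT u s) j := by
  rw [evolution, affineResolvent_eq_iff]
  constructor
  · intro h t j
    have := congrFun (DFunLike.congr_fun h t) j
    rw [this, ContinuousMap.add_apply, Pi.add_apply, generator_apply]
    simp [sub_eq_add_neg]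
  · intro h
    ext t j
    rw [h, ContinuousMap.add_apply, Pi.add_apply, generator_apply]
    simp [sub_eq_add_neg]

/-- The matrix equation decouples into columns, each a vector equation with a basis vector as
initial value. Nothing is asserted outside `[0,T]`, so uniqueness can only hold there. -/
theorem isPropagator_iff (f : ControlSpace T) (U : ℝ → Matrix (Fin n) (Fin n) ℂ) :
    IsPropagator H₀ H₁ T f U ↔ ∀ t : Icc (0 : ℝ) T, ∀ j k,
      U t j k = evolution hT H₀ H₁ (Pi.single k 1) f t j := by
  constructor
  · rintro ⟨hc, hU⟩ t j k
    have hcol : ContinuousOn (fun t j => U t j k) (Icc 0 T) := by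
      rw [continuousOn_pi]
      exact fun j => (continuous_id.matrix_elem j k).comp_continuousOn hc
    let u : C(Icc (0 : ℝ) T, Fin n → ℂ) := ⟨_, continuousOn_iff_continuous_domRestrict.1 hcol⟩
    have hu : ∀ s (hs : s ∈ Icc 0 T), IccExtend hT u s = fun j => U s j k := fun s hs => by
      rw [IccExtend_of_mem hT _ hs]; rfl
    rw [(eq_evolution_iff hT H₀ H₁ (Pi.single k 1) f u).2]
    · rfl
    · intro t j
      have : u t j = U t j k := rfl
      rw [this, hU t t.2 j k, Matrix.one_apply, Pi.single_apply]
      congr 2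
      refine intervalIntegral.integral_congr fun s hs => ?_
      rw [uIcc_of_le t.2.1] at hs
      simp only [hu s ⟨hs.1, hs.2.trans t.2.2⟩]
      rfl
  · intro hU
    have hsol := fun k => (eq_evolution_iff hT H₀ H₁ (Pi.single k 1) f _).1 rfl
    refine ⟨?_, fun t ht j k => ?_⟩
    · rw [continuousOn_iff_continuous_domRestrict]
      refine continuous_matrix fun j k => ?_
      refine Continuous.congr ?_ (fun t => (hU t j k).symm)
      exact (continuous_apply j).comp (ContinuousMap.continuous _)
    · rw [hU ⟨t, ht⟩ j k, hsol, Matrix.one_apply, Pi.single_apply]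
      congr 2
      refine intervalIntegral.integral_congr fun s hs => ?_
      rw [uIcc_of_le ht.1] at hs
      have hs' : s ∈ Icc 0 T := ⟨hs.1, hs.2.trans ht.2⟩
      simp only [IccExtend_of_mem hT _ hs', Matrix.mul_apply, mulVec, dotProduct]
      exact Finset.sum_congr rfl fun i _ => by rw [hU ⟨s, hs'⟩ i k]

theorem exists_isPropagator (hT : 0 ≤ T) (f : ControlSpace T) : ∃ U, IsPropagator H₀ H₁ T f U :=
  ⟨fun t => Matrix.of fun j k => IccExtend hT (evolution hT H₀ H₁ (Pi.single k 1) f) t j,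
    (isPropagator_iff hT H₀ H₁ f _).2 fun t j k => by simp⟩

theorem IsPropagator.eqOn {f : ControlSpace T} {U U' : ℝ → Matrix (Fin n) (Fin n) ℂ}
    (hU : IsPropagator H₀ H₁ T f U) (hU' : IsPropagator H₀ H₁ T f U') :
    EqOn U' U (Icc 0 T) := fun t ht => by
  have hT : 0 ≤ T := ht.1.trans ht.2
  ext j k
  exact ((isPropagator_iff hT H₀ H₁ f _).1 hU' ⟨t, ht⟩ j k).trans
    ((isPropagator_iff hT H₀ H₁ f _).1 hU ⟨t, ht⟩ j k).symm

theorem isPropagator_propagator (hT : 0 ≤ T) (f : ControlSpace T) :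
    IsPropagator H₀ H₁ T f (propagator H₀ H₁ T f) :=
  Classical.epsilon_spec (p := IsPropagator H₀ H₁ T f) (exists_isPropagator H₀ H₁ hT f)

theorem intervalIntegrable_generator (f : ControlSpace T) {v : ℝ → Fin n → ℂ}
    (hv : ContinuousOn v (Icc 0 T)) {t : ℝ} (ht : t ∈ Icc 0 T) (j : Fin n) :
    IntervalIntegrable (fun s => ((H₀ + ((f s : ℝ) : ℂ) • H₁) *ᵥ v s) j) volume 0 t := by
  have h0 : (0 : ℝ) ∈ Icc 0 T := ⟨le_rfl, ht.1.trans ht.2⟩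
  have hv' : ContinuousOn v (uIcc 0 t) := by
    rw [uIcc_of_le ht.1]
    exact hv.mono (Icc_subset_Icc_right ht.2)
  have hm : ∀ M : Matrix (Fin n) (Fin n) ℂ, ContinuousOn (fun s => (M *ᵥ v s) j) (uIcc 0 t) :=
    fun M => ((continuous_apply j).comp
      (Continuous.matrix_mulVec continuous_const continuous_id)).comp_continuousOn hv'
  have hf : IntervalIntegrable (fun s => ((f s : ℝ) : ℂ)) volume 0 t := by
    have := f.intervalIntegrable h0 ht
    exact ⟨this.1.ofReal, this.2.ofReal⟩
  have h1 := (hm H₀).intervalIntegrable (μ := volume)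
  refine (h1.add (hf.mul_continuousOn (hm H₁))).congr fun s _ => ?_
  simp only [add_mulVec, smul_mulVec, Pi.add_apply, Pi.smul_apply, smul_eq_mul]

theorem IsPropagator.mulVec_apply {f : ControlSpace T} {U : ℝ → Matrix (Fin n) (Fin n) ℂ}
    (hU : IsPropagator H₀ H₁ T f U) (ψ : Fin n → ℂ) {t : ℝ} (ht : t ∈ Icc 0 T) (j : Fin n) :
    (U t *ᵥ ψ) j = ψ j -
      Complex.I * ∫ s in (0 : ℝ)..t, ((H₀ + ((f s : ℝ) : ℂ) • H₁) *ᵥ (U s *ᵥ ψ)) j := by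
  have h2 : ∀ s, ((H₀ + ((f s : ℝ) : ℂ) • H₁) *ᵥ (U s *ᵥ ψ)) j =
      ∑ k, ((H₀ + ((f s : ℝ) : ℂ) • H₁) * U s) j k * ψ k := fun s => by
    rw [mulVec_mulVec]
    rfl
  have h3 : ∀ k, IntervalIntegrable (fun s => ((H₀ + ((f s : ℝ) : ℂ) • H₁) * U s) j k * ψ k)
      volume 0 t := fun k =>
    (intervalIntegrable_generator H₀ H₁ f (v := fun s i => U s i k)
      (continuousOn_pi.2 fun i => (continuous_id.matrix_elem i k).comp_continuousOn hU.1)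
      ht j).mul_const _
  have h4 : (U t *ᵥ ψ) j = ∑ k, U t j k * ψ k := rfl
  rw [h4, intervalIntegral.integral_congr fun s _ => h2 s,
    intervalIntegral.integral_finsetSum fun k _ => h3 k, Finset.mul_sum]
  have h5 : ψ j = ∑ k, (1 : Matrix (Fin n) (Fin n) ℂ) j k * ψ k := by simp [Matrix.one_apply]
  conv_rhs => rw [h5]
  rw [← Finset.sum_sub_distrib]
  refine Finset.sum_congr rfl fun k _ => ?_
  rw [hU.2 t ht j k, intervalIntegral.integral_mul_const]
  ring

theorem IsPropagator.mulVec_eq {f : ControlSpace T} {U : ℝ → Matrix (Fin n) (Fin n) ℂ}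
    (hU : IsPropagator H₀ H₁ T f U) (ψ : Fin n → ℂ) (t : Icc (0 : ℝ) T) :
    U t *ᵥ ψ = evolution hT H₀ H₁ ψ f t := by
  have hc : ContinuousOn (fun t => U t *ᵥ ψ) (Icc 0 T) :=
    (continuous_id.matrix_mulVec continuous_const).comp_continuousOn hU.1
  let u : C(Icc (0 : ℝ) T, Fin n → ℂ) := ⟨_, continuousOn_iff_continuous_domRestrict.1 hc⟩
  have hu : ∀ s (hs : s ∈ Icc 0 T), IccExtend hT u s = U s *ᵥ ψ := fun s hs => by
    rw [IccExtend_of_mem hT _ hs]; rfl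
  have key : evolution hT H₀ H₁ ψ f = u := by
    refine (eq_evolution_iff hT H₀ H₁ ψ f u).2 fun t j => ?_
    refine (hU.mulVec_apply H₀ H₁ ψ t.2 j).trans ?_
    congr 2
    refine intervalIntegral.integral_congr fun s hs => ?_
    rw [uIcc_of_le t.2.1] at hs
    simp only [hu s ⟨hs.1, hs.2.trans t.2.2⟩]
  rw [key]
  rfl

/-- The functional `u ↦ ⟨φ, u(T)⟩`. -/
def finalOverlap (φ : Fin n → ℂ) : C(Icc (0 : ℝ) T, Fin n → ℂ) →L[ℝ] ℂ :=
  (LinearMap.toContinuousLinearMap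
    { toFun := fun v => star φ ⬝ᵥ v
      map_add' := fun v w => dotProduct_add (star φ) v w
      map_smul' := fun c v => by simp [dotProduct_smul] }).comp (ContinuousMap.evalCLM ℝ (⟨T, hT, le_rfl⟩ : Icc (0 : ℝ) T))

theorem finalOverlap_apply (φ : Fin n → ℂ) (u : C(Icc (0 : ℝ) T, Fin n → ℂ)) :
    finalOverlap hT φ u = star φ ⬝ᵥ u ⟨T, hT, le_rfl⟩ := rfl

/-- This links the chosen propagator of the definition to the resolvent, so that the differential
calculus above applies. -/
theorem pureFidelity_eq (ψ φ : Fin n → ℂ) :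
    pureFidelity H₀ H₁ ψ φ T = resolventFidelity (driftOp hT H₀) (controlOp hT H₁)
      (finalOverlap hT φ) (ContinuousMap.const _ ψ) := by
  ext f
  rw [pureFidelity, (isPropagator_propagator H₀ H₁ hT f).mulVec_eq hT H₀ H₁ ψ ⟨T, hT, le_rfl⟩]
  rfl

/-- The explicit phases solve the fixed-point equation, whose solution is unique. -/
theorem evolution_zero_diagonal (h : Fin n → ℂ) (ψ : Fin n → ℂ) (t : Icc (0 : ℝ) T)
    (j : Fin n) :
    affineResolvent (driftOp hT (diagonal h)) (controlOp hT H₁) 0 (ContinuousMap.const _ ψ) t j =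
      Complex.exp (-Complex.I * h j * t) * ψ j := by
  let u : C(Icc (0 : ℝ) T, Fin n → ℂ) :=
    ⟨fun t j => Complex.exp (-Complex.I * h j * t) * ψ j, by fun_prop⟩
  rw [(affineResolvent_eq_iff hT (diagonal h) H₁ 0 _ u).2]
  · rfl
  ext t j
  have h1 : ∀ s ∈ uIcc 0 (t : ℝ), -Complex.I * (diagonal h *ᵥ IccExtend hT u s) j =
      ((-Complex.I * h j) * Complex.exp (-Complex.I * h j * s)) * ψ j := fun s hs => by
    rw [uIcc_of_le t.2.1] at hs
    rw [IccExtend_of_mem hT _ ⟨hs.1, hs.2.trans t.2.2⟩, mulVec_diagonal]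
    simp only [u, ContinuousMap.coe_mk]
    ring
  rw [map_zero, _root_.zero_apply, add_zero, ContinuousMap.add_apply, Pi.add_apply,
    driftOp_apply, intervalIntegral.integral_congr h1, intervalIntegral.integral_mul_const,
    integral_mul_cexp_mul]
  simp only [u, ContinuousMap.coe_mk, ContinuousMap.const_apply, Complex.ofReal_zero, mul_zero,
    Complex.exp_zero]
  ring

/-- Duhamel's formula for a diagonal drift. -/
theorem affineResolvent_zero_controlOp (h : Fin n → ℂ) (f : ControlSpace T)
    (u : C(Icc (0 : ℝ) T, Fin n → ℂ)) (t : Icc (0 : ℝ) T) (j : Fin n) :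
    affineResolvent (driftOp hT (diagonal h)) (controlOp hT H₁) 0 (controlOp hT H₁ f u) t j =
      ∫ s in (0 : ℝ)..t, Complex.exp (-Complex.I * h j * (t - s)) *
        (-Complex.I * ((f s : ℂ) * (H₁ *ᵥ IccExtend hT u s) j)) := by
  have h0 : (0 : ℝ) ∈ Icc 0 T := ⟨le_rfl, hT⟩
  have hu := IccExtend_continuousMap hT u
  have hg : ∀ j, ∀ t ∈ Icc 0 T, IntervalIntegrable
      (fun s => -Complex.I * ((f s : ℂ) * (H₁ *ᵥ IccExtend hT u s) j)) volume 0 t := by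
    intro j t ht
    have := f.intervalIntegrable_smul (v := fun s => -Complex.I * (H₁ *ᵥ IccExtend hT u s) j)
      (by fun_prop) h0 ht
    refine this.congr fun s _ => ?_
    simp only [Complex.real_smul]
    ring
  have hcont : Continuous fun (t : Icc (0 : ℝ) T) (j : Fin n) =>
      ∫ s in (0 : ℝ)..t, Complex.exp (-Complex.I * h j * (t - s)) *
        (-Complex.I * ((f s : ℂ) * (H₁ *ᵥ IccExtend hT u s) j)) := by
    refine continuous_pi fun j => ?_
    have h1 : ∀ t : Icc (0 : ℝ) T, ∫ s in (0 : ℝ)..t, Complex.exp (-Complex.I * h j * (t - s)) *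
        (-Complex.I * ((f s : ℂ) * (H₁ *ᵥ IccExtend hT u s) j)) =
        Complex.exp (-Complex.I * h j * t) * ∫ s in (0 : ℝ)..t,
          Complex.exp (Complex.I * h j * s) *
            (-Complex.I * ((f s : ℂ) * (H₁ *ᵥ IccExtend hT u s) j)) := fun t => by
      rw [← intervalIntegral.integral_const_mul]
      refine intervalIntegral.integral_congr fun s _ => ?_
      rw [← mul_assoc (Complex.exp _) (Complex.exp _), ← Complex.exp_add]
      ring_nf
    simp_rw [h1]
    refine Continuous.mul (by fun_prop) ?_
    have h2 : IntervalIntegrable (fun s : ℝ => Complex.exp (Complex.I * h j * s) *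
        (-Complex.I * ((f s : ℂ) * (H₁ *ᵥ IccExtend hT u s) j))) volume 0 T :=
      (hg j T ⟨hT, le_rfl⟩).continuousOn_mul (Continuous.continuousOn (by fun_prop))
    have := intervalIntegral.continuousOn_primitive_interval' h2 left_mem_uIcc
    rw [uIcc_of_le hT] at this
    exact continuousOn_iff_continuous_domRestrict.1 this
  let w : C(Icc (0 : ℝ) T, Fin n → ℂ) := ⟨_, hcont⟩
  rw [(affineResolvent_eq_iff hT (diagonal h) H₁ 0 _ w).2]
  · rfl
  ext t j
  have h1 : ∀ s ∈ uIcc 0 (t : ℝ), -Complex.I * (diagonal h *ᵥ IccExtend hT w s) j =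
      (-Complex.I * h j) * ∫ r in (0 : ℝ)..s, Complex.exp (-Complex.I * h j * (s - r)) *
        (-Complex.I * ((f r : ℂ) * (H₁ *ᵥ IccExtend hT u r) j)) := fun s hs => by
    rw [uIcc_of_le t.2.1] at hs
    rw [IccExtend_of_mem hT _ ⟨hs.1, hs.2.trans t.2.2⟩, mulVec_diagonal]
    simp only [w, ContinuousMap.coe_mk]
    ring
  rw [map_zero, _root_.zero_apply, add_zero, ContinuousMap.add_apply, Pi.add_apply,
    driftOp_apply, intervalIntegral.integral_congr h1, intervalIntegral.integral_const_mul,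
    controlOp_apply]
  exact variation_of_constants (-Complex.I * h j) t.2.1 (hg j t t.2)

end Evolution

/-! ### Integral kernels and the rank-one forms -/

section KernelForms

variable {T : ℝ}

theorem ControlSpace.integrable_Ioc (f : ControlSpace T) :
    Integrable (f : ℝ → ℝ) (volume.restrict (Ioc 0 T)) :=
  (f.memLp_Ioc le_rfl).integrable (by norm_num)

theorem Continuous.integrable_mul_squareMeasure {𝕜 : Type*} [RCLike 𝕜] {k : ℝ × ℝ → 𝕜}
    (hk : Continuous k) {G : ℝ × ℝ → 𝕜} (hG : Integrable G (squareMeasure T)) :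
    Integrable (fun p => k p * G p) (squareMeasure T) := by
  obtain ⟨C, hC⟩ := (isCompact_Icc (a := ((0 : ℝ), (0 : ℝ)))
    (b := (T, T))).exists_bound_of_continuousOn hk.continuousOn
  refine hG.bdd_mul (c := C) hk.aestronglyMeasurable ?_
  rw [squareMeasure, Measure.prod_restrict]
  filter_upwards [ae_restrict_mem (measurableSet_Ioc.prod measurableSet_Ioc)] with p hp
  exact hC p ⟨⟨hp.1.1.le, hp.2.1.le⟩, ⟨hp.1.2, hp.2.2⟩⟩

theorem ControlSpace.integrable_prod (α β : ControlSpace T) :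
    Integrable (fun p : ℝ × ℝ => α p.1 * β p.2) (squareMeasure T) :=
  α.integrable_Ioc.mul_prod β.integrable_Ioc

theorem inner_toLp (g : C(ℝ, ℝ)) (α : ControlSpace T) :
    ⟪((memLp_of_continuous_Ioo T g.continuous).toLp g : ControlSpace T), α⟫_ℝ =
      ∫ s in Ioc 0 T, g s * α s := by
  rw [L2.inner_def, integral_Ioc_eq_integral_Ioo]
  refine integral_congr_ae ?_
  filter_upwards [(memLp_of_continuous_Ioo T g.continuous).coeFn_toLp] with s hs
  rw [hs]
  simp [mul_comm]

theorem inner_unnormProj_eq_mul (g : C(ℝ, ℝ)) (α β : ControlSpace T) :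
    ⟪unnormProj T g α, β⟫_ℝ =
      (∫ s in Ioc 0 T, g s * α s) * ∫ s in Ioc 0 T, g s * β s := by
  have h2 : unnormProj T g α =
      ⟪((memLp_of_continuous_Ioo T g.continuous).toLp g : ControlSpace T), α⟫_ℝ •
        ((memLp_of_continuous_Ioo T g.continuous).toLp g : ControlSpace T) := by
    simp [unnormProj]
  rw [h2, real_inner_smul_left, inner_toLp, inner_toLp]

theorem inner_unnormProj (g : C(ℝ, ℝ)) (α β : ControlSpace T) :
    ⟪unnormProj T g α, β⟫_ℝ =
      ∫ p : ℝ × ℝ, (g p.1 * g p.2) * (α p.1 * β p.2) ∂(squareMeasure T) := by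
  rw [inner_unnormProj_eq_mul, ← integral_prod_mul]
  refine integral_congr_ae (.of_forall fun p => ?_)
  simp only
  ring

end KernelForms

/-! ### Dyson terms of the four-level system -/

section FourLevel

theorem inv_sqrt_two_mul_self : ((√2 : ℝ) : ℂ)⁻¹ * ((√2 : ℝ) : ℂ)⁻¹ = 1 / 2 := by
  rw [← mul_inv, ← Complex.ofReal_mul, Real.mul_self_sqrt (by norm_num)]
  norm_num

theorem trapTime_pos {ε : ℝ} (hε : 0 < ε) : 0 < trapTime ε := div_pos Real.pi_pos hε

variable {ε : ℝ} (hT : 0 ≤ trapTime ε) (b θ : ℝ)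

/-- The phases of the target are exactly those of free evolution over time `T` and cancel, leaving
the average of `exp (iθ)` and `exp (-iθ)`. -/
theorem trap_zeroth_order :
    finalOverlap hT (trapTarget ε) (affineResolvent (driftOp hT (trapH₀ ε))
      (controlOp hT (trapH₁ b)) 0 (ContinuousMap.const _ (trapInitial θ))) = (Real.cos θ : ℂ) := by
  rw [finalOverlap_apply, dotProduct, Fin.sum_univ_four, trapH₀]
  simp only [evolution_zero_diagonal]
  have h2 : ((√2 : ℝ) : ℂ)⁻¹ * ((√2 : ℝ) : ℂ)⁻¹ = 1 / 2 := inv_sqrt_two_mul_self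
  have h3 : ∀ z : ℂ, Complex.exp z * Complex.exp (-z) = 1 := fun z => by
    rw [← Complex.exp_add]; simp
  simp [trapTarget, trapInitial, ← Complex.exp_conj, map_ofNat]
  rw [Complex.cos]
  have e1 := h3 (Complex.I * trapTime ε * (1 + ε))
  have e2 := h3 (Complex.I * 2 * trapTime ε)
  rw [show Complex.I * (1 + ε) * trapTime ε = Complex.I * trapTime ε * (1 + ε) by ring,
    mul_comm (θ : ℂ), show -(θ : ℂ) * Complex.I = -(Complex.I * θ) by ring]
  linear_combination (((√2 : ℝ) : ℂ)⁻¹ * ((√2 : ℝ) : ℂ)⁻¹ * Complex.exp (Complex.I * θ)) * e1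
    + (((√2 : ℝ) : ℂ)⁻¹ * ((√2 : ℝ) : ℂ)⁻¹ * Complex.exp (-(Complex.I * θ))) * e2
    + (Complex.exp (Complex.I * θ) + Complex.exp (-(Complex.I * θ))) * h2

theorem trapH₁_mulVec (v : Fin 4 → ℂ) :
    trapH₁ b *ᵥ v = ![v 1, v 0 + v 2, v 1 + b * v 3, b * v 2] := by
  ext j
  fin_cases j <;> simp [trapH₁, mulVec, dotProduct, Fin.sum_univ_four]

/-- One action of the control takes levels 0 and 3, where both states live, to levels 1 and 2, where
the target has no component. -/
theorem trap_first_order (β : ControlSpace (trapTime ε)) :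
    finalOverlap hT (trapTarget ε) (affineResolvent (driftOp hT (trapH₀ ε))
      (controlOp hT (trapH₁ b)) 0 (controlOp hT (trapH₁ b) β
        (affineResolvent (driftOp hT (trapH₀ ε)) (controlOp hT (trapH₁ b)) 0
          (ContinuousMap.const _ (trapInitial θ))))) = 0 := by
  rw [finalOverlap_apply, dotProduct, Fin.sum_univ_four, trapH₀]
  simp only [affineResolvent_zero_controlOp]
  simp [trapTarget, trapInitial, trapH₁_mulVec, IccExtend, evolution_zero_diagonal]

/-- The kernel of the second-order term of the Dyson series. -/
def trapDysonKernel (ε b θ : ℝ) (p : ℝ × ℝ) : ℂ :=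
  -(1 / 2) * (Complex.exp (Complex.I * (ε * (p.1 - p.2) + θ)) +
    b ^ 2 * Complex.exp (-(Complex.I * θ)))

theorem continuous_trapDysonKernel : Continuous (trapDysonKernel ε b θ) := by
  unfold trapDysonKernel
  fun_prop

/-- Going from level 0 to level 3 takes three transitions, so at second order only 0→1→0 and 3→2→3
return to the target. The first carries the phase of the gap `ε`, the second none because levels 2
and 3 are degenerate; `(-i)² = -1` gives the sign. -/
theorem trap_second_order (α β : ControlSpace (trapTime ε)) :
    finalOverlap hT (trapTarget ε) (affineResolvent (driftOp hT (trapH₀ ε))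
      (controlOp hT (trapH₁ b)) 0 (controlOp hT (trapH₁ b) α
        (affineResolvent (driftOp hT (trapH₀ ε)) (controlOp hT (trapH₁ b)) 0
          (controlOp hT (trapH₁ b) β
            (affineResolvent (driftOp hT (trapH₀ ε)) (controlOp hT (trapH₁ b)) 0
              (ContinuousMap.const _ (trapInitial θ))))))) =
      ∫ p in lowerTriangle, trapDysonKernel ε b θ p * ((α p.1 * β p.2 : ℝ) : ℂ)
        ∂(squareMeasure (trapTime ε)) := by
  have hP : Integrable (fun p : ℝ × ℝ => ((α p.1 * β p.2 : ℝ) : ℂ))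
    (squareMeasure (trapTime ε)) := (α.integrable_prod β).ofReal
  rw [setIntegral_lowerTriangle hT
    ((continuous_trapDysonKernel b θ).integrable_mul_squareMeasure hP)]
  have h2 : ((√2 : ℝ) : ℂ)⁻¹ * ((√2 : ℝ) : ℂ)⁻¹ = 1 / 2 := inv_sqrt_two_mul_self
  have h0 : (0 : ℝ) ∈ Icc 0 (trapTime ε) := ⟨le_rfl, hT⟩
  have hTT : trapTime ε ∈ Icc 0 (trapTime ε) := ⟨hT, le_rfl⟩
  obtain ⟨u, hu⟩ : ∃ u, u = affineResolvent (driftOp hT (trapH₀ ε)) (controlOp hT (trapH₁ b)) 0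
    (controlOp hT (trapH₁ b) β (affineResolvent (driftOp hT (trapH₀ ε)) (controlOp hT (trapH₁ b)) 0
              (ContinuousMap.const _ (trapInitial θ)))) := ⟨_, rfl⟩
  have hext := IccExtend_continuousMap hT u
  have hu1 : ∀ s ∈ Icc 0 (trapTime ε), IccExtend hT u s 1 = ∫ r in (0 : ℝ)..s,
      Complex.exp (-(Complex.I * (s - r))) * (-Complex.I * (β r *
        (Complex.exp (-(Complex.I * (1 + ε) * r)) *
          ((√2 : ℝ) : ℂ)⁻¹ * Complex.exp (Complex.I * θ)))) := fun s hs => by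
    rw [IccExtend_of_mem hT _ hs, hu, trapH₀, affineResolvent_zero_controlOp]
    refine intervalIntegral.integral_congr fun r hr => ?_
    rw [uIcc_of_le hs.1] at hr
    simp only [IccExtend_of_mem hT _ (⟨hr.1, hr.2.trans hs.2⟩ : r ∈ Icc 0 (trapTime ε)),
      trapH₁_mulVec]
    simp [evolution_zero_diagonal, trapInitial, mul_assoc]
  have hu2 : ∀ s ∈ Icc 0 (trapTime ε), IccExtend hT u s 2 = ∫ r in (0 : ℝ)..s,
      Complex.exp (-(Complex.I * 2 * (s - r))) * (-Complex.I * (β r *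
        (b * (Complex.exp (-(Complex.I * 2 * r)) *
          ((√2 : ℝ) : ℂ)⁻¹ * Complex.exp (-(Complex.I * θ)))))) := fun s hs => by
    rw [IccExtend_of_mem hT _ hs, hu, trapH₀, affineResolvent_zero_controlOp]
    refine intervalIntegral.integral_congr fun r hr => ?_
    rw [uIcc_of_le hs.1] at hr
    simp only [IccExtend_of_mem hT _ (⟨hr.1, hr.2.trans hs.2⟩ : r ∈ Icc 0 (trapTime ε)),
      trapH₁_mulVec]
    simp [evolution_zero_diagonal, trapInitial, mul_assoc]
  have hint : ∀ {v : ℝ → ℂ}, Continuous v → ∀ γ : ControlSpace (trapTime ε),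
      ∀ t ∈ Icc 0 (trapTime ε), IntervalIntegrable (fun s => v s * (γ s : ℂ)) volume 0 t :=
    fun hv γ t ht => by
      refine (γ.intervalIntegrable_smul hv h0 ht).congr fun s _ => ?_
      simp only [Complex.real_smul, mul_comm]
  rw [← hu, finalOverlap_apply, dotProduct, Fin.sum_univ_four, trapH₀]
  simp only [affineResolvent_zero_controlOp]
  simp [trapTarget, trapH₁_mulVec, ← Complex.exp_conj, map_ofNat]
  rw [← intervalIntegral.integral_const_mul, ← intervalIntegral.integral_const_mul,
    ← intervalIntegral.integral_neg, ← intervalIntegral.integral_neg,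
    ← intervalIntegral.integral_add]
  · refine intervalIntegral.integral_congr fun s hs => ?_
    rw [uIcc_of_le hT] at hs
    simp only [hu1 s hs, hu2 s hs, ← intervalIntegral.integral_const_mul,
      ← intervalIntegral.integral_neg]
    rw [← intervalIntegral.integral_add]
    · refine intervalIntegral.integral_congr fun r hr => ?_
      simp only [trapDysonKernel]
      have e1 : Complex.exp (Complex.I * trapTime ε * (1 + ε)) *
          Complex.exp (-(Complex.I * (1 + ε) * (trapTime ε - s))) *
          Complex.exp (-(Complex.I * (s - r))) * Complex.exp (-(Complex.I * (1 + ε) * r)) *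
          Complex.exp (Complex.I * θ) = Complex.exp (Complex.I * (ε * (s - r) + θ)) := by
        simp only [← Complex.exp_add]
        ring_nf
      have e2 : Complex.exp (Complex.I * 2 * trapTime ε) *
          Complex.exp (-(Complex.I * 2 * (trapTime ε - s))) *
          Complex.exp (-(Complex.I * 2 * (s - r))) * Complex.exp (-(Complex.I * 2 * r)) = 1 := by
        simp only [← Complex.exp_add]
        ring_nf
        simp
      linear_combination (((√2 : ℝ) : ℂ)⁻¹ * ((√2 : ℝ) : ℂ)⁻¹ * Complex.I ^ 2 * α s * β r) * e1 +
        (((√2 : ℝ) : ℂ)⁻¹ * ((√2 : ℝ) : ℂ)⁻¹ * Complex.I ^ 2 * α s * β r * b ^ 2 * Complex.exp (-(Complex.I * θ))) * e2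
        + (Complex.I ^ 2 * α s * β r) * (Complex.exp (Complex.I * (ε * (s - r) + θ)) + b ^ 2 * Complex.exp (-(Complex.I * θ))) * h2
        + (1 / 2 * α s * β r) * (Complex.exp (Complex.I * (ε * (s - r) + θ)) + b ^ 2 * Complex.exp (-(Complex.I * θ))) * Complex.I_sq
    · refine (hint (v := fun r : ℝ => -(((√2 : ℝ) : ℂ)⁻¹ *
        Complex.exp (Complex.I * trapTime ε * (1 + ε)) *
        Complex.exp (-(Complex.I * (1 + ε) * (trapTime ε - s))) * Complex.I * α s *
        Complex.exp (-(Complex.I * (s - r))) * -Complex.I *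
        (Complex.exp (-(Complex.I * (1 + ε) * r)) *
          ((√2 : ℝ) : ℂ)⁻¹ * Complex.exp (Complex.I * θ)))) (by fun_prop) β s hs).congr
            fun r _ => ?_
      ring
    · refine (hint (v := fun r : ℝ => -(((√2 : ℝ) : ℂ)⁻¹ *
        Complex.exp (Complex.I * 2 * trapTime ε) *
        Complex.exp (-(Complex.I * 2 * (trapTime ε - s))) * Complex.I * α s * b *
        Complex.exp (-(Complex.I * 2 * (s - r))) * -Complex.I * b *
        (Complex.exp (-(Complex.I * 2 * r)) *
          ((√2 : ℝ) : ℂ)⁻¹ * Complex.exp (-(Complex.I * θ))))) (by fun_prop) β s hs).congr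
            fun r _ => ?_
      ring
  · refine (hint (v := fun s : ℝ => -(((√2 : ℝ) : ℂ)⁻¹ *
        Complex.exp (Complex.I * trapTime ε * (1 + ε)) *
        Complex.exp (-(Complex.I * (1 + ε) * (trapTime ε - s))) * Complex.I *
        IccExtend hT u s 1)) (by fun_prop) α _ hTT).congr fun r _ => ?_
    ring
  · refine (hint (v := fun s : ℝ => -(((√2 : ℝ) : ℂ)⁻¹ *
        Complex.exp (Complex.I * 2 * trapTime ε) *
        Complex.exp (-(Complex.I * 2 * (trapTime ε - s))) * Complex.I * b *
        IccExtend hT u s 2)) (by fun_prop) α _ hTT).congr fun r _ => ?_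
    ring

/-- The kernel of the Hessian at the zero control, up to sign. -/
def trapKernel (ε b θ x : ℝ) : ℝ :=
  Real.cos θ * (Real.cos θ * Real.cos (ε * x) - Real.sin θ * Real.sin (ε * x)) +
    b ^ 2 * Real.cos θ ^ 2

/-- The bracket in the Hessian kernel is `cos (ε x + θ)` expanded by the addition formula. -/
theorem re_trapDysonKernel (p : ℝ × ℝ) :
    2 * (Real.cos θ * (trapDysonKernel ε b θ p).re) = -trapKernel ε b θ (p.1 - p.2) := by
  have h1 : Complex.exp (Complex.I * (ε * (p.1 - p.2) + θ)) =
      Complex.exp (((ε * (p.1 - p.2) + θ : ℝ) : ℂ) * Complex.I) := by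
    push_cast
    ring_nf
  have h2 : Complex.exp (-(Complex.I * θ)) = Complex.exp (((-θ : ℝ) : ℂ) * Complex.I) := by
    push_cast
    ring_nf
  have h3 : trapDysonKernel ε b θ p = ((-(1 / 2) : ℝ) : ℂ) *
      (Complex.exp (((ε * (p.1 - p.2) + θ : ℝ) : ℂ) * Complex.I) +
        ((b ^ 2 : ℝ) : ℂ) * Complex.exp (((-θ : ℝ) : ℂ) * Complex.I)) := by
    rw [trapDysonKernel, h1, h2]
    push_cast
    ring
  rw [h3, Complex.re_ofReal_mul, Complex.add_re, Complex.re_ofReal_mul,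
    Complex.exp_ofReal_mul_I_re, Complex.exp_ofReal_mul_I_re, Real.cos_neg, trapKernel,
    Real.cos_add]
  ring

theorem continuous_trapKernel : Continuous (trapKernel ε b θ) := by
  unfold trapKernel
  fun_prop

variable (ε) in
theorem trapFidelity_eq : trapFidelity ε b θ = resolventFidelity (driftOp hT (trapH₀ ε))
    (controlOp hT (trapH₁ b)) (finalOverlap hT (trapTarget ε))
    (ContinuousMap.const _ (trapInitial θ)) :=
  pureFidelity_eq hT _ _ _ _

/-- Since the zeroth-order amplitude `cos θ` is real, pairing with it keeps only the real part of
the second-order amplitude. -/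
theorem inner_hessian_trapFidelity (hT : 0 ≤ trapTime ε) (b θ : ℝ) (α β : ControlSpace (trapTime ε)) :
    ⟪hessian (trapFidelity ε b θ) 0 α, β⟫_ℝ =
      -∫ p in lowerTriangle, trapKernel ε b θ (p.1 - p.2) * (α p.2 * β p.1 + β p.2 * α p.1)
        ∂(squareMeasure (trapTime ε)) := by
  rw [trapFidelity_eq ε hT, inner_hessian_resolventFidelity_zero
    (isUnit_one_sub_generator hT _ _) (trap_first_order hT b θ), trap_zeroth_order,
    trap_second_order, trap_second_order]
  have hI : ∀ α β : ControlSpace (trapTime ε),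
      Integrable (fun p : ℝ × ℝ => trapDysonKernel ε b θ p * ((α p.1 * β p.2 : ℝ) : ℂ))
        ((squareMeasure (trapTime ε)).restrict lowerTriangle) := fun α β =>
    ((continuous_trapDysonKernel b θ).integrable_mul_squareMeasure
      (α.integrable_prod β).ofReal).integrableOn
  rw [← integral_add (hI α β) (hI β α), ← integral_neg]
  have h1 : ∀ z : ℂ, 2 * ⟪(Real.cos θ : ℂ), z⟫_ℝ = 2 * (Real.cos θ * z.re) := fun z => by
    simp only [Complex.inner, Complex.conj_ofReal, Complex.re_mul_ofReal, mul_comm]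
  rw [h1]
  have h2 := integral_re ((hI α β).add (hI β α))
  simp only [Pi.add_apply, RCLike.re_eq_complex_re] at h2
  rw [← h2, ← integral_const_mul, ← integral_const_mul]
  refine integral_congr_ae (.of_forall fun p => ?_)
  simp only [Complex.add_re, Complex.re_mul_ofReal]
  linear_combination (α p.1 * β p.2 + β p.1 * α p.2) * re_trapDysonKernel b θ p

end FourLevel

/-! ### Fourier series of `|sin|` -/

section FourierSin

theorem integral_cexp_mul_sin (c : ℂ) (hc : c ^ 2 + 1 ≠ 0) :
    ∫ x in (0 : ℝ)..Real.pi, Complex.exp (c * x) * (Real.sin x : ℂ) =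
      (Complex.exp (c * Real.pi) + 1) / (c ^ 2 + 1) := by
  have hd : ∀ x : ℝ, HasDerivAt (fun x : ℝ => Complex.exp (c * x) *
      (c * (Real.sin x : ℂ) - (Real.cos x : ℂ)) / (c ^ 2 + 1))
      (Complex.exp (c * x) * (Real.sin x : ℂ)) x := fun x => by
    have h1 := (Real.hasDerivAt_sin x).ofReal_comp
    have h2 := (Real.hasDerivAt_cos x).ofReal_comp
    have h3 := ((hasDerivAt_cexp_mul c x).mul ((h1.const_mul c).sub h2)).div_const (c ^ 2 + 1)
    refine h3.congr_deriv ?_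
    simp only [Pi.sub_apply]
    field_simp
    push_cast
    ring
  rw [intervalIntegral.integral_eq_sub_of_hasDerivAt (fun x _ => hd x)
    (Continuous.intervalIntegrable (by fun_prop) _ _)]
  simp
  ring

/-- The function `|sin|` on the circle of length `π`. -/
def absSinCircle : C(AddCircle Real.pi, ℂ) where
  toFun := Function.Periodic.lift (f := fun x : ℝ => ((|Real.sin x| : ℝ) : ℂ)) (c := Real.pi)
    fun x => by simp [Real.sin_add_pi]
  continuous_toFun := continuous_coinduced_dom.2
    (show Continuous fun x : ℝ => ((|Real.sin x| : ℝ) : ℂ) by fun_prop)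

theorem absSinCircle_coe (x : ℝ) : absSinCircle (x : AddCircle Real.pi) = ((|Real.sin x| : ℝ) : ℂ) :=
  rfl

/-- On one period `|sin| = sin`, and the boundary term is explicit because `exp (-2 i n π) = 1`. -/
theorem fourierCoeff_absSinCircle (n : ℤ) :
    haveI : Fact (0 < Real.pi) := ⟨Real.pi_pos⟩
    fourierCoeff absSinCircle n = ((2 / (Real.pi * (1 - 4 * (n : ℝ) ^ 2)) : ℝ) : ℂ) := by
  have : Fact (0 < Real.pi) := ⟨Real.pi_pos⟩
  have hpi : (Real.pi : ℂ) ≠ 0 := Complex.ofReal_ne_zero.2 Real.pi_ne_zero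
  have hz : (1 - 4 * (n : ℂ) ^ 2) ≠ 0 := by
    -- Divisibility by 4 excludes a zero of the denominator.
    have : (1 - 4 * n ^ 2 : ℤ) ≠ 0 := by omega
    exact_mod_cast this
  have hc2 : (-(2 * Complex.I * n)) ^ 2 + 1 = 1 - 4 * (n : ℂ) ^ 2 := by
    linear_combination 4 * (n : ℂ) ^ 2 * Complex.I_sq
  rw [fourierCoeff_eq_intervalIntegral absSinCircle n 0, zero_add]
  have h1 : ∀ x ∈ uIcc 0 Real.pi, fourier (-n) (x : AddCircle Real.pi) •
      absSinCircle (x : AddCircle Real.pi) =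
      Complex.exp (-(2 * Complex.I * n) * x) * (Real.sin x : ℂ) := fun x hx => by
    rw [uIcc_of_le Real.pi_pos.le] at hx
    rw [absSinCircle_coe, abs_of_nonneg (Real.sin_nonneg_of_mem_Icc hx), fourier_coe_apply,
      smul_eq_mul]
    congr 2
    push_cast
    field_simp
  rw [intervalIntegral.integral_congr h1, integral_cexp_mul_sin _ (by rw [hc2]; exact hz), hc2]
  have h2 : Complex.exp (-(2 * Complex.I * n) * Real.pi) = 1 := by
    rw [Complex.exp_eq_one_iff]
    exact ⟨-n, by push_cast; ring⟩
  rw [h2]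
  push_cast
  rw [Complex.real_smul]
  push_cast
  field_simp
  norm_num

/-- The coefficients of `|sin|` are summable, so its Fourier series converges at every point;
opposite frequencies combine into cosines and the mean value `2/π` is moved to the right. -/
theorem hasSum_cos_sub_sin {y : ℝ} (hy : y ∈ Icc 0 Real.pi) :
    HasSum (fun k : ℕ => 4 / (Real.pi * (4 * ((k + 1 : ℕ) : ℝ) ^ 2 - 1)) *
      Real.cos (2 * ((k + 1 : ℕ) : ℝ) * y)) (2 / Real.pi - Real.sin y) := by
  have : Fact (0 < Real.pi) := ⟨Real.pi_pos⟩
  have hs : Summable (fourierCoeff absSinCircle) := by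
    have h1 : Summable fun n : ℤ => 1 / |(n : ℝ)| ^ 2 := by
      simpa using Real.summable_one_div_int_pow.2 (by norm_num : 1 < 2)
    refine Summable.of_norm_bounded_eventually h1 ?_
    have : ∀ᶠ n : ℤ in Filter.cofinite, n ≠ 0 := by
      rw [Filter.eventually_cofinite]
      simp
    filter_upwards [this] with n hn
    rw [fourierCoeff_absSinCircle, Complex.norm_real, Real.norm_eq_abs, sq_abs]
    have hn1 : (1 : ℝ) ≤ (n : ℝ) ^ 2 := by
      have : 1 ≤ n ^ 2 := by have := sq_pos_of_ne_zero hn; omega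
      exact_mod_cast this
    rw [abs_div, abs_mul, abs_of_pos Real.pi_pos, abs_of_neg (by linarith : 1 - 4 * (n : ℝ) ^ 2 < 0),
      abs_two, div_le_div_iff₀ (mul_pos Real.pi_pos (by linarith)) (by linarith)]
    nlinarith [Real.pi_gt_three]
  have h2 : HasSum (fun n : ℤ => 2 / (Real.pi * (1 - 4 * (n : ℝ) ^ 2)) * Real.cos (2 * n * y))
      (Real.sin y) := by
    have h := Complex.hasSum_re
      (has_pointwise_sum_fourier_series_of_summable hs (y : AddCircle Real.pi))
    rw [absSinCircle_coe, Complex.ofReal_re,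
      abs_of_nonneg (Real.sin_nonneg_of_mem_Icc hy)] at h
    refine h.congr_fun ?_
    intro n
    rw [fourierCoeff_absSinCircle, smul_eq_mul, Complex.re_ofReal_mul, fourier_coe_apply,
      ← Complex.exp_ofReal_mul_I_re]
    congr 3
    have hpi : (Real.pi : ℂ) ≠ 0 := Complex.ofReal_ne_zero.2 Real.pi_ne_zero
    push_cast
    field_simp
  -- Pairing `n` with `-n` over `ℕ` counts `n = 0` twice, so the sum gains an extra zeroth term;
  -- dropping index 0 then starts the series at `k + 1`.
  have h3 := h2.nat_add_neg
  rw [← hasSum_nat_add_iff' 1] at h3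
  have h4 := h3.neg
  have hval : -(Real.sin y + 2 / (Real.pi * (1 - 4 * ((0 : ℤ) : ℝ) ^ 2)) *
      Real.cos (2 * ((0 : ℤ) : ℝ) * y) - ∑ i ∈ Finset.range 1,
        (2 / (Real.pi * (1 - 4 * ((i : ℤ) : ℝ) ^ 2)) * Real.cos (2 * ((i : ℤ) : ℝ) * y) +
          2 / (Real.pi * (1 - 4 * ((-(i : ℤ) : ℤ) : ℝ) ^ 2)) *
            Real.cos (2 * ((-(i : ℤ) : ℤ) : ℝ) * y))) = 2 / Real.pi - Real.sin y := by
    simp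
  rw [hval] at h4
  refine h4.congr_fun fun k => ?_
  have hk : (0 : ℝ) < 4 * ((k + 1 : ℕ) : ℝ) ^ 2 - 1 := by
    push_cast
    nlinarith [k.cast_nonneg (α := ℝ)]
  simp only [Int.cast_neg, Int.cast_natCast, even_two.neg_pow, mul_neg, neg_mul, Real.cos_neg]
  have hk' : 1 - 4 * ((k + 1 : ℕ) : ℝ) ^ 2 ≠ 0 := by linarith
  have := hk.ne'
  have := Real.pi_ne_zero
  field_simp
  ring

end FourierSin

/-! ### The eigen-expansion of the Hessian -/

section Expansion

variable {T : ℝ}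

theorem norm_unnormProj_le (hT : 0 ≤ T) {g : C(ℝ, ℝ)} (hg : ∀ x, |g x| ≤ 1) :
    ‖unnormProj T g‖ ≤ T := by
  have h1 : ‖((memLp_of_continuous_Ioo T g.continuous).toLp g : ControlSpace T)‖ ^ 2 ≤ T := by
    rw [← ControlSpace.integral_sq_eq hT, intervalIntegral_congr_ae_Ioo
      (h := fun s => g s ^ 2) ?_ ⟨le_rfl, hT⟩ ⟨hT, le_rfl⟩]
    · calc ∫ s in (0 : ℝ)..T, g s ^ 2 ≤ ∫ s in (0 : ℝ)..T, (1 : ℝ) := by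
            refine intervalIntegral.integral_mono_on hT
              (Continuous.intervalIntegrable (by fun_prop) _ _) (by simp) fun s _ => ?_
            rw [← sq_abs]
            exact pow_le_one₀ (abs_nonneg _) (hg s)
        _ = T := by simp
    · filter_upwards [(memLp_of_continuous_Ioo T g.continuous).coeFn_toLp] with s hs
      rw [hs]
  simpa [unnormProj, pow_two] using h1

/-- The addition formula for the cosine turns a sine–cosine pair of rank-one kernels into a kernel
of the difference of the variables. -/
theorem inner_unnormProj_sin_add_cos (ω : ℝ) (α β : ControlSpace T) :
    ⟪(unnormProj T (sinMap ω) + unnormProj T (cosMap ω)) α, β⟫_ℝ =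
      ∫ p : ℝ × ℝ, Real.cos (ω * (p.1 - p.2)) * (α p.1 * β p.2) ∂(squareMeasure T) := by
  have hi : ∀ g : C(ℝ, ℝ), Integrable (fun p : ℝ × ℝ => (g p.1 * g p.2) * (α p.1 * β p.2))
      (squareMeasure T) := fun g => Continuous.integrable_mul_squareMeasure
    (k := fun p : ℝ × ℝ => g p.1 * g p.2) (by fun_prop) (α.integrable_prod β)
  rw [_root_.add_apply, inner_add_left, inner_unnormProj, inner_unnormProj,
    ← integral_add (hi _) (hi _)]
  refine integral_congr_ae (.of_forall fun p => ?_)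
  simp only [sinMap, cosMap, ContinuousMap.coe_mk]
  rw [mul_sub, Real.cos_sub]
  ring

theorem abs_trapCoeff_succ_le (b θ : ℝ) (k : ℕ) :
    |trapCoeff b θ (k + 1)| ≤ 1 / ((k + 1 : ℕ) : ℝ) ^ 2 := by
  have hk : (1 : ℝ) ≤ ((k + 1 : ℕ) : ℝ) := by exact_mod_cast Nat.le_add_left 1 k
  have hk2 : (0 : ℝ) < 4 * ((k + 1 : ℕ) : ℝ) ^ 2 - 1 := by nlinarith
  rw [trapCoeff, if_neg (Nat.succ_ne_zero k), abs_neg, abs_div, abs_mul, abs_two,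
    abs_of_pos (mul_pos Real.pi_pos hk2), div_le_div_iff₀ (mul_pos Real.pi_pos hk2) (by positivity)]
  have h1 := Real.abs_sin_le_one (2 * θ)
  have h2 := Real.pi_gt_three
  have h3 : 0 ≤ ((k + 1 : ℕ) : ℝ) ^ 2 := by positivity
  calc 2 * |Real.sin (2 * θ)| * ((k + 1 : ℕ) : ℝ) ^ 2 ≤ 2 * 1 * ((k + 1 : ℕ) : ℝ) ^ 2 := by gcongr
    _ ≤ 3 * (4 * ((k + 1 : ℕ) : ℝ) ^ 2 - 1) := by nlinarith
    _ ≤ 1 * (Real.pi * (4 * ((k + 1 : ℕ) : ℝ) ^ 2 - 1)) := by nlinarith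

theorem summable_one_div_succ_sq : Summable fun k : ℕ => 1 / ((k + 1 : ℕ) : ℝ) ^ 2 :=
  (summable_nat_add_iff 1).2 (Real.summable_one_div_nat_pow.2 one_lt_two)

/-- The coefficients decay like `k⁻²` and each rank-one operator has norm at most `T`, so the series
converges absolutely in operator norm. -/
theorem summable_trapCoeff_smul (hT : 0 ≤ T) (b θ : ℝ) (ω : ℕ → ℝ) :
    Summable fun k : ℕ => trapCoeff b θ (k + 1) •
      (unnormProj T (sinMap (ω k)) + unnormProj T (cosMap (ω k))) := by
  refine Summable.of_norm_bounded (g := fun k : ℕ => 1 / ((k + 1 : ℕ) : ℝ) ^ 2 * (T + T))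
    (summable_one_div_succ_sq.mul_right _) fun k => ?_
  rw [norm_smul, Real.norm_eq_abs]
  refine mul_le_mul (abs_trapCoeff_succ_le b θ k) ?_ (norm_nonneg _) (by positivity)
  exact (norm_add_le _ _).trans (add_le_add
    (norm_unnormProj_le hT fun x => Real.abs_sin_le_one _)
    (norm_unnormProj_le hT fun x => Real.abs_cos_le_one _))

/-- The Fourier expansion of the Hessian kernel. -/
theorem hasSum_trapKernel {ε : ℝ} (hε : 0 < ε) (b θ : ℝ) {x : ℝ} (hx : |x| ≤ trapTime ε) :
    HasSum (fun k : ℕ => trapCoeff b θ (k + 1) * Real.cos (2 * ((k + 1 : ℕ) : ℝ) * ε * x))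
      (-trapKernel ε b θ |x| - trapCoeff b θ 0 + Real.cos θ ^ 2 * Real.cos (ε * x)) := by
  have hy : ε * |x| ∈ Icc 0 Real.pi := by
    refine ⟨by positivity, ?_⟩
    rw [trapTime, le_div_iff₀ hε] at hx
    linarith
  -- The factor comes from `sin θ cos θ = sin (2θ) / 2`, the coefficient of `sin (ε |x|)` in minus
  -- the kernel. The condition `|x| ≤ π/ε` keeps the argument in `[0, π]`, where `|sin|` is `sin`.
  have h := (hasSum_cos_sub_sin hy).mul_left (-(Real.sin (2 * θ) / 2))
  have hval : -(Real.sin (2 * θ) / 2) * (2 / Real.pi - Real.sin (ε * |x|)) =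
      -trapKernel ε b θ |x| - trapCoeff b θ 0 + Real.cos θ ^ 2 * Real.cos (ε * x) := by
    have hc : Real.cos (ε * x) = Real.cos (ε * |x|) := by
      rw [← Real.cos_abs, abs_mul, abs_of_pos hε]
    rw [hc, trapKernel, trapCoeff, if_pos rfl, Real.sin_two_mul]
    ring
  rw [hval] at h
  refine h.congr_fun fun k => ?_
  have hc : Real.cos (2 * ((k + 1 : ℕ) : ℝ) * ε * x) =
      Real.cos (2 * ((k + 1 : ℕ) : ℝ) * (ε * |x|)) := by
    rw [← Real.cos_abs, abs_mul, abs_mul, abs_of_pos hε,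
      abs_of_nonneg (by positivity : (0 : ℝ) ≤ 2 * ((k + 1 : ℕ) : ℝ)), mul_assoc]
  rw [hc, trapCoeff, if_neg (Nat.succ_ne_zero k)]
  ring

/-- Unfolding the triangle to the square makes the kernel even in the difference of the variables,
which is what its cosine expansion requires. -/
theorem inner_hessian_trapFidelity_square {ε : ℝ} (hT : 0 ≤ trapTime ε) (b θ : ℝ)
    (α β : ControlSpace (trapTime ε)) :
    ⟪hessian (trapFidelity ε b θ) 0 α, β⟫_ℝ =
      ∫ p : ℝ × ℝ, -trapKernel ε b θ |p.1 - p.2| * (α p.1 * β p.2)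
        ∂(squareMeasure (trapTime ε)) := by
  have hk : Continuous fun p : ℝ × ℝ => -trapKernel ε b θ |p.1 - p.2| :=
    ((continuous_trapKernel b θ).comp (by fun_prop)).neg
  rw [integral_square_eq_lowerTriangle (hk.integrable_mul_squareMeasure (α.integrable_prod β)),
    inner_hessian_trapFidelity hT, ← integral_neg]
  refine setIntegral_congr_fun measurableSet_lowerTriangle fun p hp => ?_
  have h1 : |p.1 - p.2| = p.1 - p.2 := abs_of_pos (sub_pos.2 hp)
  simp only [Prod.fst_swap, Prod.snd_swap, abs_sub_comm p.2 p.1, h1]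
  ring

theorem ae_squareMeasure_abs_sub_le (T : ℝ) :
    ∀ᵐ p ∂(squareMeasure T), |p.1 - p.2| ≤ T := by
  rw [squareMeasure, Measure.prod_restrict]
  filter_upwards [ae_restrict_mem (measurableSet_Ioc.prod measurableSet_Ioc)] with p hp
  rw [abs_le]
  constructor <;> linarith [hp.1.1, hp.1.2, hp.2.1, hp.2.2]

/-- Both operators are compared through their bilinear forms, where the pointwise expansion of the
kernel is integrated term by term. -/
theorem hessian_trapFidelity_eq {ε : ℝ} (hε : 0 < ε) (b θ : ℝ) :
    hessian (trapFidelity ε b θ) 0 =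
      trapCoeff b θ 0 • unnormProj (trapTime ε) 1
      + (∑' k : ℕ, trapCoeff b θ (k + 1) •
          (unnormProj (trapTime ε) (sinMap (2 * ((k + 1 : ℕ) : ℝ) * ε))
            + unnormProj (trapTime ε) (cosMap (2 * ((k + 1 : ℕ) : ℝ) * ε))))
      - Real.cos θ ^ 2 •
          (unnormProj (trapTime ε) (sinMap ε) + unnormProj (trapTime ε) (cosMap ε)) := by
  have hT := (trapTime_pos hε).le
  refine ContinuousLinearMap.ext fun α => ext_inner_right ℝ fun β => ?_
  have hsum := (summable_trapCoeff_smul hT b θ fun k => 2 * ((k + 1 : ℕ) : ℝ) * ε).hasSum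
  have h1 := ((innerSL ℝ β).comp (ContinuousLinearMap.apply ℝ (ControlSpace (trapTime ε))
    α)).hasSum hsum
  have hG := α.integrable_prod β
  have hcos : ∀ ω : ℝ, Integrable (fun p : ℝ × ℝ => Real.cos (ω * (p.1 - p.2)) *
      (α p.1 * β p.2)) (squareMeasure (trapTime ε)) := fun ω =>
    Continuous.integrable_mul_squareMeasure (k := fun p : ℝ × ℝ => Real.cos (ω * (p.1 - p.2)))
      (by fun_prop) hG
  have h2 := hasSum_integral_of_summable_integral_norm (μ := squareMeasure (trapTime ε))
    (F := fun (k : ℕ) (p : ℝ × ℝ) => trapCoeff b θ (k + 1) *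
      (Real.cos (2 * ((k + 1 : ℕ) : ℝ) * ε * (p.1 - p.2)) * (α p.1 * β p.2)))
    (fun k => (hcos _).const_mul _) (by
      refine Summable.of_nonneg_of_le (fun k => integral_nonneg fun p => norm_nonneg _)
        (fun k => ?_) (summable_one_div_succ_sq.mul_right
          (∫ p : ℝ × ℝ, ‖α p.1 * β p.2‖ ∂(squareMeasure (trapTime ε))))
      rw [← integral_const_mul]
      refine integral_mono_of_nonneg (.of_forall fun p => norm_nonneg _) (hG.norm.const_mul _)
        (.of_forall fun p => ?_)
      simp only [norm_mul, Real.norm_eq_abs]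
      refine mul_le_mul (abs_trapCoeff_succ_le b θ k) ?_ (by positivity) (by positivity)
      exact mul_le_of_le_one_left (by positivity) (Real.abs_cos_le_one _))
  have h3 : ∀ k : ℕ, ((innerSL ℝ β).comp (ContinuousLinearMap.apply ℝ (ControlSpace (trapTime ε))
      α)) (trapCoeff b θ (k + 1) • (unnormProj (trapTime ε) (sinMap (2 * ((k + 1 : ℕ) : ℝ) * ε))
            + unnormProj (trapTime ε) (cosMap (2 * ((k + 1 : ℕ) : ℝ) * ε)))) =
      ∫ p : ℝ × ℝ, trapCoeff b θ (k + 1) *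
      (Real.cos (2 * ((k + 1 : ℕ) : ℝ) * ε * (p.1 - p.2)) * (α p.1 * β p.2))
        ∂(squareMeasure (trapTime ε)) := fun k => by
    rw [integral_const_mul, ← inner_unnormProj_sin_add_cos, ← real_inner_smul_left,
      real_inner_comm]
    rfl
  -- The same scalar series is summed in two ways: as the integral of the summed kernel, and as the
  -- operator sum tested on `α` and `β`.
  have h4 := (h2.congr_fun h3).unique h1
  have h5 : ((innerSL ℝ β).comp (ContinuousLinearMap.apply ℝ (ControlSpace (trapTime ε))
      α)) (∑' k : ℕ, trapCoeff b θ (k + 1) •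
          (unnormProj (trapTime ε) (sinMap (2 * ((k + 1 : ℕ) : ℝ) * ε))
            + unnormProj (trapTime ε) (cosMap (2 * ((k + 1 : ℕ) : ℝ) * ε)))) =
      ⟪(∑' k : ℕ, trapCoeff b θ (k + 1) •
          (unnormProj (trapTime ε) (sinMap (2 * ((k + 1 : ℕ) : ℝ) * ε))
            + unnormProj (trapTime ε) (cosMap (2 * ((k + 1 : ℕ) : ℝ) * ε)))) α, β⟫_ℝ := by
    rw [real_inner_comm]
    rfl
  rw [_root_.sub_apply, _root_.add_apply, inner_sub_left, inner_add_left, ← h5, ← h4,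
    _root_.smul_apply, _root_.smul_apply, real_inner_smul_left, real_inner_smul_left,
    inner_unnormProj_sin_add_cos, inner_unnormProj, inner_hessian_trapFidelity_square hT,
    ← integral_const_mul, ← integral_const_mul]
  have hk : Continuous fun p : ℝ × ℝ =>
      -trapKernel ε b θ |p.1 - p.2| - trapCoeff b θ 0 +
        Real.cos θ ^ 2 * Real.cos (ε * (p.1 - p.2)) :=
    (((continuous_trapKernel b θ).comp (by fun_prop)).neg.sub continuous_const).add (by fun_prop)
  have h6 : ∫ p : ℝ × ℝ, ∑' k : ℕ, trapCoeff b θ (k + 1) *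
      (Real.cos (2 * ((k + 1 : ℕ) : ℝ) * ε * (p.1 - p.2)) * (α p.1 * β p.2))
        ∂(squareMeasure (trapTime ε)) =
      ∫ p : ℝ × ℝ, (-trapKernel ε b θ |p.1 - p.2| - trapCoeff b θ 0 +
        Real.cos θ ^ 2 * Real.cos (ε * (p.1 - p.2))) * (α p.1 * β p.2)
        ∂(squareMeasure (trapTime ε)) := by
    refine integral_congr_ae ?_
    filter_upwards [ae_squareMeasure_abs_sub_le (trapTime ε)] with p hp
    refine (((hasSum_trapKernel hε b θ hp).mul_right (α p.1 * β p.2)).congr_fun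
      fun k => ?_).tsum_eq
    ring
  have h7 : Integrable (fun p : ℝ × ℝ => trapCoeff b θ 0 * ((1 : C(ℝ, ℝ)) p.1 *
      (1 : C(ℝ, ℝ)) p.2 * (α p.1 * β p.2))) (squareMeasure (trapTime ε)) := by
    simpa using hG.const_mul (trapCoeff b θ 0)
  have h8 := hk.integrable_mul_squareMeasure hG
  rw [h6, ← integral_add h7 h8]
  refine Eq.trans ?_ (integral_sub (h7.add h8) ((hcos ε).const_mul (Real.cos θ ^ 2)))
  refine integral_congr_ae (.of_forall fun p => ?_)
  simp only [ContinuousMap.one_apply]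
  ring

/-- The Hessian as an integral operator on the triangle. -/
theorem inner_hessian_trapFidelity_triangle {ε : ℝ} (hT : 0 ≤ trapTime ε) (b θ : ℝ)
    (α β : ControlSpace (trapTime ε)) :
    ⟪hessian (trapFidelity ε b θ) 0 α, β⟫_ℝ =
      ⟪(-(b ^ 2 * Real.cos θ ^ 2)) • unnormProj (trapTime ε) 1 α, β⟫_ℝ
      - ∫ τ in (0 : ℝ)..trapTime ε, ∫ σ in (0 : ℝ)..τ,
          Real.cos θ * (Real.cos θ * Real.cos (ε * (τ - σ))
            - Real.sin θ * Real.sin (ε * (τ - σ))) * (α σ * β τ + β σ * α τ) := by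
  have hG := α.integrable_prod β
  have hS : Integrable (fun p : ℝ × ℝ => α p.2 * β p.1 + β p.2 * α p.1)
      (squareMeasure (trapTime ε)) := by
    refine (hG.swap.add hG).congr (.of_forall fun p => ?_)
    simp only [Pi.add_apply, Function.comp_apply, Prod.fst_swap, Prod.snd_swap]
    ring
  have h1 := Continuous.integrable_mul_squareMeasure (T := trapTime ε) (k := fun p : ℝ × ℝ =>
    Real.cos θ * (Real.cos θ * Real.cos (ε * (p.1 - p.2))
            - Real.sin θ * Real.sin (ε * (p.1 - p.2)))) (by fun_prop) hS
  have h2 := setIntegral_lowerTriangle hT h1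
  simp only at h2
  rw [← h2, real_inner_smul_left, inner_unnormProj]
  simp only [ContinuousMap.one_apply, one_mul]
  rw [integral_square_eq_lowerTriangle hG, inner_hessian_trapFidelity hT, neg_mul,
    ← integral_const_mul, sub_eq_add_neg, ← neg_add, ← integral_add _ h1.integrableOn]
  · congr 1
    refine integral_congr_ae (.of_forall fun p => ?_)
    simp only [trapKernel, Prod.fst_swap, Prod.snd_swap]
    ring
  · refine (hS.const_mul (b ^ 2 * Real.cos θ ^ 2)).integrableOn.congr (.of_forall fun p => ?_)
    simp only [Prod.fst_swap, Prod.snd_swap]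
    ring

end Expansion

/-! ### Negative definiteness and infinite rank -/

section NegativeDefinite

variable {T : ℝ}

/-- Completeness of the trigonometric system of period `T` in `L²(0,T)`. -/
theorem ControlSpace.eq_zero_of_trig_coeff_eq_zero (hT : 0 < T) (α : ControlSpace T)
    (hc : ∀ k : ℕ, ∫ s in Ioc 0 T, Real.cos (2 * k * (Real.pi / T) * s) * α s = 0)
    (hs : ∀ k : ℕ, ∫ s in Ioc 0 T, Real.sin (2 * k * (Real.pi / T) * s) * α s = 0) : α = 0 := by
  have hα := α.integrable_Ioc
  have hI : ∀ g : ℝ → ℝ, Continuous g → Integrable (fun s => ((g s * α s : ℝ) : ℂ))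
      (volume.restrict (Ioc 0 T)) := fun g hg => by
    have := α.intervalIntegrable_smul hg ⟨le_rfl, hT.le⟩ ⟨hT.le, le_rfl⟩
    rw [intervalIntegrable_iff_integrableOn_Ioc_of_le hT.le] at this
    exact (this.congr (.of_forall fun s => mul_comm _ _)).ofReal
  have hcoeff : ∀ n : ℤ, fourierCoeffOn hT (fun s => ((α s : ℝ) : ℂ)) n = 0 := by
    intro n
    rw [fourierCoeffOn_eq_integral]
    have hcn : ∫ s in Ioc 0 T, Real.cos (2 * n * (Real.pi / T) * s) * α s = 0 := by
      obtain ⟨m, rfl | rfl⟩ := n.eq_nat_or_neg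
      · exact_mod_cast hc m
      · refine Eq.trans ?_ (hc m)
        refine integral_congr_ae (.of_forall fun s => ?_)
        simp only [Int.cast_neg, Int.cast_natCast, mul_neg, neg_mul, Real.cos_neg]
    have hsn : ∫ s in Ioc 0 T, Real.sin (2 * n * (Real.pi / T) * s) * α s = 0 := by
      obtain ⟨m, rfl | rfl⟩ := n.eq_nat_or_neg
      · exact_mod_cast hs m
      · rw [← neg_eq_zero, ← integral_neg]
        refine Eq.trans ?_ (hs m)
        refine integral_congr_ae (.of_forall fun s => ?_)
        simp only [Int.cast_neg, Int.cast_natCast, mul_neg, neg_mul, Real.sin_neg, neg_neg]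
    have h1 : ∀ s : ℝ, fourier (-n) (s : AddCircle (T - 0)) • ((α s : ℝ) : ℂ) =
        ((Real.cos (2 * n * (Real.pi / T) * s) * α s : ℝ) : ℂ) -
          Complex.I * ((Real.sin (2 * n * (Real.pi / T) * s) * α s : ℝ) : ℂ) := fun s => by
      have h2 : (2 * Real.pi * Complex.I * ((-n : ℤ) : ℂ) * s / ((T - 0 : ℝ) : ℂ)) =
          ((-(2 * n * (Real.pi / T) * s) : ℝ) : ℂ) * Complex.I := by
        push_cast
        ring
      rw [fourier_coe_apply, h2, Complex.exp_mul_I, ← Complex.ofReal_cos, ← Complex.ofReal_sin,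
        Real.cos_neg, Real.sin_neg, smul_eq_mul]
      push_cast
      ring
    simp only [h1]
    rw [intervalIntegral.integral_of_le hT.le, integral_sub (hI _ (by fun_prop))
      ((hI _ (by fun_prop)).const_mul _), integral_const_mul, integral_complex_ofReal, integral_complex_ofReal,
      hcn, hsn]
    simp
  have hmem : MemLp (fun s => ((α s : ℝ) : ℂ)) 2 (volume.restrict (Ioc 0 T)) :=
    (α.memLp_Ioc le_rfl).ofReal
  have h := hasSum_sq_fourierCoeffOn hT hmem
  simp only [hcoeff, norm_zero, ne_eq, OfNat.ofNat_ne_zero, not_false_eq_true, zero_pow] at h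
  have h2 := h.unique hasSum_zero
  have h3 : ∫ s in (0 : ℝ)..T, ‖((α s : ℝ) : ℂ)‖ ^ 2 = ‖α‖ ^ 2 := by
    rw [← ControlSpace.integral_sq_eq hT.le]
    simp
  rw [h3, smul_eq_mul, sub_zero] at h2
  have h4 : ‖α‖ ^ 2 = 0 := (mul_eq_zero.1 h2).resolve_left (inv_ne_zero hT.ne')
  exact norm_eq_zero.1 (pow_eq_zero_iff (two_ne_zero) |>.1 h4)

/-- Every term of the quadratic form is nonpositive, so a nonnegative value forces all coefficients
of `α` in the complete trigonometric system to vanish. The terms of frequency `ε` only help. -/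
theorem isNegDef_hessian_trapFidelity {ε : ℝ} (hε : 0 < ε) {b θ : ℝ}
    (ha : ∀ k : ℕ, trapCoeff b θ k < 0) : IsNegDef (hessian (trapFidelity ε b θ) 0) := by
  intro α hα
  by_contra! hcon
  have hT := trapTime_pos hε
  have hsum := (summable_trapCoeff_smul hT.le b θ fun k => 2 * ((k + 1 : ℕ) : ℝ) * ε).hasSum
  have h1 := ((innerSL ℝ α).comp (ContinuousLinearMap.apply ℝ (ControlSpace (trapTime ε))
    α)).hasSum hsum
  have hsq : ∀ g : C(ℝ, ℝ), ⟪α, unnormProj (trapTime ε) g α⟫_ℝ =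
      (∫ s in Ioc 0 (trapTime ε), g s * α s) ^ 2 := fun g => by
    rw [real_inner_comm, inner_unnormProj_eq_mul, pow_two]
  have hterm : ∀ k : ℕ, ((innerSL ℝ α).comp (ContinuousLinearMap.apply ℝ
      (ControlSpace (trapTime ε)) α)) (trapCoeff b θ (k + 1) •
        (unnormProj (trapTime ε) (sinMap (2 * ((k + 1 : ℕ) : ℝ) * ε))
          + unnormProj (trapTime ε) (cosMap (2 * ((k + 1 : ℕ) : ℝ) * ε)))) =
      trapCoeff b θ (k + 1) *
        ((∫ s in Ioc 0 (trapTime ε), sinMap (2 * ((k + 1 : ℕ) : ℝ) * ε) s * α s) ^ 2 +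
          (∫ s in Ioc 0 (trapTime ε), cosMap (2 * ((k + 1 : ℕ) : ℝ) * ε) s * α s) ^ 2) :=
    fun k => by
      rw [← hsq, ← hsq, ← inner_add_right, ← real_inner_smul_right]
      rfl
  have h2 := h1.congr_fun fun k => (hterm k).symm
  have hle : ∀ k : ℕ, trapCoeff b θ (k + 1) *
        ((∫ s in Ioc 0 (trapTime ε), sinMap (2 * ((k + 1 : ℕ) : ℝ) * ε) s * α s) ^ 2 +
          (∫ s in Ioc 0 (trapTime ε), cosMap (2 * ((k + 1 : ℕ) : ℝ) * ε) s * α s) ^ 2) ≤ 0 :=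
    fun k => mul_nonpos_of_nonpos_of_nonneg (ha _).le (by positivity)
  have hH : ⟪hessian (trapFidelity ε b θ) 0 α, α⟫_ℝ =
      trapCoeff b θ 0 * (∫ s in Ioc 0 (trapTime ε), (1 : C(ℝ, ℝ)) s * α s) ^ 2 +
      ((innerSL ℝ α).comp (ContinuousLinearMap.apply ℝ (ControlSpace (trapTime ε)) α))
        (∑' k : ℕ, trapCoeff b θ (k + 1) •
          (unnormProj (trapTime ε) (sinMap (2 * ((k + 1 : ℕ) : ℝ) * ε))
            + unnormProj (trapTime ε) (cosMap (2 * ((k + 1 : ℕ) : ℝ) * ε)))) -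
      Real.cos θ ^ 2 * ((∫ s in Ioc 0 (trapTime ε), sinMap ε s * α s) ^ 2 +
        (∫ s in Ioc 0 (trapTime ε), cosMap ε s * α s) ^ 2) := by
    rw [hessian_trapFidelity_eq hε, ← hsq, ← hsq, ← hsq, ← inner_add_right,
      ← real_inner_smul_right, ← real_inner_smul_right, real_inner_comm, _root_.sub_apply,
      _root_.add_apply, inner_sub_right, inner_add_right]
    rfl
  rw [hH] at hcon
  have hS := h2.nonpos hle
  have h0 := mul_nonpos_of_nonpos_of_nonneg (ha 0).le
    (sq_nonneg (∫ s in Ioc 0 (trapTime ε), (1 : C(ℝ, ℝ)) s * α s))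
  have h3 : 0 ≤ Real.cos θ ^ 2 * ((∫ s in Ioc 0 (trapTime ε), sinMap ε s * α s) ^ 2 +
        (∫ s in Ioc 0 (trapTime ε), cosMap ε s * α s) ^ 2) := by positivity
  have hone : ∫ s in Ioc 0 (trapTime ε), (1 : C(ℝ, ℝ)) s * α s = 0 :=
    pow_eq_zero_iff two_ne_zero |>.1
      ((mul_eq_zero.1 (by linarith : trapCoeff b θ 0 * _ ^ 2 = 0)).resolve_left (ha 0).ne)
  have hzero : HasSum (fun k : ℕ => -(trapCoeff b θ (k + 1) *
        ((∫ s in Ioc 0 (trapTime ε), sinMap (2 * ((k + 1 : ℕ) : ℝ) * ε) s * α s) ^ 2 +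
          (∫ s in Ioc 0 (trapTime ε), cosMap (2 * ((k + 1 : ℕ) : ℝ) * ε) s * α s) ^ 2))) 0 := by
    have := h2.neg
    rwa [show ((innerSL ℝ α).comp (ContinuousLinearMap.apply ℝ (ControlSpace (trapTime ε)) α))
        (∑' k : ℕ, trapCoeff b θ (k + 1) •
          (unnormProj (trapTime ε) (sinMap (2 * ((k + 1 : ℕ) : ℝ) * ε))
            + unnormProj (trapTime ε) (cosMap (2 * ((k + 1 : ℕ) : ℝ) * ε)))) = 0 by linarith,
      neg_zero] at this
  have hall := (hasSum_zero_iff_of_nonneg fun k => neg_nonneg.2 (hle k)).1 hzero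
  have hk : ∀ k : ℕ, (∫ s in Ioc 0 (trapTime ε), sinMap (2 * ((k + 1 : ℕ) : ℝ) * ε) s * α s) = 0 ∧
      (∫ s in Ioc 0 (trapTime ε), cosMap (2 * ((k + 1 : ℕ) : ℝ) * ε) s * α s) = 0 := fun k => by
    have := congrFun hall k
    have h5 := (mul_eq_zero.1 (neg_eq_zero.1 this)).resolve_left (ha _).ne
    constructor <;> nlinarith
  -- The choice `T = π/ε` makes the frequencies `2kε` the full set `2πk/T`.
  have hfreq : Real.pi / trapTime ε = ε := by
    rw [trapTime]
    field_simp
  refine hα (α.eq_zero_of_trig_coeff_eq_zero hT ?_ ?_) <;> intro k <;> rw [hfreq] <;>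
    rcases k with _ | k
  · simpa using hone
  · exact (hk k).2
  · simp
  · exact (hk k).1

/-- Polynomials embed: one that vanishes almost everywhere on the interval has infinitely many
roots. -/
theorem ControlSpace.not_finiteDimensional (hT : 0 < T) :
    ¬ FiniteDimensional ℝ (ControlSpace T) := by
  intro hfin
  let Φ : Polynomial ℝ →ₗ[ℝ] ControlSpace T :=
    { toFun := fun p => (memLp_of_continuous_Ioo T p.continuous).toLp fun x => p.eval x
      map_add' := fun p q => by
        rw [← MemLp.toLp_add]
        congr 1
        ext x
        simp
      map_smul' := fun c p => by
        rw [RingHom.id_apply, ← MemLp.toLp_const_smul]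
        congr 1
        ext x
        simp }
  have hinj : Function.Injective Φ := by
    rw [← LinearMap.ker_eq_bot, LinearMap.ker_eq_bot']
    intro p hp
    have h1 : (fun x => p.eval x) =ᵐ[volume.restrict (Ioo 0 T)] fun _ => (0 : ℝ) := by
      refine (MemLp.coeFn_toLp (memLp_of_continuous_Ioo T p.continuous)).symm.trans ?_
      have : (memLp_of_continuous_Ioo T p.continuous).toLp (fun x => p.eval x) = 0 := hp
      rw [this]
      exact Lp.coeFn_zero _ _ _
    have h2 := Measure.eqOn_open_of_ae_eq h1 isOpen_Ioo p.continuous.continuousOn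
      continuousOn_const
    exact Polynomial.eq_zero_of_infinite_isRoot p ((Ioo_infinite hT).mono fun x hx => h2 hx)
  exact Polynomial.not_finite (Module.Finite.of_injective Φ hinj)

/-- Strict negativity makes the operator injective, so its range is isomorphic to `L²(0,T)`. -/
theorem IsNegDef.hasInfiniteRank (hT : 0 < T) {A : ControlSpace T →L[ℝ] ControlSpace T}
    (hA : IsNegDef A) : HasInfiniteRank A := by
  intro hfin
  have hinj : Function.Injective (A : ControlSpace T →ₗ[ℝ] ControlSpace T) := by
    rw [← LinearMap.ker_eq_bot, LinearMap.ker_eq_bot']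
    intro α hα
    by_contra hne
    have := hA α hne
    have h0 : A α = 0 := hα
    rw [h0, inner_zero_left] at this
    exact lt_irrefl _ this
  exact ControlSpace.not_finiteDimensional hT
    (Module.Finite.equiv (LinearEquiv.ofInjective _ hinj).symm)

end NegativeDefinite

/-! ### The second-order test on finite-dimensional subspaces -/

section SecondDerivativeTest

variable {E : Type*} [NormedAddCommGroup E] [InnerProductSpace ℝ E] [CompleteSpace E]

/-- A critical point with negative definite Hessian is a strict local maximum on
finite-dimensional subspaces. -/
theorem IsNegDef.isStrictLocalMaxOnFinDim {F : E → ℝ} (hF : ContDiff ℝ 2 F)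
    (h0 : HasGradientAt F 0 0) (hA : IsNegDef (hessian F 0)) : IsStrictLocalMaxOnFinDim F := by
  intro V hV
  -- This uniform gap is where finite dimension enters, through compactness of the unit sphere; the
  -- empty sphere is the case `V = 0`.
  obtain ⟨c, hc, hcV⟩ : ∃ c : ℝ, 0 < c ∧ ∀ v : V,
      ⟪hessian F 0 (v : E), (v : E)⟫_ℝ ≤ -c * ‖v‖ ^ 2 := by
    have hq : Continuous fun v : V => ⟪hessian F 0 (v : E), (v : E)⟫_ℝ := by fun_prop
    rcases (Metric.sphere (0 : V) 1).eq_empty_or_nonempty with hemp | hne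
    · refine ⟨1, one_pos, fun v => ?_⟩
      have hv : v = 0 := by
        by_contra hv
        have : ‖v‖⁻¹ • v ∈ Metric.sphere (0 : V) 1 := by
          rw [mem_sphere_zero_iff_norm, norm_smul, norm_inv, norm_norm,
            inv_mul_cancel₀ (norm_ne_zero_iff.2 hv)]
        rw [hemp] at this
        exact this
      simp [hv]
    · obtain ⟨w, hw, hmax⟩ := (isCompact_sphere (0 : V) 1).exists_isMaxOn hne hq.continuousOn
      have hw0 : (w : E) ≠ 0 := by
        intro h
        rw [mem_sphere_zero_iff_norm, Submodule.coe_norm, h, norm_zero] at hw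
        exact zero_ne_one hw
      refine ⟨-⟪hessian F 0 (w : E), (w : E)⟫_ℝ, neg_pos.2 (hA _ hw0), fun v => ?_⟩
      rw [neg_neg]
      rcases eq_or_ne v 0 with rfl | hv
      · simp
      have hv' : ‖v‖ ≠ 0 := norm_ne_zero_iff.2 hv
      have h1 : ‖v‖⁻¹ • v ∈ Metric.sphere (0 : V) 1 := by
        rw [mem_sphere_zero_iff_norm, norm_smul, norm_inv, norm_norm, inv_mul_cancel₀ hv']
      have h2 := hmax h1
      simp only [mem_ofPred_eq, Submodule.coe_smul, map_smul, real_inner_smul_left,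
        real_inner_smul_right] at h2
      calc ⟪hessian F 0 (v : E), (v : E)⟫_ℝ
          = (‖v‖⁻¹ * (‖v‖⁻¹ * ⟪hessian F 0 (v : E), (v : E)⟫_ℝ)) * ‖v‖ ^ 2 := by field_simp
        _ ≤ _ := by gcongr
  obtain ⟨D, -, hg⟩ := hF.hasFDerivAt_gradient 0
  have hg' : HasFDerivAt (gradient F) (hessian F 0) 0 := hg.differentiableAt.hasFDerivAt
  have hlit := hg'.isLittleO.def (half_pos hc)
  rw [h0.gradient] at hlit
  simp only [sub_zero] at hlit
  obtain ⟨δ, hδ, hball⟩ := Metric.eventually_nhds_iff.1 hlit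
  have hV : ∀ᶠ v : V in 𝓝[≠] 0, ‖v‖ < δ := by
    refine nhdsWithin_le_nhds ?_
    have : Metric.ball (0 : V) δ ∈ 𝓝 (0 : V) := Metric.ball_mem_nhds _ hδ
    filter_upwards [this] with v hv
    simpa using hv
  filter_upwards [hV, self_mem_nhdsWithin] with v hvδ hv0
  have hderiv : ∀ s : ℝ, HasDerivAt (fun s : ℝ => F (s • (v : E)))
      ⟪gradient F (s • (v : E)), (v : E)⟫_ℝ s := fun s => by
    have h1 := ((hF.differentiable (by norm_num)) (s • (v : E))).hasGradientAt.hasFDerivAt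
    have h2 : HasDerivAt (fun s : ℝ => s • (v : E)) (v : E) s := by
      simpa using (hasDerivAt_id s).smul_const (v : E)
    exact h1.comp_hasDerivAt s h2
  -- By the mean value theorem `F v - F 0` is the gradient at `s v` paired with `v`; this is at most
  -- `-c s ‖v‖²` from the Hessian plus an error of half that size.
  obtain ⟨s, hs, hslope⟩ := exists_hasDerivAt_eq_slope (fun s : ℝ => F (s • (v : E))) _ zero_lt_one
    (fun s _ => (hderiv s).continuousAt.continuousWithinAt) (fun s _ => hderiv s)
  simp only [one_smul, zero_smul, sub_zero, div_one] at hslope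
  have hvpos : 0 < ‖v‖ := norm_pos_iff.2 hv0
  have hnear : dist (s • (v : E)) 0 < δ := by
    rw [dist_zero_right, norm_smul, Real.norm_eq_abs, abs_of_pos hs.1]
    exact (mul_le_of_le_one_left (norm_nonneg _) hs.2.le).trans_lt hvδ
  have h1 := hball hnear
  rw [norm_smul, Real.norm_eq_abs, abs_of_pos hs.1] at h1
  have h2 : ⟪gradient F (s • (v : E)) - hessian F 0 (s • (v : E)), (v : E)⟫_ℝ ≤
      c / 2 * (s * ‖v‖) * ‖v‖ :=
    (real_inner_le_norm _ _).trans (mul_le_mul_of_nonneg_right h1 (norm_nonneg _))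
  rw [inner_sub_left, map_smul, real_inner_smul_left] at h2
  have h3 := mul_le_mul_of_nonneg_left (hcV v) hs.1.le
  have h4 : 0 < c * s * ‖v‖ ^ 2 := mul_pos (mul_pos hc hs.1) (pow_pos hvpos 2)
  nlinarith

end SecondDerivativeTest

/-! ### Sign of the coefficients and the traps for `b = 3` -/

section TrapConsequences

theorem contDiff_trapFidelity {ε : ℝ} (hT : 0 ≤ trapTime ε) (b θ : ℝ) {n : WithTop ℕ∞} :
    ContDiff ℝ n (trapFidelity ε b θ) := by
  rw [trapFidelity_eq ε hT]
  exact contDiff_resolventFidelity (isUnit_one_sub_generator hT _ _) _ _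

theorem hasGradientAt_trapFidelity_zero {ε : ℝ} (hT : 0 ≤ trapTime ε) (b θ : ℝ) :
    HasGradientAt (trapFidelity ε b θ) 0 0 := by
  rw [trapFidelity_eq ε hT]
  exact hasGradientAt_resolventFidelity_zero (isUnit_one_sub_generator hT _ _)
    (trap_first_order hT b θ)

theorem trapFidelity_zero {ε : ℝ} (hT : 0 ≤ trapTime ε) (b θ : ℝ) :
    trapFidelity ε b θ 0 = Real.cos θ ^ 2 := by
  rw [trapFidelity_eq ε hT, resolventFidelity, trap_zeroth_order, Complex.norm_real,
    Real.norm_eq_abs, sq_abs]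

/-- All coefficients with `k ≥ 1` have the sign of `-sin (2θ)`, so `k = 0` and `k = 1` decide
everything. -/
theorem trapCoeff_neg_iff (b θ : ℝ) : (∀ k : ℕ, trapCoeff b θ k < 0) ↔
    (1 / Real.pi * Real.sin (2 * θ) < b ^ 2 * Real.cos θ ^ 2 ∧
      0 < 1 / Real.pi * Real.sin (2 * θ)) := by
  have hpi : 0 < 1 / Real.pi := one_div_pos.2 Real.pi_pos
  constructor
  · intro h
    have h0 := h 0
    have h1 := h 1
    simp only [trapCoeff, if_pos, one_ne_zero, if_false, neg_lt_zero, Nat.cast_one, one_pow,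
      mul_one] at h0 h1
    refine ⟨by linarith, mul_pos hpi ?_⟩
    have := Real.pi_pos
    have h2 : 0 < Real.pi * (4 - 1) := by positivity
    have h3 := (div_pos_iff_of_pos_right h2).1 h1
    linarith
  · rintro ⟨h1, h2⟩ k
    have hs : 0 < Real.sin (2 * θ) := pos_of_mul_pos_right h2 hpi.le
    rcases k with _ | k
    · simp only [trapCoeff, if_pos]
      linarith
    · rw [trapCoeff, if_neg (Nat.succ_ne_zero k), neg_lt_zero]
      have hk : (1 : ℝ) ≤ ((k + 1 : ℕ) : ℝ) := by exact_mod_cast Nat.le_add_left 1 k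
      exact div_pos (by linarith) (mul_pos Real.pi_pos (by nlinarith))

theorem trap_of_trapCoeff_neg {ε : ℝ} (hε : 0 < ε) {b θ : ℝ}
    (ha : ∀ k : ℕ, trapCoeff b θ k < 0) :
    IsNegDef (hessian (trapFidelity ε b θ) 0) ∧
      IsStrictLocalMaxOnFinDim (trapFidelity ε b θ) ∧
      HasInfiniteRank (hessian (trapFidelity ε b θ) 0) := by
  have hT := trapTime_pos hε
  have h := isNegDef_hessian_trapFidelity hε ha
  exact ⟨h, h.isStrictLocalMaxOnFinDim (contDiff_trapFidelity hT.le b θ)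
    (hasGradientAt_trapFidelity_zero hT.le b θ), h.hasInfiniteRank hT⟩

theorem half_le_cos {θ : ℝ} (hθ : θ ∈ Ioc 0 (Real.pi / 3)) : 1 / 2 ≤ Real.cos θ := by
  rw [← Real.cos_pi_div_three]
  exact Real.cos_le_cos_of_nonneg_of_le_pi hθ.1.le (by linarith [Real.pi_pos]) hθ.2

theorem cos_lt_one {θ : ℝ} (hθ : θ ∈ Ioc 0 (Real.pi / 3)) : Real.cos θ < 1 := by
  rw [← Real.cos_zero]
  exact Real.cos_lt_cos_of_nonneg_of_le_pi le_rfl (by linarith [Real.pi_pos, hθ.2]) hθ.1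

/-- Since `cos θ ≥ 1/2`, one has `sin (2θ) ≤ 2 cos θ ≤ 4 cos² θ`, well below `9π cos² θ`. -/
theorem trapCoeff_three_neg {θ : ℝ} (hθ : θ ∈ Ioc 0 (Real.pi / 3)) (k : ℕ) :
    trapCoeff 3 θ k < 0 := by
  refine (trapCoeff_neg_iff 3 θ).2 ?_ k
  have hpi := Real.pi_gt_three
  have hc := half_le_cos hθ
  have hs : 0 < Real.sin θ := Real.sin_pos_of_pos_of_lt_pi hθ.1 (by linarith [hθ.2])
  have hs1 := Real.sin_le_one θ
  rw [Real.sin_two_mul]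
  refine ⟨?_, by positivity⟩
  rw [one_div, inv_mul_lt_iff₀ Real.pi_pos]
  have h1 : 2 * Real.sin θ * Real.cos θ ≤ 2 * 1 * Real.cos θ := by gcongr
  nlinarith [mul_pos (by linarith : 0 < Real.pi - 3) (by positivity : 0 < Real.cos θ ^ 2)]

theorem cos_sq_mem_Ico {θ : ℝ} (hθ : θ ∈ Ioc 0 (Real.pi / 3)) :
    Real.cos θ ^ 2 ∈ Ico (1 / 4 : ℝ) 1 := by
  have h1 := half_le_cos hθ
  have h2 := cos_lt_one hθ
  constructor <;> nlinarith

theorem image_cos_sq : (fun θ => Real.cos θ ^ 2) '' Ioc 0 (Real.pi / 3) = Ico (1 / 4 : ℝ) 1 := by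
  refine Subset.antisymm (image_subset_iff.2 fun θ hθ => cos_sq_mem_Ico hθ) fun y hy => ?_
  have hy0 : 0 ≤ y := by linarith [hy.1]
  have h1 : 1 / 2 ≤ √y := Real.le_sqrt_of_sq_le (by linarith [hy.1])
  have h2 : √y < 1 := by rw [Real.sqrt_lt' one_pos]; linarith [hy.2]
  refine ⟨Real.arccos √y, ⟨Real.arccos_pos.2 h2, ?_⟩, ?_⟩
  · rw [← Real.arccos_cos (x := Real.pi / 3) (by linarith [Real.pi_pos]) (by linarith [Real.pi_pos]),
      Real.cos_pi_div_three]
    exact Real.arccos_le_arccos h1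
  · simp only
    rw [Real.cos_arccos (by linarith) h2.le, Real.sq_sqrt hy0]

end TrapConsequences

/-! ### Commutators of the four-level Hamiltonians at `ε = 0` -/

section LieAlgebra

/-- The elements of `W` whose adjoint action preserves `W`. -/
def adStable {A : Type*} [Ring A] [Algebra ℂ A] (W : Submodule ℂ A) : Submodule ℂ A where
  carrier := {Y | Y ∈ W ∧ ∀ X ∈ W, Y * X - X * Y ∈ W}
  zero_mem' := ⟨W.zero_mem, fun X _ => by simp⟩
  add_mem' := fun {Y Z} hY hZ => ⟨W.add_mem hY.1 hZ.1, fun X hX => by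
    have := W.add_mem (hY.2 X hX) (hZ.2 X hX)
    convert this using 1
    noncomm_ring⟩
  smul_mem' := fun c Y hY => ⟨W.smul_mem c hY.1, fun X hX => by
    have := W.smul_mem c (hY.2 X hX)
    rwa [smul_sub, ← smul_mul_assoc, ← mul_smul_comm] at this⟩

/-- By the Jacobi identity. `Y` need not lie in `W`, so the lemma also covers the drift, which has
nonzero trace. -/
theorem adStable_bracket {A : Type*} [Ring A] [Algebra ℂ A] {W : Submodule ℂ A} {Y Z : A}
    (hY : ∀ X ∈ W, Y * X - X * Y ∈ W) (hZ : Z ∈ adStable W) : Y * Z - Z * Y ∈ adStable W := by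
  refine ⟨hY Z hZ.1, fun X hX => ?_⟩
  have h1 := hY _ (hZ.2 X hX)
  have h2 := hZ.2 _ (hY X hX)
  convert W.sub_mem h1 h2 using 1
  noncomm_ring

/-- The raising part of the control Hamiltonian. -/
def raisePart (b : ℂ) : Matrix (Fin 4) (Fin 4) ℂ :=
  !![0, 1, 0, 0; 0, 0, 0, 0; 0, 0, 0, b; 0, 0, 0, 0]

/-- The lowering part of the control Hamiltonian. -/
def lowerPart (b : ℂ) : Matrix (Fin 4) (Fin 4) ℂ :=
  !![0, 0, 0, 0; 1, 0, 0, 0; 0, 0, 0, 0; 0, 0, b, 0]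

/-- The commutator of `raisePart b` and `lowerPart b`. -/
def weightPart (b : ℂ) : Matrix (Fin 4) (Fin 4) ℂ :=
  !![1, 0, 0, 0; 0, -1, 0, 0; 0, 0, b ^ 2, 0; 0, 0, 0, -b ^ 2]

theorem trapH₀_zero : trapH₀ 0 = !![1, 0, 0, 0; 0, 1, 0, 0; 0, 0, 2, 0; 0, 0, 0, 2] := by
  ext i j
  fin_cases i <;> fin_cases j <;> simp [trapH₀]

theorem commutator_drift_trapH₁ (b : ℝ) : trapH₀ 0 * trapH₁ b - trapH₁ b * trapH₀ 0 =
    !![0, 0, 0, 0; 0, 0, -1, 0; 0, 1, 0, 0; 0, 0, 0, 0] := by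
  rw [trapH₀_zero, trapH₁]
  ext i j
  fin_cases i <;> fin_cases j <;> simp <;> ring

theorem commutator_drift_antisymm : trapH₀ 0 * !![0, 0, 0, 0; 0, 0, -1, 0; 0, 1, 0, 0; 0, 0, 0, 0] -
    !![0, 0, 0, 0; 0, 0, -1, 0; 0, 1, 0, 0; 0, 0, 0, 0] * trapH₀ 0 =
    !![0, 0, 0, 0; 0, 0, 1, 0; 0, 1, 0, 0; 0, 0, 0, 0] := by
  rw [trapH₀_zero]
  ext i j
  fin_cases i <;> fin_cases j <;> simp <;> ring

theorem commutator_raise_lower (b : ℂ) :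
    raisePart b * lowerPart b - lowerPart b * raisePart b = weightPart b := by
  rw [raisePart, lowerPart, weightPart]
  ext i j
  fin_cases i <;> fin_cases j <;> simp <;> ring

/-- The weight element scales the 0–1 transition by `2` and the 2–3 transition by `2b²`; the
discrepancy isolates the latter when `b(b² - 1) ≠ 0`. -/
theorem commutator_weight_raise (b : ℂ) :
    weightPart b * raisePart b - raisePart b * weightPart b =
      (2 : ℂ) • raisePart b + (2 * b * (b ^ 2 - 1)) • single 2 3 1 := by
  rw [raisePart, weightPart]
  ext i j
  fin_cases i <;> fin_cases j <;> simp <;> ring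

theorem commutator_weight_lower (b : ℂ) :
    weightPart b * lowerPart b - lowerPart b * weightPart b =
      -((2 : ℂ) • lowerPart b + (2 * b * (b ^ 2 - 1)) • single 3 2 1) := by
  rw [lowerPart, weightPart]
  ext i j
  fin_cases i <;> fin_cases j <;> simp <;> ring

theorem commutator_middle_sum (b : ℂ) :
    !![0, 0, 0, 0; 0, 1, 0, 0; 0, 0, -1, 0; 0, 0, 0, 0] * (raisePart b + lowerPart b) -
      (raisePart b + lowerPart b) * !![0, 0, 0, 0; 0, 1, 0, 0; 0, 0, -1, 0; 0, 0, 0, 0] =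
      lowerPart b - raisePart b := by
  rw [raisePart, lowerPart]
  ext i j
  fin_cases i <;> fin_cases j <;> simp

theorem commutator_middle_single :
    (single 1 2 1 * single 2 1 1 - single 2 1 1 * single 1 2 1 : Matrix (Fin 4) (Fin 4) ℂ) =
      !![0, 0, 0, 0; 0, 1, 0, 0; 0, 0, -1, 0; 0, 0, 0, 0] := by
  rw [single_mul_single_same, single_mul_single_same]
  ext i j
  fin_cases i <;> fin_cases j <;> simp

theorem raisePart_add_lowerPart (b : ℝ) : raisePart b + lowerPart b =
    trapH₁ b - !![0, 0, 0, 0; 0, 0, 1, 0; 0, 1, 0, 0; 0, 0, 0, 0] := by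
  rw [raisePart, lowerPart, trapH₁]
  ext i j
  fin_cases i <;> fin_cases j <;> simp

theorem raisePart_eq (b : ℂ) :
    raisePart b = (single 0 1 1 : Matrix (Fin 4) (Fin 4) ℂ) + b • single 2 3 1 := by
  rw [raisePart]
  ext i j
  fin_cases i <;> fin_cases j <;> simp

theorem lowerPart_eq (b : ℂ) :
    lowerPart b = (single 1 0 1 : Matrix (Fin 4) (Fin 4) ℂ) + b • single 3 2 1 := by
  rw [lowerPart]
  ext i j
  fin_cases i <;> fin_cases j <;> simp

/-- Away from `b ∈ {0, 1, -1}`, the control Hamiltonian generates all traceless matrices under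
commutation with the unperturbed drift and with itself. -/
theorem traceless_mem_of_ad_invariant {b : ℝ} (hb0 : b ≠ 0) (hb1 : b ≠ 1) (hb2 : b ≠ -1)
    {W : Submodule ℂ (Matrix (Fin 4) (Fin 4) ℂ)} (hW : trapH₁ b ∈ W)
    (h0 : ∀ X ∈ W, trapH₀ 0 * X - X * trapH₀ 0 ∈ W)
    (h1 : ∀ X ∈ W, trapH₁ b * X - X * trapH₁ b ∈ W)
    {X : Matrix (Fin 4) (Fin 4) ℂ} (hX : X.trace = 0) : X ∈ W := by
  have hbr : ∀ Y ∈ adStable W, ∀ Z ∈ adStable W, Y * Z - Z * Y ∈ adStable W :=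
    fun Y hY Z hZ => adStable_bracket hY.2 hZ
  have hd : ∀ Z ∈ adStable W, trapH₀ 0 * Z - Z * trapH₀ 0 ∈ adStable W :=
    fun Z hZ => adStable_bracket h0 hZ
  have hH : trapH₁ b ∈ adStable W := ⟨hW, h1⟩
  suffices X ∈ adStable W from this.1
  -- From here on it only matters that `S` is closed under brackets, normalised by the drift, and
  -- contains the control Hamiltonian.
  generalize adStable W = S at hbr hd hH
  have hb0' : (b : ℂ) ≠ 0 := Complex.ofReal_ne_zero.2 hb0
  have hb1' : (b : ℂ) ^ 2 - 1 ≠ 0 := by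
    intro h
    have h2 : b ^ 2 - 1 = 0 := by exact_mod_cast h
    rcases mul_eq_zero.1 (by linarith : (b - 1) * (b + 1) = 0) with h3 | h3
    · exact hb1 (by linarith)
    · exact hb2 (by linarith)
  have hA := hd _ hH
  rw [commutator_drift_trapH₁] at hA
  have hB := hd _ hA
  rw [commutator_drift_antisymm] at hB
  have h12 : single 1 2 1 ∈ S := by
    convert S.smul_mem (1 / 2 : ℂ) (S.sub_mem hB hA) using 1
    ext i j
    fin_cases i <;> fin_cases j <;> simp
    norm_num
  have h21 : single 2 1 1 ∈ S := by
    convert S.smul_mem (1 / 2 : ℂ) (S.add_mem hB hA) using 1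
    ext i j
    fin_cases i <;> fin_cases j <;> simp
    norm_num
  have hM := S.sub_mem hH hB
  rw [← raisePart_add_lowerPart] at hM
  have hh := hbr _ h12 _ h21
  rw [commutator_middle_single] at hh
  have hP := hbr _ hh _ hM
  rw [commutator_middle_sum] at hP
  have hu : raisePart b ∈ S := by
    convert S.smul_mem (1 / 2 : ℂ) (S.sub_mem hM hP) using 1
    module
  have hv : lowerPart b ∈ S := by
    convert S.smul_mem (1 / 2 : ℂ) (S.add_mem hM hP) using 1
    module
  have hg := hbr _ hu _ hv
  rw [commutator_raise_lower] at hg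
  have hc : 2 * (b : ℂ) * ((b : ℂ) ^ 2 - 1) ≠ 0 := mul_ne_zero (mul_ne_zero two_ne_zero hb0') hb1'
  have h23 : single 2 3 1 ∈ S := by
    have := hbr _ hg _ hu
    rwa [commutator_weight_raise, S.add_mem_iff_right (S.smul_mem _ hu), S.smul_mem_iff hc] at this
  have h32 : single 3 2 1 ∈ S := by
    have := hbr _ hg _ hv
    rwa [commutator_weight_lower, S.neg_mem_iff, S.add_mem_iff_right (S.smul_mem _ hv),
      S.smul_mem_iff hc] at this
  have h01 : single 0 1 1 ∈ S := by
    rwa [raisePart_eq, S.add_mem_iff_left (S.smul_mem _ h23)] at hu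
  have h10 : single 1 0 1 ∈ S := by
    rwa [lowerPart_eq, S.add_mem_iff_left (S.smul_mem _ h32)] at hv
  have hcomp : ∀ i j k : Fin 4, i ≠ k → (single i j 1 : Matrix (Fin 4) (Fin 4) ℂ) ∈ S →
      single j k 1 ∈ S → single i k 1 ∈ S := fun i j k hik hij hjk => by
    have := hbr _ hij _ hjk
    rwa [single_mul_single_same, single_mul_single_of_ne _ _ _ _ hik.symm, sub_zero, mul_one]
      at this
  have hdiag : ∀ i j : Fin 4, (single i j 1 : Matrix (Fin 4) (Fin 4) ℂ) ∈ S →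
      single j i 1 ∈ S → single i i 1 - single j j 1 ∈ S := fun i j hij hji => by
    have := hbr _ hij _ hji
    rwa [single_mul_single_same, single_mul_single_same, mul_one] at this
  have h02 := hcomp 0 1 2 (by decide) h01 h12
  have h13 := hcomp 1 2 3 (by decide) h12 h23
  have h03 := hcomp 0 2 3 (by decide) h02 h23
  have h20 := hcomp 2 1 0 (by decide) h21 h10
  have h31 := hcomp 3 2 1 (by decide) h32 h21
  have h30 := hcomp 3 2 0 (by decide) h32 h20
  have hoff : ∀ i j : Fin 4, i ≠ j → (single i j 1 : Matrix (Fin 4) (Fin 4) ℂ) ∈ S := by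
    intro i j hij
    fin_cases i <;> fin_cases j <;> first | exact absurd rfl hij | assumption
  -- The subtracted terms add up to the trace times one matrix unit, hence to zero, and make each
  -- summand traceless.
  have hdec : X = ∑ i, ∑ j, X i j • (single i j 1 - if i = j then single 0 0 1 else 0) := by
    simp only [smul_sub, Finset.sum_sub_distrib]
    have h2 : ∑ i : Fin 4, ∑ j : Fin 4, X i j • (if i = j then
        (single 0 0 1 : Matrix (Fin 4) (Fin 4) ℂ) else 0) = 0 := by
      simp only [smul_ite, smul_zero, Finset.sum_ite_eq, Finset.mem_univ, if_true,
        ← Finset.sum_smul]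
      have h3 : ∑ i, X i i = 0 := hX
      rw [h3, zero_smul]
    rw [h2, sub_zero]
    conv_lhs => rw [matrix_eq_sum_single X]
    simp [smul_single]
  rw [hdec]
  refine S.sum_mem fun i _ => S.sum_mem fun j _ => S.smul_mem _ ?_
  by_cases hij : i = j
  · subst hij
    rw [if_pos rfl]
    by_cases hi : i = 0
    · subst hi
      simp
    · exact hdiag i 0 (hoff _ _ hi) (hoff _ _ (Ne.symm hi))
  · rw [if_neg hij, sub_zero]
    exact hoff i j hij

end LieAlgebra

/-! ### Concatenation of controls and constant controls -/

section Reach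

variable {n : ℕ} (H₀ H₁ : Matrix (Fin n) (Fin n) ℂ)

/-- The matrices reached at time `T` from the identity. -/
def reachable (T : ℝ) : Set (Matrix (Fin n) (Fin n) ℂ) :=
  {V | ∃ (f : ControlSpace T) (U : ℝ → Matrix (Fin n) (Fin n) ℂ),
    IsPropagator H₀ H₁ T f U ∧ U T = V}

variable {H₀ H₁}

theorem IsPropagator.zero {T : ℝ} (hT : 0 ≤ T) {f : ControlSpace T}
    {U : ℝ → Matrix (Fin n) (Fin n) ℂ} (hU : IsPropagator H₀ H₁ T f U) : U 0 = 1 := by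
  ext j k
  simp [hU.2 0 ⟨le_rfl, hT⟩ j k]

/-- Switching from the control `f₁` on `[0,T₁]` to the control `f₂` on `[0,T₂]`. -/
def switchControl {T₁ T₂ : ℝ} (f₁ : ControlSpace T₁) (f₂ : ControlSpace T₂) (s : ℝ) : ℝ :=
  (Ioo 0 T₁).indicator f₁ s + (Ioo 0 T₂).indicator f₂ (s - T₁)

theorem memLp_switchControl {T₁ T₂ : ℝ} (f₁ : ControlSpace T₁) (f₂ : ControlSpace T₂) :
    MemLp (switchControl f₁ f₂) 2 (volume : Measure ℝ) := by
  have h1 : MemLp ((Ioo 0 T₁).indicator f₁) 2 (volume : Measure ℝ) :=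
    (memLp_indicator_iff_restrict measurableSet_Ioo).2 (Lp.memLp f₁)
  have h2 : MemLp ((Ioo 0 T₂).indicator f₂) 2 (volume : Measure ℝ) :=
    (memLp_indicator_iff_restrict measurableSet_Ioo).2 (Lp.memLp f₂)
  exact h1.add (h2.comp_measurePreserving (measurePreserving_sub_right volume T₁))

/-- The clamped arguments make one continuous formula: the second factor stays at `1` until `T₁`,
and the first is frozen after it. -/
theorem IsPropagator.switch {T₁ T₂ : ℝ} (hT₁ : 0 ≤ T₁) (hT₂ : 0 ≤ T₂) {f₁ : ControlSpace T₁}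
    {f₂ : ControlSpace T₂} {U₁ U₂ : ℝ → Matrix (Fin n) (Fin n) ℂ}
    (h₁ : IsPropagator H₀ H₁ T₁ f₁ U₁) (h₂ : IsPropagator H₀ H₁ T₂ f₂ U₂) :
    IsPropagator H₀ H₁ (T₁ + T₂) ((memLp_switchControl f₁ f₂).restrict _).toLp
      (fun t => U₂ (max (t - T₁) 0) * U₁ (min t T₁)) := by
  set f : ControlSpace (T₁ + T₂) := ((memLp_switchControl f₁ f₂).restrict _).toLp with hf
  set U : ℝ → Matrix (Fin n) (Fin n) ℂ := fun t => U₂ (max (t - T₁) 0) * U₁ (min t T₁) with hU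
  have hfF : ∀ᵐ s, s ∈ Ioo 0 (T₁ + T₂) → f s = switchControl f₁ f₂ s :=
    (ae_restrict_iff' measurableSet_Ioo).1 (MemLp.coeFn_toLp _)
  have hc : ContinuousOn U (Icc 0 (T₁ + T₂)) := by
    have hc1 : ContinuousOn (fun t => U₁ (min t T₁)) (Icc 0 (T₁ + T₂)) :=
      h₁.1.comp (by fun_prop) fun t ht => ⟨le_min ht.1 hT₁, min_le_right _ _⟩
    have hc2 : ContinuousOn (fun t => U₂ (max (t - T₁) 0)) (Icc 0 (T₁ + T₂)) :=
      h₂.1.comp (by fun_prop) fun t ht =>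
        ⟨le_max_right _ _, max_le (by linarith [ht.2]) hT₂⟩
    exact hc2.mul hc1
  have hU1 : ∀ t ≤ T₁, U t = U₁ t := fun t ht => by
    simp only [hU, max_eq_right (sub_nonpos.2 ht), min_eq_left ht, h₂.zero hT₂, one_mul]
  have hU2 : ∀ t, T₁ ≤ t → U t = U₂ (t - T₁) * U₁ T₁ := fun t ht => by
    simp only [hU, max_eq_left (sub_nonneg.2 ht), min_eq_right ht]
  have hleft : ∀ t ∈ Icc 0 T₁, ∀ j k, U t j k = (1 : Matrix (Fin n) (Fin n) ℂ) j k
        - Complex.I * ∫ s in (0 : ℝ)..t, ((H₀ + ((f s : ℝ) : ℂ) • H₁) * U s) j k := by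
    intro t ht j k
    rw [hU1 t ht.2, h₁.2 t ht j k]
    congr 2
    refine intervalIntegral_congr_ae_Ioo (T := t) ((ae_restrict_iff' measurableSet_Ioo).2 ?_)
      ⟨le_rfl, ht.1⟩ ⟨ht.1, le_rfl⟩
    filter_upwards [hfF] with s hs hst
    have hsT : s ∈ Ioo 0 T₁ := ⟨hst.1, hst.2.trans_le ht.2⟩
    rw [hs ⟨hst.1, by linarith [hsT.2]⟩, hU1 s hsT.2.le, switchControl, indicator_of_mem hsT,
      indicator_of_notMem (fun h => by linarith [h.1, hsT.2]), add_zero]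
  refine ⟨hc, fun t ht j k => ?_⟩
  rcases le_total t T₁ with htT | htT
  · exact hleft t ⟨ht.1, htT⟩ j k
  have hint : ∀ r ∈ Icc 0 (T₁ + T₂), IntervalIntegrable
      (fun s => ((H₀ + ((f s : ℝ) : ℂ) • H₁) * U s) j k) volume 0 r := fun r hr =>
    intervalIntegrable_generator H₀ H₁ f (v := fun s i => U s i k)
      (continuousOn_pi.2 fun i => (continuous_id.matrix_elem i k).comp_continuousOn hc) hr j
  have hT1 : T₁ ∈ Icc 0 (T₁ + T₂) := ⟨hT₁, by linarith⟩
  have ht2 : t - T₁ ∈ Icc 0 T₂ := ⟨by linarith, by linarith [ht.2]⟩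
  rw [← intervalIntegral.integral_add_adjacent_intervals (hint T₁ hT1)
    ((hint T₁ hT1).symm.trans (hint t ht)), mul_add, ← sub_sub,
    ← hleft T₁ ⟨hT₁, le_rfl⟩ j k, hU1 T₁ le_rfl, hU2 t htT]
  have hcol : (U₂ (t - T₁) * U₁ T₁) j k = (U₂ (t - T₁) *ᵥ fun i => U₁ T₁ i k) j := rfl
  rw [hcol, h₂.mulVec_apply H₀ H₁ _ ht2 j]
  congr 2
  have hshift := intervalIntegral.integral_comp_sub_right (a := T₁) (b := t)
    (fun s => ((H₀ + ((f₂ s : ℝ) : ℂ) • H₁) *ᵥ (U₂ s *ᵥ fun i => U₁ T₁ i k)) j) T₁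
  rw [sub_self] at hshift
  rw [← hshift]
  rw [intervalIntegral.integral_of_le htT, intervalIntegral.integral_of_le htT,
    integral_Ioc_eq_integral_Ioo, integral_Ioc_eq_integral_Ioo]
  refine setIntegral_congr_ae measurableSet_Ioo ?_
  filter_upwards [hfF] with s hs hst
  have hs2 : s - T₁ ∈ Ioo 0 T₂ := ⟨by linarith [hst.1], by linarith [hst.2, ht2.2]⟩
  rw [hs ⟨by linarith [hst.1], by linarith [hs2.2]⟩, hU2 s hst.1.le, switchControl,
    indicator_of_mem hs2, indicator_of_notMem (fun h => by linarith [h.2, hst.1]), zero_add,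
    mulVec_mulVec, ← Matrix.mul_assoc]
  rfl

theorem mul_mem_reachable {T₁ T₂ : ℝ} (hT₁ : 0 ≤ T₁) (hT₂ : 0 ≤ T₂)
    {V W : Matrix (Fin n) (Fin n) ℂ} (hV : V ∈ reachable H₀ H₁ T₁)
    (hW : W ∈ reachable H₀ H₁ T₂) : W * V ∈ reachable H₀ H₁ (T₁ + T₂) := by
  obtain ⟨f₁, U₁, h₁, rfl⟩ := hV
  obtain ⟨f₂, U₂, h₂, rfl⟩ := hW
  refine ⟨_, _, h₁.switch hT₁ hT₂ h₂, ?_⟩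
  simp [hT₂]

theorem one_mem_reachable : 1 ∈ reachable H₀ H₁ 0 := by
  obtain ⟨U, hU⟩ := exists_isPropagator H₀ H₁ le_rfl (0 : ControlSpace 0)
  exact ⟨0, U, hU, hU.zero le_rfl⟩

open scoped Matrix.Norms.L2Operator in
theorem exp_mem_reachable (t c : ℝ) :
    NormedSpace.exp ((t : ℂ) • ((-Complex.I) • (H₀ + (c : ℂ) • H₁))) ∈ reachable H₀ H₁ t := by
  set A : Matrix (Fin n) (Fin n) ℂ := (-Complex.I) • (H₀ + (c : ℂ) • H₁) with hA
  have hd := fun z : ℂ => hasDerivAt_exp_smul_const' (𝕂 := ℂ) A z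
  have hcont : Continuous fun s : ℝ => NormedSpace.exp ((s : ℂ) • A) :=
    (continuous_iff_continuousAt.2 fun z => (hd z).continuousAt).comp Complex.continuous_ofReal
  have hent : ∀ j k (s : ℝ), HasDerivAt (fun s : ℝ => NormedSpace.exp ((s : ℂ) • A) j k)
      ((A * NormedSpace.exp ((s : ℂ) • A)) j k) s := fun j k s =>
    ((LinearMap.toContinuousLinearMap (Matrix.entryLinearMap ℂ ℂ j k :
      Matrix (Fin n) (Fin n) ℂ →ₗ[ℂ] ℂ)).hasFDerivAt.comp_hasDerivAt (s : ℂ) (hd s)).comp_ofReal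
  let f : ControlSpace t := (memLp_of_continuous_Ioo t (continuous_const (y := c))).toLp fun _ => c
  refine ⟨f, fun s => NormedSpace.exp ((s : ℂ) • A), ⟨hcont.continuousOn, fun s hs j k => ?_⟩, rfl⟩
  have hfc : ∀ᵐ r, r ∈ Ioo 0 t → f r = c :=
    (ae_restrict_iff' measurableSet_Ioo).1 (MemLp.coeFn_toLp _)
  have hI : ∫ r in (0 : ℝ)..s, ((H₀ + ((f r : ℝ) : ℂ) • H₁) * NormedSpace.exp ((r : ℂ) • A)) j k =
      ∫ r in (0 : ℝ)..s, Complex.I * (A * NormedSpace.exp ((r : ℂ) • A)) j k := by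
    refine intervalIntegral_congr_ae_Ioo (T := s) ((ae_restrict_iff' measurableSet_Ioo).2 ?_)
      ⟨le_rfl, hs.1⟩ ⟨hs.1, le_rfl⟩
    filter_upwards [hfc] with r hr hrs
    rw [hr ⟨hrs.1, hrs.2.trans_le hs.2⟩, hA, smul_mul, Matrix.smul_apply, smul_eq_mul,
      ← mul_assoc]
    simp
  have hF := intervalIntegral.integral_eq_sub_of_hasDerivAt (a := 0) (b := s)
    (fun r _ => hent j k r) (Continuous.intervalIntegrable
      ((continuous_const.mul hcont).matrix_elem j k) _ _)
  rw [hI, intervalIntegral.integral_const_mul, hF, ← mul_assoc, Complex.I_mul_I]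
  simp

open scoped Matrix.Norms.L2Operator in
-- In an eigenbasis the determinant of the exponential is the product of the exponentials of the
-- scaled eigenvalues.
theorem det_exp_smul_of_isHermitian {H : Matrix (Fin n) (Fin n) ℂ} (hH : H.IsHermitian) (c : ℂ) :
    (NormedSpace.exp (c • H)).det = Complex.exp (c * H.trace) := by
  set U := (hH.eigenvectorUnitary : Matrix (Fin n) (Fin n) ℂ) with hU
  have hUU : U * star U = 1 := Unitary.mul_star_self_of_mem hH.eigenvectorUnitary.2
  have hu : IsUnit U := IsUnit.of_mul_eq_one _ hUU
  have hinv : U⁻¹ = star U := Matrix.inv_eq_right_inv hUU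
  have hspec : c • H = U * diagonal (fun i => c * (hH.eigenvalues i : ℂ)) * U⁻¹ := by
    conv_lhs => rw [hH.spectral_theorem]
    rw [hinv, Unitary.conjStarAlgAut_apply]
    rw [← smul_mul_assoc, ← mul_smul_comm, ← diagonal_smul]
    rfl
  rw [hspec, exp_conj _ _ hu, det_conj hu, exp_diagonal, det_diagonal,
    hH.trace_eq_sum_eigenvalues, Finset.mul_sum, Complex.exp_sum]
  refine Finset.prod_congr rfl fun i _ => ?_
  rw [Pi.coe_exp, Complex.exp_eq_exp_ℂ]
  rfl

end Reach

/-! ### Smooth families of reached elements -/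

section LocalControllability

variable {A : Type*} [CStarAlgebra A]

/-- The generator of the evolution under the constant control `c` at the drift `h + ε k`. -/
def controlGenerator (h k h₁ : A) (ε c : ℝ) : A :=
  (-Complex.I) • (h + (ε : ℂ) • k + (c : ℂ) • h₁)

/-- `R ε t` is a family of unitaries containing what is reached at time `t` with piecewise constant
controls at the drift `h + ε k`. -/
structure ContainsReachable (h k h₁ : A) (R : ℝ → ℝ → A → Prop) : Prop where
  one : ∀ ε, R ε 0 1
  step : ∀ ε s V t c, R ε s V → 0 ≤ t →
    R ε (s + t) (NormedSpace.exp ((t : ℂ) • controlGenerator h k h₁ ε c) * V)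
  mem_unitary : ∀ ε s V, R ε s V → V ∈ unitary A

/-- Up to a phase, a smooth family of reached elements passes through `g`, uniformly near `ε = 0`,
and its directions of motion, together with those of time, include `D`. -/
def IsReachDirection (R : ℝ → ℝ → A → Prop) (g : A) (D : Submodule ℝ (A × ℝ)) : Prop :=
  ∃ (X : Type) (_ : NormedAddCommGroup X) (_ : NormedSpace ℝ X) (_ : CompleteSpace X)
    (Ψ : ℝ × X → A) (τ : X →L[ℝ] ℝ) (x₀ : X), ContDiff ℝ 1 Ψ ∧
    (∀ᶠ p in 𝓝 ((0 : ℝ), x₀), ∃ φ : ℝ, |φ| < 1 / 2 ∧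
      R p.1 (τ p.2) (Complex.exp (-(φ * Complex.I)) • Ψ p)) ∧ Ψ (0, x₀) = g ∧
    ∀ d ∈ D, ∃ y, star g * fderiv ℝ Ψ (0, x₀) (0, y) = d.1 ∧ τ y = d.2

theorem star_controlGenerator {h k h₁ : A} (hh : IsSelfAdjoint h) (hk : IsSelfAdjoint k)
    (hh₁ : IsSelfAdjoint h₁) (ε c : ℝ) :
    star (controlGenerator h k h₁ ε c) = -controlGenerator h k h₁ ε c := by
  simp [controlGenerator, hh.star_eq, hk.star_eq, hh₁.star_eq]
  abel

theorem exp_smul_mem_unitary {a : A} (ha : star a = -a) (t : ℝ) :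
    NormedSpace.exp ((t : ℂ) • a) ∈ unitary A := by
  let +nondep : NormedAlgebra ℚ A := .restrictScalars ℚ ℂ A
  refine NormedSpace.exp_mem_unitary_of_mem_skewAdjoint ?_
  rw [skewAdjoint.mem_iff, star_smul, ha]
  simp

theorem hasDerivAt_exp_ofReal_smul (a : A) (t : ℝ) :
    HasDerivAt (fun s : ℝ => NormedSpace.exp ((s : ℂ) • a))
      (NormedSpace.exp ((t : ℂ) • a) * a) t := by
  simp only [Complex.coe_smul]
  exact hasDerivAt_exp_smul_const a t

theorem smul_mem_unitary_of_norm_eq_one {z : ℂ} (hz : ‖z‖ = 1) {g : A} (hg : g ∈ unitary A) :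
    z • g ∈ unitary A := by
  have h1 : star z * z = 1 := by
    rw [Complex.star_def, Complex.conj_mul', hz]
    simp
  have h2 : z * star z = 1 := by rw [mul_comm, h1]
  rw [Unitary.mem_iff] at hg ⊢
  simp only [star_smul, smul_mul_smul_comm, hg.1, hg.2, h1, h2, one_smul, and_self]

theorem ContainsReachable.mem_unitary_of_phase {h k h₁ : A} {R : ℝ → ℝ → A → Prop}
    (hR : ContainsReachable h k h₁ R) {ε t φ : ℝ} {V : A}
    (hV : R ε t (Complex.exp (-(φ * Complex.I)) • V)) : V ∈ unitary A := by
  have h1 := smul_mem_unitary_of_norm_eq_one (Complex.norm_exp_ofReal_mul_I φ)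
    (hR.mem_unitary _ _ _ hV)
  rwa [smul_smul, ← Complex.exp_add, add_neg_cancel, Complex.exp_zero, one_smul] at h1

/-- Phases alone, at time 0, give the direction `i·1`. It must be adjoined: the determinant is fixed
at a given time, so the dynamics cannot supply it. -/
theorem isReachDirection_one {h k h₁ : A} {R : ℝ → ℝ → A → Prop}
    (hR : ContainsReachable h k h₁ R) :
    IsReachDirection R 1 (Submodule.span ℝ {(Complex.I • (1 : A), (0 : ℝ))}) := by
  have hc : ContDiff ℝ 1 fun p : ℝ × ℝ => Complex.exp (p.2 * Complex.I) • (1 : A) := by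
    have : ContDiff ℝ 1 fun p : ℝ × ℝ => Complex.exp (p.2 * Complex.I) :=
      ((Complex.ofRealCLM.contDiff.comp contDiff_snd).mul contDiff_const).cexp
    exact this.smul contDiff_const
  refine ⟨ℝ, inferInstance, inferInstance, inferInstance,
    fun p => Complex.exp (p.2 * Complex.I) • 1, 0, 0, hc, ?_, by simp, ?_⟩
  · have h1 : ∀ᶠ p : ℝ × ℝ in 𝓝 (0, 0), |p.2| < 1 / 2 := by
      refine ContinuousAt.eventually_lt (by fun_prop) continuousAt_const (by simp)
    filter_upwards [h1] with p hp
    refine ⟨p.2, hp, ?_⟩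
    simp only [smul_smul, ← Complex.exp_add, neg_add_cancel, Complex.exp_zero, one_smul]
    exact hR.one p.1
  · have h1 : HasDerivAt (fun s : ℝ => Complex.exp (s * Complex.I) • (1 : A))
        (Complex.I • (1 : A)) 0 := by
      have := (hasDerivAt_cexp_mul Complex.I 0).smul_const (1 : A)
      simpa [mul_comm] using this
    have h2 : HasDerivAt (fun s : ℝ => ((0 : ℝ), s)) ((0 : ℝ), (1 : ℝ)) 0 :=
      (hasDerivAt_const _ _).prodMk (hasDerivAt_id _)
    have h3 := ((hc.differentiable one_ne_zero) ((0 : ℝ), (0 : ℝ))).hasFDerivAt.comp_hasDerivAt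
      (0 : ℝ) h2
    have h4 := h3.unique h1
    intro d hd
    obtain ⟨r, rfl⟩ := Submodule.mem_span_singleton.1 hd
    refine ⟨r, ?_, by simp⟩
    have h5 : ((0 : ℝ), r) = r • ((0 : ℝ), (1 : ℝ)) := by simp
    rw [h5, map_smul, h4]
    simp

theorem IsReachDirection.mem_unitary {h k h₁ : A} {R : ℝ → ℝ → A → Prop}
    (hR : ContainsReachable h k h₁ R) {g : A} {D : Submodule ℝ (A × ℝ)}
    (hg : IsReachDirection R g D) : g ∈ unitary A := by
  obtain ⟨X, _, _, _, Ψ, τ, x₀, -, hev, rfl, -⟩ := hg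
  obtain ⟨φ, -, hφ⟩ := hev.self_of_nhds
  exact hR.mem_unitary_of_phase hφ

/-- The duration of an appended constant control becomes a new parameter, `t > 0` leaving room on
both sides. In left-translated derivatives the new exponential cancels, so the old directions
persist. -/
theorem IsReachDirection.step {h k h₁ : A} (hh : IsSelfAdjoint h) (hk : IsSelfAdjoint k)
    (hh₁ : IsSelfAdjoint h₁) {R : ℝ → ℝ → A → Prop}
    (hR : ContainsReachable h k h₁ R) {g : A} {D : Submodule ℝ (A × ℝ)}
    (hg : IsReachDirection R g D) {t : ℝ} (ht : 0 < t) (c : ℝ) :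
    IsReachDirection R (NormedSpace.exp ((t : ℂ) • controlGenerator h k h₁ 0 c) * g)
      (D ⊔ Submodule.span ℝ {(star g * controlGenerator h k h₁ 0 c * g, 1)}) := by
  obtain ⟨X, _, _, _, Ψ, τ, x₀, hc, hev, hΨ, hD⟩ := hg
  set a := controlGenerator h k h₁ 0 c with ha
  have haE : NormedSpace.exp ((t : ℂ) • a) ∈ unitary A :=
    exp_smul_mem_unitary (star_controlGenerator hh hk hh₁ 0 c) t
  let Φ : ℝ × (X × ℝ) → A := fun p =>
    NormedSpace.exp ((p.2.2 : ℂ) • controlGenerator h k h₁ p.1 c) * Ψ (p.1, p.2.1)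
  have hΦ : ContDiff ℝ 1 Φ := by
    have h1 : ContDiff ℝ 1 (NormedSpace.exp : A → A) :=
      contDiff_iff_contDiffAt.2 fun x => (NormedSpace.exp_analytic (𝕂 := ℝ) x).contDiffAt
    have h2 : ContDiff ℝ 1 fun p : ℝ × (X × ℝ) => (p.2.2 : ℂ) :=
      Complex.ofRealCLM.contDiff.comp (contDiff_snd.comp contDiff_snd)
    have h3 : ContDiff ℝ 1 fun p : ℝ × (X × ℝ) => (p.1 : ℂ) :=
      Complex.ofRealCLM.contDiff.comp contDiff_fst
    have h4 : ContDiff ℝ 1 fun p : ℝ × (X × ℝ) => controlGenerator h k h₁ p.1 c := by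
      unfold controlGenerator
      have h5 : ContDiff ℝ 1 fun p : ℝ × (X × ℝ) => h + (p.1 : ℂ) • k + (c : ℂ) • h₁ :=
        (contDiff_const.add (h3.smul contDiff_const)).add contDiff_const
      exact h5.const_smul (-Complex.I)
    exact (h1.comp (h2.smul h4)).mul
      (hc.comp (contDiff_fst.prodMk (contDiff_fst.comp contDiff_snd)))
  refine ⟨X × ℝ, inferInstance, inferInstance, inferInstance, Φ,
    τ.comp (ContinuousLinearMap.fst ℝ X ℝ) + ContinuousLinearMap.snd ℝ X ℝ, (x₀, t), hΦ, ?_, ?_, ?_⟩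
  · have h1 : Filter.Tendsto (fun p : ℝ × (X × ℝ) => (p.1, p.2.1)) (𝓝 (0, (x₀, t)))
        (𝓝 (0, x₀)) := by
      have : ContinuousAt (fun p : ℝ × (X × ℝ) => (p.1, p.2.1)) (0, (x₀, t)) := by fun_prop
      exact this
    have h2 : ∀ᶠ p : ℝ × (X × ℝ) in 𝓝 (0, (x₀, t)), 0 < p.2.2 :=
      ContinuousAt.eventually_lt continuousAt_const (by fun_prop) ht
    filter_upwards [h1.eventually hev, h2] with p hp hp2
    obtain ⟨φ, hφ, hRφ⟩ := hp
    refine ⟨φ, hφ, ?_⟩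
    have := hR.step _ _ _ p.2.2 c hRφ hp2.le
    rwa [mul_smul_comm] at this
  · simp only [Φ, hΨ, ha]
  · have key : ∀ (y : X) (s : ℝ), star (NormedSpace.exp ((t : ℂ) • a) * g) *
        fderiv ℝ Φ (0, (x₀, t)) (0, (y, s)) =
        star g * fderiv ℝ Ψ (0, x₀) (0, y) + s • (star g * a * g) := by
      intro y s
      have h1 : HasDerivAt (fun r : ℝ => ((0 : ℝ), (x₀ + r • y, t + r * s)))
          ((0 : ℝ), (y, s)) 0 := by
        refine (hasDerivAt_const _ _).prodMk (HasDerivAt.prodMk ?_ ?_)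
        · simpa using ((hasDerivAt_id (0 : ℝ)).smul_const y).const_add x₀
        · simpa using ((hasDerivAt_id (0 : ℝ)).mul_const s).const_add t
      have h1' : HasDerivAt (fun r : ℝ => ((0 : ℝ), x₀ + r • y)) ((0 : ℝ), y) 0 := by
        refine (hasDerivAt_const _ _).prodMk ?_
        simpa using ((hasDerivAt_id (0 : ℝ)).smul_const y).const_add x₀
      have h2 : HasDerivAt (fun r : ℝ => Φ ((0 : ℝ), (x₀ + r • y, t + r * s)))
          (fderiv ℝ Φ (0, (x₀, t)) (0, (y, s))) 0 := by
        have h6 : HasFDerivAt Φ (fderiv ℝ Φ (0, (x₀, t)))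
            ((0 : ℝ), (x₀ + (0 : ℝ) • y, t + (0 : ℝ) * s)) := by
          simpa using (hΦ.differentiable one_ne_zero (0, (x₀, t))).hasFDerivAt
        exact h6.comp_hasDerivAt (0 : ℝ) h1
      have h3 : HasDerivAt (fun r : ℝ => Ψ ((0 : ℝ), x₀ + r • y))
          (fderiv ℝ Ψ (0, x₀) (0, y)) 0 := by
        refine HasFDerivAt.comp_hasDerivAt (0 : ℝ) ?_ h1'
        simpa using (hc.differentiable one_ne_zero (0, x₀)).hasFDerivAt
      have h4 : HasDerivAt (fun r : ℝ => NormedSpace.exp (((t + r * s : ℝ) : ℂ) • a))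
          (s • (NormedSpace.exp ((t : ℂ) • a) * a)) 0 := by
        have h5 : HasDerivAt (fun r : ℝ => t + r * s) s 0 := by
          simpa using ((hasDerivAt_id (0 : ℝ)).mul_const s).const_add t
        have h6 : HasDerivAt (fun r : ℝ => NormedSpace.exp ((r : ℂ) • a))
            (NormedSpace.exp ((t : ℂ) • a) * a) (t + 0 * s) := by
          simpa using hasDerivAt_exp_ofReal_smul a t
        exact h6.scomp (0 : ℝ) h5
      have h5 := h2.unique (h4.mul h3)
      rw [h5]
      simp only [zero_mul, add_zero, zero_smul, hΨ]
      have h6 := Unitary.star_mul_self_of_mem haE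
      rw [star_mul, mul_add]
      simp only [smul_mul_assoc, mul_smul_comm]
      have h7 : ∀ x : A, star g * star (NormedSpace.exp ((t : ℂ) • a)) *
          (NormedSpace.exp ((t : ℂ) • a) * x) = star g * x := fun x => by
        rw [mul_assoc, ← mul_assoc (star (NormedSpace.exp ((t : ℂ) • a))), h6, one_mul]
      rw [h7, mul_assoc (NormedSpace.exp ((t : ℂ) • a)) a g, h7, add_comm, mul_assoc]
    intro d hd
    obtain ⟨d₁, hd₁, d₂, hd₂, rfl⟩ := Submodule.mem_sup.1 hd
    obtain ⟨s, rfl⟩ := Submodule.mem_span_singleton.1 hd₂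
    obtain ⟨y, hy, hτ⟩ := hD d₁ hd₁
    refine ⟨(y, s), ?_, ?_⟩
    · rw [key, hy]
      rfl
    · simp [hτ]

end LocalControllability

/-! ### Maximal spaces of directions -/

section LocalControllability

variable {A : Type*} [CStarAlgebra A]

/-- Near `1` the skew part is an injective coordinate on the unitaries: the difference is
self-adjoint, and unitarity bounds twice its norm by its norm. -/
theorem eq_of_mem_unitary_of_sub_star_eq {X Y : A} (hX : X ∈ unitary A) (hY : Y ∈ unitary A)
    (hX1 : ‖X - 1‖ < 1 / 4) (hY1 : ‖Y - 1‖ < 1 / 4) (h : X - star X = Y - star Y) : X = Y := by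
  set D := X - Y with hD
  have hsD : star D = D := by
    rw [sub_eq_sub_iff_add_eq_add] at h
    rw [hD, star_sub, sub_eq_sub_iff_add_eq_add, add_comm, ← h]
  have hsY : star (Y - 1) = star Y - 1 := by simp
  have hkey : (2 : ℝ) • D = -((Y - 1) * D + D * star (Y - 1) + D * D) := by
    have h1 : (Y + D) * (star Y + D) = 1 := by
      have h2 : Y + D = X := by rw [hD]; abel
      have h3 : star Y + D = star X := by rw [← h2, star_add, hsD]
      rw [h2, h3, Unitary.mul_star_self_of_mem hX]
    have h4 := Unitary.mul_star_self_of_mem hY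
    have h5 : Y * D + D * star Y + D * D = 0 := by
      have : (Y + D) * (star Y + D) = Y * star Y + (Y * D + D * star Y + D * D) := by noncomm_ring
      rw [this, h4] at h1
      simpa using h1
    rw [hsY, two_smul, ← sub_eq_zero, ← h5]
    noncomm_ring
  have hDn : ‖D‖ ≤ 1 / 2 := by
    have : D = (X - 1) - (Y - 1) := by rw [hD]; abel
    rw [this]
    exact (norm_sub_le _ _).trans (by linarith)
  have h2 : 2 * ‖D‖ ≤ ‖D‖ := by
    have h3 : ‖(2 : ℝ) • D‖ = 2 * ‖D‖ := by rw [norm_smul]; norm_num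
    rw [← h3, hkey, norm_neg]
    have h4 : ‖star (Y - 1)‖ < 1 / 4 := by rwa [norm_star]
    have h5 := norm_mul_le (Y - 1) D
    have h6 := norm_mul_le D (star (Y - 1))
    have h7 := norm_mul_le D D
    refine (norm_add_le _ _).trans ?_
    have h8 := norm_add_le ((Y - 1) * D) (D * star (Y - 1))
    nlinarith [norm_nonneg D]
  exact sub_eq_zero.1 (norm_le_zero_iff.1 (by linarith))

/-- The skew-adjoint part. -/
def skewPart (A : Type*) [CStarAlgebra A] : A →L[ℝ] A :=
  (2⁻¹ : ℝ) • (ContinuousLinearMap.id ℝ A - (starL' ℝ : A ≃L[ℝ] A).toContinuousLinearMap)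

theorem skewPart_apply (X : A) : skewPart A X = (2⁻¹ : ℝ) • (X - star X) := rfl

theorem star_skewPart (X : A) : star (skewPart A X) = -skewPart A X := by
  simp [skewPart_apply, ← smul_neg]

theorem skewPart_of_star_eq_neg {X : A} (hX : star X = -X) : skewPart A X = X := by
  rw [skewPart_apply, hX, sub_neg_eq_add, ← two_smul ℝ X, smul_smul]
  norm_num

theorem norm_skewPart_le (X : A) : ‖skewPart A X‖ ≤ ‖X‖ := by
  rw [skewPart_apply, norm_smul]
  have := norm_sub_le X (star X)
  rw [norm_star] at this
  norm_num
  linarith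

/-- A subspace of complex combinations of skew-adjoint elements of a real subspace. -/
def skewComplexSpan (D : Submodule ℝ A) : Submodule ℂ A where
  carrier := {X | ∃ u ∈ D, ∃ v ∈ D, star u = -u ∧ star v = -v ∧ X = u + Complex.I • v}
  zero_mem' := ⟨0, D.zero_mem, 0, D.zero_mem, by simp, by simp, by simp⟩
  add_mem' := by
    rintro _ _ ⟨u, hu, v, hv, hus, hvs, rfl⟩ ⟨u', hu', v', hv', hus', hvs', rfl⟩
    refine ⟨u + u', D.add_mem hu hu', v + v', D.add_mem hv hv', ?_, ?_, ?_⟩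
    · rw [star_add, hus, hus', neg_add]
    · rw [star_add, hvs, hvs', neg_add]
    · rw [smul_add]; abel
  smul_mem' := by
    rintro c _ ⟨u, hu, v, hv, hus, hvs, rfl⟩
    refine ⟨c.re • u - c.im • v, D.sub_mem (D.smul_mem _ hu) (D.smul_mem _ hv),
      c.im • u + c.re • v, D.add_mem (D.smul_mem _ hu) (D.smul_mem _ hv), ?_, ?_, ?_⟩
    · simp [hus, hvs]; abel
    · simp [hus, hvs]; abel
    · conv_lhs => rw [← Complex.re_add_im c]
      simp only [← Complex.coe_smul]
      have h := Complex.I_mul_I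
      match_scalars
      · ring
      · linear_combination (c.im : ℂ) * h

/-- In `u + i v` with `u`, `v` skew-adjoint, the term `i v` is self-adjoint, so it must vanish. This
brings complex spans back to real directions. -/
theorem mem_of_mem_skewComplexSpan {D : Submodule ℝ A} {X : A} (hX : X ∈ skewComplexSpan D)
    (hs : star X = -X) : X ∈ D := by
  obtain ⟨u, hu, v, -, hus, hvs, rfl⟩ := hX
  have h1 : star (Complex.I • v) = Complex.I • v := by simp [hvs]
  rw [star_add, hus, h1, neg_add, add_right_inj] at hs
  have h2 : (2 : ℝ) • (Complex.I • v) = 0 := by rw [two_smul, add_eq_zero_iff_eq_neg.2 hs]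
  replace h2 := (smul_eq_zero_iff_right two_ne_zero).1 h2
  rwa [h2, add_zero]

/-- The evolutions under piecewise constant controls, without the perturbation. -/
def evolutions (h k h₁ : A) : Submonoid A :=
  Submonoid.closure {e | ∃ t c : ℝ, 0 < t ∧
    e = NormedSpace.exp ((t : ℂ) • controlGenerator h k h₁ 0 c)}

/-- The complex span of the conjugates of `h₁` by the evolutions. -/
def conjugateSpan (h k h₁ : A) : Submodule ℂ A :=
  Submodule.span ℂ {X | ∃ w ∈ evolutions h k h₁, X = star w * h₁ * w}

theorem self_mem_conjugateSpan (h k h₁ : A) : h₁ ∈ conjugateSpan h k h₁ :=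
  Submodule.subset_span ⟨1, one_mem _, by simp⟩

variable [FiniteDimensional ℂ A]

/-- The derivative at time `0` of conjugation by the evolution. -/
theorem commutator_mem_of_conj_mem {W : Submodule ℂ A} {a X : A} (ha : star a = -a) (hX : X ∈ W)
    (h : ∀ t : ℝ, 0 < t → star (NormedSpace.exp ((t : ℂ) • a)) * X *
      NormedSpace.exp ((t : ℂ) • a) ∈ W) : X * a - a * X ∈ W := by
  have h1 : HasDerivAt (fun t : ℝ => star (NormedSpace.exp ((t : ℂ) • a)) * X *
      NormedSpace.exp ((t : ℂ) • a)) (X * a - a * X) 0 := by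
    have h2 := hasDerivAt_exp_ofReal_smul a 0
    have h3 := (h2.star.mul_const X).mul h2
    refine h3.congr_deriv ?_
    simp [ha]
    abel
  have h4 := h1.tendsto_slope_zero_right
  have hcl : IsClosed (W : Set A) := W.closed_of_finiteDimensional
  refine hcl.mem_of_tendsto h4 ?_
  filter_upwards [self_mem_nhdsWithin] with t ht
  have h5 : t⁻¹ • (star (NormedSpace.exp (((0 + t : ℝ) : ℂ) • a)) * X *
      NormedSpace.exp (((0 + t : ℝ) : ℂ) • a) - star (NormedSpace.exp (((0 : ℝ) : ℂ) • a)) * X *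
      NormedSpace.exp (((0 : ℝ) : ℂ) • a)) ∈ W := by
    rw [← Complex.coe_smul]
    refine W.smul_mem _ (W.sub_mem ?_ ?_)
    · rw [zero_add]
      exact h t ht
    · simpa using hX
  exact h5

/-- Appending a short evolution maps conjugates of `h₁` to such conjugates; differentiating at time
zero gives the commutator. -/
theorem commutator_generator_mem_conjugateSpan {h k h₁ : A} (hh : IsSelfAdjoint h)
    (hk : IsSelfAdjoint k) (hh₁ : IsSelfAdjoint h₁) (c : ℝ) {X : A}
    (hX : X ∈ conjugateSpan h k h₁) :
    X * controlGenerator h k h₁ 0 c - controlGenerator h k h₁ 0 c * X ∈ conjugateSpan h k h₁ := by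
  refine commutator_mem_of_conj_mem (star_controlGenerator hh hk hh₁ 0 c) hX fun t ht => ?_
  set e := NormedSpace.exp ((t : ℂ) • controlGenerator h k h₁ 0 c) with he
  have hmem : e ∈ evolutions h k h₁ := Submonoid.subset_closure ⟨t, c, ht, rfl⟩
  induction hX using Submodule.span_induction with
  | mem x hx =>
    obtain ⟨w, hw, rfl⟩ := hx
    refine Submodule.subset_span ⟨w * e, mul_mem hw hmem, ?_⟩
    simp only [star_mul, mul_assoc]
  | zero => simp
  | add x y _ _ hx hy =>
    rw [mul_add, add_mul]
    exact Submodule.add_mem _ hx hy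
  | smul c x _ hx =>
    rw [mul_smul_comm, smul_mul_assoc]
    exact Submodule.smul_mem _ c hx

/-- The control value 0 gives the drift, and the difference between the values 1 and 0 gives `h₁`.
-/
theorem commutator_mem_conjugateSpan {h k h₁ : A} (hh : IsSelfAdjoint h)
    (hk : IsSelfAdjoint k) (hh₁ : IsSelfAdjoint h₁) {X : A} (hX : X ∈ conjugateSpan h k h₁) :
    h * X - X * h ∈ conjugateSpan h k h₁ ∧ h₁ * X - X * h₁ ∈ conjugateSpan h k h₁ := by
  have h0 : h * X - X * h ∈ conjugateSpan h k h₁ := by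
    convert Submodule.smul_mem _ (-Complex.I)
      (commutator_generator_mem_conjugateSpan hh hk hh₁ 0 hX) using 1
    simp [controlGenerator, smul_smul]
    abel
  refine ⟨h0, ?_⟩
  have h1 : (h * X - X * h) + (h₁ * X - X * h₁) ∈ conjugateSpan h k h₁ := by
    convert Submodule.smul_mem _ (-Complex.I)
      (commutator_generator_mem_conjugateSpan hh hk hh₁ 1 hX) using 1
    simp [controlGenerator, smul_add, smul_sub, smul_smul, mul_add, add_mul]
    abel
  exact (Submodule.add_mem_iff_right _ h0).1 h1

/-- If the commutators of the Hamiltonians span everything up to multiples of `1`, some reached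
element can be moved in all directions, and in time. -/
theorem exists_isReachDirection_full {h k h₁ : A} (hh : IsSelfAdjoint h) (hk : IsSelfAdjoint k)
    (hh₁ : IsSelfAdjoint h₁) {R : ℝ → ℝ → A → Prop} (hR : ContainsReachable h k h₁ R)
    (hspan : ∀ W : Submodule ℂ A, h₁ ∈ W → (∀ X ∈ W, h * X - X * h ∈ W) →
      (∀ X ∈ W, h₁ * X - X * h₁ ∈ W) → ∀ X, ∃ z : ℂ, X - z • 1 ∈ W) :
    ∃ (g : A) (D : Submodule ℝ (A × ℝ)), IsReachDirection R g D ∧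
      ∀ X : A, star X = -X → ∀ s : ℝ, (X, s) ∈ D := by
  have hfin : FiniteDimensional ℝ A := FiniteDimensional.complexToReal A
  obtain ⟨D, ⟨hDI, g₀, hg₀⟩, hmax⟩ := (set_has_maximal_iff_noetherian (R := ℝ) (M := A × ℝ)).2
    inferInstance {D | (Complex.I • (1 : A), (0 : ℝ)) ∈ D ∧ ∃ g, IsReachDirection R g D}
    ⟨_, Submodule.mem_span_singleton_self _, 1, isReachDirection_one hR⟩
  -- One more step cannot enlarge the maximal `D`, so the direction it adds already lies in `D`.
  have hstep : ∀ g, IsReachDirection R g D → ∀ t c : ℝ, 0 < t →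
      IsReachDirection R (NormedSpace.exp ((t : ℂ) • controlGenerator h k h₁ 0 c) * g) D ∧
        (star g * controlGenerator h k h₁ 0 c * g, (1 : ℝ)) ∈ D := by
    intro g hg t c ht
    have h1 := hg.step hh hk hh₁ hR ht c
    have h2 := hmax _ ⟨Submodule.mem_sup_left hDI, _, h1⟩
    have h3 := eq_of_le_of_not_lt le_sup_left h2
    rw [← h3] at h1
    refine ⟨h1, ?_⟩
    rw [h3]
    exact Submodule.mem_sup_right (Submodule.mem_span_singleton_self _)
  have hw : ∀ w ∈ evolutions h k h₁, IsReachDirection R (w * g₀) D := by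
    intro w hw
    induction hw using Submonoid.closure_induction_left with
    | one => simpa using hg₀
    | mul_left x hx y _ hy =>
      obtain ⟨t, c, ht, rfl⟩ := hx
      rw [mul_assoc]
      exact (hstep _ hy t c ht).1
  -- Subtracting the directions for the controls 1 and 0 cancels both the drift and the time
  -- component.
  have hgen : ∀ w ∈ evolutions h k h₁,
      (star g₀ * (-Complex.I • (star w * h₁ * w)) * g₀, (0 : ℝ)) ∈ D := by
    intro w hwm
    have h1 := (hstep _ (hw w hwm) 1 1 one_pos).2
    have h0 := (hstep _ (hw w hwm) 1 0 one_pos).2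
    convert D.sub_mem h1 h0 using 1
    rw [Prod.mk_sub_mk, sub_self]
    congr 1
    simp only [controlGenerator, star_mul]
    simp [mul_add, add_mul, mul_assoc]
  have hgu := hg₀.mem_unitary hR
  have hg1 := Unitary.star_mul_self_of_mem hgu
  have hg2 := Unitary.mul_star_self_of_mem hgu
  let D₀ : Submodule ℝ A := D.comap ((LinearMap.inl ℝ A ℝ).comp
    ((LinearMap.mulRight ℝ g₀).comp (LinearMap.mulLeft ℝ (star g₀))))
  have hD₀ : ∀ X, X ∈ D₀ ↔ (star g₀ * X * g₀, (0 : ℝ)) ∈ D := fun X => Iff.rfl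
  have hI : Complex.I • (1 : A) ∈ D₀ := by
    rw [hD₀, mul_smul_comm, mul_one, smul_mul_assoc, hg1]
    exact hDI
  have hIs : star (Complex.I • (1 : A)) = -(Complex.I • (1 : A)) := by simp
  have hone : (1 : A) ∈ skewComplexSpan D₀ :=
    ⟨0, D₀.zero_mem, -(Complex.I • 1), D₀.neg_mem hI, by simp, by simp, by simp [smul_smul]⟩
  have hW : conjugateSpan h k h₁ ≤ skewComplexSpan D₀ := by
    refine Submodule.span_le.2 ?_
    rintro _ ⟨w, hwm, rfl⟩
    refine ⟨0, D₀.zero_mem, -Complex.I • (star w * h₁ * w), (hD₀ _).2 (hgen w hwm), by simp, ?_, ?_⟩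
    · simp [hh₁.star_eq, mul_assoc]
    · simp [smul_smul]
  have hskew : ∀ X : A, star X = -X → X ∈ D₀ := by
    intro X hX
    obtain ⟨z, hz⟩ := hspan (conjugateSpan h k h₁) (self_mem_conjugateSpan h k h₁)
      (fun X hX => (commutator_mem_conjugateSpan hh hk hh₁ hX).1)
      (fun X hX => (commutator_mem_conjugateSpan hh hk hh₁ hX).2) X
    refine mem_of_mem_skewComplexSpan ?_ hX
    have := (skewComplexSpan D₀).add_mem (hW hz) ((skewComplexSpan D₀).smul_mem z hone)
    rwa [sub_add_cancel] at this
  have hskew' : ∀ X : A, star X = -X → (X, (0 : ℝ)) ∈ D := by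
    intro X hX
    have h1 := (hD₀ _).1 (hskew (g₀ * X * star g₀) (by simp [hX, mul_assoc]))
    have h2 : star g₀ * (g₀ * X * star g₀) * g₀ = X := by
      calc star g₀ * (g₀ * X * star g₀) * g₀ = (star g₀ * g₀) * X * (star g₀ * g₀) := by
            noncomm_ring
        _ = X := by rw [hg1, one_mul, mul_one]
    rwa [h2] at h1
  refine ⟨g₀, D, hg₀, fun X hX s => ?_⟩
  -- One direction with time component 1 suffices; its skew-adjoint part is corrected by directions
  -- that do not change the time.
  set B := star g₀ * controlGenerator h k h₁ 0 0 * g₀ with hB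
  have hBs : star B = -B := by
    simp [hB, star_controlGenerator hh hk hh₁, mul_assoc]
  have h1 : (B, (1 : ℝ)) ∈ D := (hstep g₀ hg₀ 1 0 one_pos).2
  have h2 := hskew' (X - s • B) (by
    rw [star_sub, star_smul, hX, hBs]
    simp; abel)
  have h3 := D.add_mem h2 (D.smul_mem s h1)
  simpa using h3

end LocalControllability

/-! ### A ball reached at one fixed time -/

section LocalControllability

variable {A : Type*} [CStarAlgebra A] [FiniteDimensional ℂ A]

/-- If the commutators of the Hamiltonians span everything up to multiples of `1`, a ball of
unitaries is reached, up to phases, at one time, uniformly for small perturbations of the drift. -/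
theorem exists_reached_ball {h k h₁ : A} (hh : IsSelfAdjoint h) (hk : IsSelfAdjoint k)
    (hh₁ : IsSelfAdjoint h₁) {R : ℝ → ℝ → A → Prop} (hR : ContainsReachable h k h₁ R)
    (hspan : ∀ W : Submodule ℂ A, h₁ ∈ W → (∀ X ∈ W, h * X - X * h ∈ W) →
      (∀ X ∈ W, h₁ * X - X * h₁ ∈ W) → ∀ X, ∃ z : ℂ, X - z • 1 ∈ W) :
    ∃ (T : ℝ) (g : A), R 0 T g ∧ ∃ r > 0, ∃ ε₀ > 0, ∀ ε : ℝ, |ε| < ε₀ →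
      ∀ V ∈ unitary A, ‖V - g‖ < r → ∃ φ : ℝ, |φ| < 1 ∧
        R ε T (Complex.exp (-(φ * Complex.I)) • V) := by
  have hfin : FiniteDimensional ℝ A := FiniteDimensional.complexToReal A
  obtain ⟨g, D, hg, hDfull⟩ := exists_isReachDirection_full hh hk hh₁ hR hspan
  have hgu := hg.mem_unitary hR
  have hsg : star g ∈ unitary A := Unitary.star_mem hgu
  obtain ⟨X, _, _, _, Ψ, τ, x₀, hc, hev, hΨ, hD⟩ := hg
  let S := (skewPart A : A →ₗ[ℝ] A).range
  let sk : A →L[ℝ] S := (skewPart A).codRestrict S fun x => ⟨x, rfl⟩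
  have hsk : ∀ x, (sk x : A) = skewPart A x := fun x => rfl
  -- Keeping `ε` and the time among the coordinates makes the open mapping argument uniform in `ε`
  -- and lets it prescribe the time exactly. The skew part serves as a chart of the unitary group.
  let G : ℝ × X → ℝ × S × ℝ := fun p => (p.1, sk (star g * Ψ p), τ p.2)
  let L := fderiv ℝ Ψ (0, x₀)
  let G' : ℝ × X →L[ℝ] ℝ × S × ℝ := (ContinuousLinearMap.fst ℝ ℝ X).prod
    ((sk.comp ((ContinuousLinearMap.mul ℝ A (star g)).comp L)).prod
      (τ.comp (ContinuousLinearMap.snd ℝ ℝ X)))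
  have hG : HasStrictFDerivAt G G' (0, x₀) := by
    have h1 : HasStrictFDerivAt Ψ L (0, x₀) :=
      hc.contDiffAt.hasStrictFDerivAt one_ne_zero
    refine hasStrictFDerivAt_fst.prodMk (HasStrictFDerivAt.prodMk ?_ ?_)
    · exact (sk.comp (ContinuousLinearMap.mul ℝ A (star g))).hasStrictFDerivAt.comp (0, x₀) h1
    · exact τ.hasStrictFDerivAt.comp (0, x₀) hasStrictFDerivAt_snd
  have hsurj : G'.range = ⊤ := by
    rw [eq_top_iff]
    rintro ⟨e, ⟨_, ⟨s, rfl⟩⟩, t⟩ -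
    obtain ⟨y, hy, hyt⟩ := hD _ (hDfull (skewPart A s - skewPart A (star g * L (e, 0))) (by
      rw [star_sub, star_skewPart, star_skewPart]; abel) t)
    refine ⟨(e, y), ?_⟩
    have h1 : L (e, y) = L (e, 0) + L (0, y) := by rw [← map_add]; simp
    refine Prod.ext rfl (Prod.ext (Subtype.ext ?_) hyt)
    change skewPart A (star g * L (e, y)) = skewPart A s
    rw [h1, mul_add, map_add, hy, map_sub, skewPart_of_star_eq_neg (star_skewPart s),
      skewPart_of_star_eq_neg (star_skewPart _)]
    abel
  have hmap := hG.map_nhds_eq_of_surj hsurj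
  have hnear : ∀ᶠ p in 𝓝 ((0 : ℝ), x₀), ‖star g * Ψ p - 1‖ < 1 / 4 := by
    have hcΨ : Continuous Ψ := hc.continuous
    refine ContinuousAt.eventually_lt (by fun_prop) continuousAt_const ?_
    rw [hΨ, Unitary.star_mul_self_of_mem hgu]
    simp
  have himg := Filter.image_mem_map (m := G) (hev.and hnear)
  rw [hmap] at himg
  obtain ⟨r, hr, hball⟩ := Metric.mem_nhds_iff.1 himg
  -- Only a phase multiple of `g` is known to be reached, so the ball is recentred there; the two
  -- phases below `1/2` combine to one below `1`.
  obtain ⟨φ₀, hφ₀, hRφ₀⟩ := hev.self_of_nhds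
  rw [hΨ] at hRφ₀
  suffices hmain : ∀ ε : ℝ, |ε| < r → ∀ V ∈ unitary A, ‖V - g‖ < min r (1 / 4) →
      ∃ φ : ℝ, |φ| < 1 / 2 ∧ R ε (τ x₀) (Complex.exp (-(φ * Complex.I)) • V) by
    refine ⟨τ x₀, _, hRφ₀, min r (1 / 4), by positivity, r, hr, fun ε hε V hV hVg => ?_⟩
    have hz := Complex.norm_exp_ofReal_mul_I φ₀
    have hzz : Complex.exp (φ₀ * Complex.I) * Complex.exp (-(φ₀ * Complex.I)) = 1 := by
      rw [← Complex.exp_add, add_neg_cancel, Complex.exp_zero]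
    obtain ⟨φ, hφ, hRφ⟩ := hmain ε hε _ (smul_mem_unitary_of_norm_eq_one hz hV) (by
      have h1 : Complex.exp (φ₀ * Complex.I) • V - g = Complex.exp (φ₀ * Complex.I) •
          (V - Complex.exp (-(φ₀ * Complex.I)) • g) := by
        rw [smul_sub, smul_smul, hzz, one_smul]
      rwa [h1, norm_smul, hz, one_mul])
    refine ⟨φ - φ₀, (abs_sub _ _).trans_lt (by linarith), ?_⟩
    rw [smul_smul, ← Complex.exp_add] at hRφ
    convert hRφ using 3
    push_cast
    ring
  intro ε hε V hV hVg
  have hVn : ‖star g * V - 1‖ = ‖V - g‖ := by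
    have : star g * V - 1 = star g * (V - g) := by
      rw [mul_sub, Unitary.star_mul_self_of_mem hgu]
    rw [this]
    exact CStarRing.norm_coe_unitary_mul ⟨star g, hsg⟩ _
  have hG0 : G (0, x₀) = (0, 0, τ x₀) := by
    refine Prod.ext rfl (Prod.ext (Subtype.ext ?_) rfl)
    change skewPart A (star g * Ψ (0, x₀)) = 0
    rw [hΨ, Unitary.star_mul_self_of_mem hgu, skewPart_apply]
    simp
  have hpt : (ε, sk (star g * V), τ x₀) ∈ Metric.ball (G (0, x₀)) r := by
    rw [hG0, mem_ball_iff_norm, Prod.mk_sub_mk, Prod.mk_sub_mk, sub_zero, sub_zero, sub_self,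
      Prod.norm_mk, Prod.norm_mk, norm_zero]
    refine max_lt hε (max_lt ?_ hr)
    have h1 : sk (star g * V) = sk (star g * V - 1) := by
      refine Subtype.ext ?_
      rw [hsk, hsk, map_sub, skewPart_apply 1]
      simp
    rw [h1]
    refine (norm_skewPart_le _).trans_lt ?_
    rw [hVn]
    exact hVg.trans_le (min_le_left _ _)
  obtain ⟨⟨ε', x⟩, ⟨⟨φ, hφ, hRφ⟩, hn⟩, hGx⟩ := hball hpt
  obtain ⟨rfl, hGx2⟩ := Prod.ext_iff.1 hGx
  obtain ⟨hs, ht⟩ := Prod.ext_iff.1 hGx2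
  have hs' : skewPart A (star g * Ψ (ε', x)) = skewPart A (star g * V) := congrArg Subtype.val hs
  have ht' : τ x = τ x₀ := ht
  refine ⟨φ, hφ, ?_⟩
  have hΨu : Ψ (ε', x) ∈ unitary A := hR.mem_unitary_of_phase hRφ
  have heq : star g * Ψ (ε', x) = star g * V := by
    refine eq_of_mem_unitary_of_sub_star_eq (mul_mem hsg hΨu) (mul_mem hsg hV) hn ?_ ?_
    · rw [hVn]
      exact hVg.trans_le (min_le_right _ _)
    · exact smul_right_injective A (inv_ne_zero two_ne_zero : (2⁻¹ : ℝ) ≠ 0) hs'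
  have hV' : Ψ (ε', x) = V := by
    have := congrArg (g * ·) heq
    simpa [← mul_assoc, Unitary.mul_star_self_of_mem hgu] using this
  rw [← hV', ← ht']
  exact hRφ

end LocalControllability

/-! ### Powers of a neighbourhood of `1` in the special unitary group -/

section SpecialUnitary

open scoped Matrix.Norms.L2Operator Pointwise

/-- The spectrum is finite, so the argument is continuous on it despite its jump on the negative
axis, and functional calculus gives a logarithm even when `-1` is an eigenvalue. -/
theorem exists_exp_eq_of_mem_unitary {n : ℕ} {V : Matrix (Fin n) (Fin n) ℂ}
    (hV : V ∈ unitary (Matrix (Fin n) (Fin n) ℂ)) :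
    ∃ x : selfAdjoint (Matrix (Fin n) (Fin n) ℂ), ‖x‖ ≤ Real.pi ∧
      (selfAdjoint.expUnitary x : Matrix (Fin n) (Fin n) ℂ) = V := by
  have hc : ContinuousOn Complex.arg (spectrum ℂ V) := (Matrix.finite_spectrum V).continuousOn _
  refine ⟨Unitary.argSelfAdjoint ⟨V, hV⟩, Unitary.norm_argSelfAdjoint_le_pi _, ?_⟩
  rw [selfAdjoint.expUnitary_coe, Unitary.argSelfAdjoint_coe,
    ← CFC.exp_eq_normedSpace_exp (𝕜 := ℂ), ← cfc_comp_smul .., ← cfc_comp' ..]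
  conv_rhs => rw [← cfc_id' ℂ V]
  refine cfc_congr fun y hy ↦ ?_
  have hy₁ : ‖y‖ = 1 := spectrum.norm_eq_one_of_unitary hV hy
  have : Complex.I * y.arg = Complex.log y :=
    Complex.ext (by simp [Complex.log_re, hy₁]) (by simp [Complex.log_im])
  simpa [← Complex.exp_eq_exp_ℂ, this] using Complex.exp_log (by aesop)

theorem norm_expUnitary_sub_one_le {A : Type*} [CStarAlgebra A] {x : selfAdjoint A}
    (hx : ‖x‖ ≤ Real.pi) : ‖(selfAdjoint.expUnitary x - 1 : A)‖ ≤ ‖x‖ := by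
  refine (sq_le_sq₀ (norm_nonneg _) (norm_nonneg _)).1 ?_
  rw [selfAdjoint.norm_sq_expUnitary_sub_one hx]
  linarith [Real.one_sub_sq_div_two_le_cos (x := ‖x‖)]

/-- The special unitary matrices within `ρ` of `1`. -/
def smallSU (ρ : ℝ) : Set (Matrix (Fin 4) (Fin 4) ℂ) :=
  {v | v ∈ unitary (Matrix (Fin 4) (Fin 4) ℂ) ∧ v.det = 1 ∧ ‖v - 1‖ < ρ}

/-- A diagonal special unitary matrix that differs from a scalar matrix in one entry. -/
def phaseDiag (α : ℝ) : Matrix (Fin 4) (Fin 4) ℂ :=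
  diagonal fun i => Complex.exp (Complex.I * (if i = 3 then -(3 * α) else α : ℝ))

theorem phaseDiag_mem_smallSU {α ρ : ℝ} (h : 3 * |α| < ρ) : phaseDiag α ∈ smallSU ρ := by
  have hα : |α| < ρ := by linarith [abs_nonneg α]
  refine ⟨?_, ?_, ?_⟩
  · rw [Unitary.mem_iff, phaseDiag, star_eq_conjTranspose, diagonal_conjTranspose,
      diagonal_mul_diagonal, diagonal_mul_diagonal, ← diagonal_one]
    have h1 : ∀ t : ℝ, star (Complex.exp (Complex.I * t)) * Complex.exp (Complex.I * t) = 1 := by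
      intro t
      rw [Complex.star_def, Complex.conj_mul', mul_comm, Complex.norm_exp_ofReal_mul_I]
      simp
    constructor
    · congr 1
      ext i
      exact h1 _
    · congr 1
      ext i
      exact (mul_comm _ _).trans (h1 _)
  · rw [phaseDiag, det_diagonal, ← Complex.exp_sum, Fin.sum_univ_four]
    simp only [Fin.reduceEq, if_false, if_true]
    rw [← Complex.exp_zero]
    congr 1
    push_cast
    ring
  · rw [phaseDiag, ← diagonal_one, diagonal_sub, l2_opNorm_diagonal,
      pi_norm_lt_iff (by linarith [abs_nonneg α])]
    intro i
    refine (Real.norm_exp_I_mul_ofReal_sub_one_le).trans_lt ?_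
    rw [Real.norm_eq_abs]
    split_ifs
    · rw [abs_neg, abs_mul]
      simpa using h
    · exact hα

theorem det_expUnitary {n : ℕ} (x : selfAdjoint (Matrix (Fin n) (Fin n) ℂ)) :
    (selfAdjoint.expUnitary x : Matrix (Fin n) (Fin n) ℂ).det =
      Complex.exp (Complex.I * (x : Matrix (Fin n) (Fin n) ℂ).trace) := by
  rw [selfAdjoint.expUnitary_coe]
  exact det_exp_smul_of_isHermitian x.2 _

theorem trace_eq_ofReal_re {n : ℕ} {x : Matrix (Fin n) (Fin n) ℂ} (hx : IsSelfAdjoint x) :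
    x.trace = (x.trace.re : ℂ) := by
  refine (Complex.conj_eq_iff_re.1 ?_).symm
  rw [← Complex.star_def, ← trace_conjTranspose, ← star_eq_conjTranspose, hx.star_eq]

/-- The special unitary group is covered by a power of any neighbourhood of `1`. -/
theorem exists_mem_smallSU_pow {ρ : ℝ} (hρ : 0 < ρ) : ∃ N : ℕ,
    ∀ V ∈ unitary (Matrix (Fin 4) (Fin 4) ℂ), V.det = 1 → V ∈ smallSU ρ ^ N := by
  let tr : Matrix (Fin 4) (Fin 4) ℂ →L[ℂ] ℂ :=
    LinearMap.toContinuousLinearMap (Matrix.traceLinearMap (Fin 4) ℂ ℂ)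
  have htr : ∀ x, tr x = x.trace := fun x => rfl
  -- Large enough for an `N`-th root of `V` and the correcting phases of size `|τ|/(4N)` to stay
  -- within `ρ` of `1`.
  obtain ⟨N, hN⟩ := exists_nat_gt ((‖tr‖ + 1) * Real.pi / ρ)
  have hN0 : (0 : ℝ) < N := lt_of_le_of_lt (by positivity) hN
  have hN0' : N ≠ 0 := by rintro rfl; simp at hN0
  have hN1 : (1 : ℝ) ≤ N := by exact_mod_cast Nat.one_le_iff_ne_zero.2 hN0'
  rw [div_lt_iff₀ hρ] at hN
  refine ⟨N + N, fun V hV hdet => ?_⟩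
  obtain ⟨x, hx, hxV⟩ := exists_exp_eq_of_mem_unitary hV
  set τ := (x : Matrix (Fin 4) (Fin 4) ℂ).trace.re with hτ
  have htx : (x : Matrix (Fin 4) (Fin 4) ℂ).trace = τ := trace_eq_ofReal_re x.2
  have hτb : |τ| ≤ ‖tr‖ * Real.pi := by
    have h1 := tr.le_opNorm x
    rw [htr, htx, Complex.norm_real, Real.norm_eq_abs] at h1
    exact h1.trans (mul_le_mul_of_nonneg_left hx (norm_nonneg _))
  -- The root has determinant `exp (iτ/N)`; the phase `exp (-iα)` normalises it. The trace `τ` may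
  -- be a nonzero multiple of `2π`, which leaves the scalar `exp (iτ/4)` to be made up.
  set α := τ / (4 * N) with hα
  have hα4 : 4 * (N * α) = τ := by rw [hα]; field_simp
  have hαb : 4 * |α| * N ≤ ‖tr‖ * Real.pi := by
    rw [← hα4, abs_mul, abs_mul, abs_of_pos hN0] at hτb
    norm_num at hτb
    linarith
  have hcN : (N : ℂ) ≠ 0 := Nat.cast_ne_zero.2 hN0'
  let y : selfAdjoint (Matrix (Fin 4) (Fin 4) ℂ) :=
    ⟨((N⁻¹ : ℝ) : ℂ) • (x : Matrix (Fin 4) (Fin 4) ℂ), by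
      rw [selfAdjoint.mem_iff, star_smul, x.2.star_eq, Complex.star_def, Complex.conj_ofReal]⟩
  have hyx : (y : Matrix (Fin 4) (Fin 4) ℂ) = ((N⁻¹ : ℝ) : ℂ) • (x : Matrix (Fin 4) (Fin 4) ℂ) :=
    rfl
  have hy : ‖y‖ ≤ Real.pi / N := by
    change ‖(y : Matrix (Fin 4) (Fin 4) ℂ)‖ ≤ _
    rw [hyx, norm_smul, Complex.norm_real, Real.norm_eq_abs,
      abs_of_pos (inv_pos.2 hN0), inv_mul_eq_div]
    exact div_le_div_of_nonneg_right hx hN0.le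
  set v : Matrix (Fin 4) (Fin 4) ℂ := (selfAdjoint.expUnitary y : unitary (Matrix (Fin 4) (Fin 4) ℂ)).1 with hv
  have hvN : v ^ N = V := by
    rw [← hxV, hv, selfAdjoint.expUnitary_coe, selfAdjoint.expUnitary_coe, ← Matrix.exp_nsmul, hyx]
    congr 1
    rw [← Nat.cast_smul_eq_nsmul ℂ, smul_smul, smul_smul]
    congr 1
    push_cast
    field_simp
  have hvdet : v.det = Complex.exp (Complex.I * (4 * α : ℝ)) := by
    rw [hv, det_expUnitary, hyx, trace_smul, htx, smul_eq_mul, ← Complex.ofReal_mul]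
    congr 3
    rw [hα]
    field_simp
  have hvn : ‖v - 1‖ ≤ Real.pi / N :=
    (norm_expUnitary_sub_one_le (hy.trans (div_le_self Real.pi_pos.le hN1))).trans hy
  set z := Complex.exp (Complex.I * (-α : ℝ)) with hz
  have hzn : ‖z‖ = 1 := by rw [hz, mul_comm, Complex.norm_exp_ofReal_mul_I]
  have hz1 : ‖z - 1‖ ≤ |α| := by
    rw [← Real.norm_eq_abs, ← norm_neg α]
    exact Real.norm_exp_I_mul_ofReal_sub_one_le
  have hv' : z • v ∈ smallSU ρ := by
    refine ⟨smul_mem_unitary_of_norm_eq_one hzn (selfAdjoint.expUnitary y).2, ?_, ?_⟩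
    · rw [det_smul, hvdet, hz, ← Complex.exp_nat_mul, ← Complex.exp_add, ← Complex.exp_zero]
      congr 1
      simp
      ring
    · have h1 : z • v - 1 = z • (v - 1) + (z - 1) • 1 := by
        rw [smul_sub, sub_smul, one_smul]; abel
      have h2 : ‖z • v - 1‖ ≤ Real.pi / N + |α| := by
        rw [h1]
        refine (norm_add_le _ _).trans ?_
        rw [norm_smul, norm_smul, hzn, one_mul, norm_one, mul_one]
        exact add_le_add hvn hz1
      refine h2.trans_lt ?_
      refine lt_of_mul_lt_mul_right ?_ hN0.le
      rw [add_mul, div_mul_cancel₀ _ hN0.ne']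
      nlinarith [abs_nonneg α]
  have hd : phaseDiag α ∈ smallSU ρ := by
    refine phaseDiag_mem_smallSU (lt_of_mul_lt_mul_right ?_ hN0.le)
    nlinarith [abs_nonneg α, Real.pi_pos]
  have hτ1 : Complex.exp (Complex.I * τ) = 1 := by rw [← htx, ← det_expUnitary, hxV, hdet]
  -- The odd entry `exp (-3iNα)` agrees with the others because `exp (4iNα) = exp (iτ) = 1`; thus
  -- the missing scalar is itself an `N`-th power of a small element.
  have hdN : phaseDiag α ^ N = Complex.exp (Complex.I * (N * α : ℝ)) • 1 := by
    rw [phaseDiag, diagonal_pow, smul_one_eq_diagonal]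
    congr 1
    ext i
    rw [Pi.pow_apply, ← Complex.exp_nat_mul]
    split_ifs
    · rw [← mul_one (Complex.exp (N * _)), ← hτ1, ← Complex.exp_add, ← hα4]
      congr 1
      push_cast
      ring
    · congr 1
      push_cast
      ring
  have hprod : V = (z • v) ^ N * phaseDiag α ^ N := by
    rw [hdN, smul_pow, hvN, smul_mul_smul_comm, mul_one, hz, ← Complex.exp_nat_mul,
      ← Complex.exp_add]
    have : (N : ℂ) * (Complex.I * (-α : ℝ)) + Complex.I * (N * α : ℝ) = 0 := by
      push_cast
      ring
    rw [this, Complex.exp_zero, one_smul]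
  rw [hprod, pow_add]
  exact Set.mul_mem_mul (Set.pow_mem_pow hv') (Set.pow_mem_pow hd)

end SpecialUnitary

/-! ### Exact-time controllability of the four-level system -/

section GlobalControllability

open scoped Matrix.Norms.L2Operator Pointwise

/-- What is reached at time `t` by the four-level system, with the properties of a propagator. -/
def TrapReached (b ε t : ℝ) (V : Matrix (Fin 4) (Fin 4) ℂ) : Prop :=
  0 ≤ t ∧ V ∈ reachable (trapH₀ ε) (trapH₁ b) t ∧ V ∈ unitary (Matrix (Fin 4) (Fin 4) ℂ) ∧
    V.det = Complex.exp (-Complex.I * t * (trapH₀ ε).trace)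

theorem TrapReached.mul {b ε s t : ℝ} {V W : Matrix (Fin 4) (Fin 4) ℂ} (hV : TrapReached b ε s V)
    (hW : TrapReached b ε t W) : TrapReached b ε (s + t) (W * V) := by
  obtain ⟨hs, hVr, hVu, hVd⟩ := hV
  obtain ⟨ht, hWr, hWu, hWd⟩ := hW
  refine ⟨add_nonneg hs ht, mul_mem_reachable hs ht hVr hWr, mul_mem hWu hVu, ?_⟩
  rw [det_mul, hVd, hWd, ← Complex.exp_add]
  congr 1
  push_cast
  ring

theorem trapReached_one (b ε : ℝ) : TrapReached b ε 0 1 :=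
  ⟨le_rfl, one_mem_reachable, one_mem _, by simp⟩

/-- The direction of the perturbation of the drift. -/
def driftPerturbation : Matrix (Fin 4) (Fin 4) ℂ := diagonal ![1, 0, 0, 0]

theorem trapH₀_eq (ε : ℝ) : trapH₀ ε = trapH₀ 0 + (ε : ℂ) • driftPerturbation := by
  rw [trapH₀, trapH₀, driftPerturbation, ← diagonal_smul, diagonal_add]
  congr 1
  ext i
  fin_cases i <;> simp

theorem trace_trapH₀ (ε : ℝ) : (trapH₀ ε).trace = 6 + ε := by
  rw [trapH₀, trace_diagonal, Fin.sum_univ_four]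
  simp
  ring

theorem trace_trapH₁ (b : ℝ) : (trapH₁ b).trace = 0 := by
  simp [trapH₁, trace, Fin.sum_univ_four]

theorem isSelfAdjoint_driftPerturbation : IsSelfAdjoint driftPerturbation := by
  rw [isSelfAdjoint_iff, driftPerturbation, star_eq_conjTranspose, diagonal_conjTranspose]
  congr 1
  ext i
  fin_cases i <;> simp

theorem isSelfAdjoint_trapH₀ (ε : ℝ) : IsSelfAdjoint (trapH₀ ε) := by
  rw [isSelfAdjoint_iff, trapH₀, star_eq_conjTranspose, diagonal_conjTranspose]
  congr 1
  ext i
  fin_cases i <;> simp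

theorem isSelfAdjoint_trapH₁ (b : ℝ) : IsSelfAdjoint (trapH₁ b) := by
  rw [isSelfAdjoint_iff, trapH₁, star_eq_conjTranspose]
  ext i j
  fin_cases i <;> fin_cases j <;> simp

theorem trapReached_exp (b ε : ℝ) {t : ℝ} (ht : 0 ≤ t) (c : ℝ) :
    TrapReached b ε t (NormedSpace.exp
      ((t : ℂ) • controlGenerator (trapH₀ 0) driftPerturbation (trapH₁ b) ε c)) := by
  have hgen : controlGenerator (trapH₀ 0) driftPerturbation (trapH₁ b) ε c =
      (-Complex.I) • (trapH₀ ε + (c : ℂ) • trapH₁ b) := by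
    rw [controlGenerator, ← trapH₀_eq]
  have hherm : (trapH₀ ε + (c : ℂ) • trapH₁ b).IsHermitian := by
    refine (isSelfAdjoint_trapH₀ ε).isHermitian.add ?_
    rw [IsHermitian, conjTranspose_smul, (isSelfAdjoint_trapH₁ b).isHermitian.eq]
    simp
  refine ⟨ht, ?_, ?_, ?_⟩
  · rw [hgen]
    exact exp_mem_reachable t c
  · exact exp_smul_mem_unitary (star_controlGenerator (isSelfAdjoint_trapH₀ 0)
      isSelfAdjoint_driftPerturbation (isSelfAdjoint_trapH₁ b) ε c) t
  · rw [hgen, smul_smul, det_exp_smul_of_isHermitian hherm, trace_add, trace_smul, trace_trapH₁,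
      smul_zero, add_zero, mul_comm (t : ℂ)]

theorem containsReachable_trap (b : ℝ) :
    ContainsReachable (trapH₀ 0) driftPerturbation (trapH₁ b) (TrapReached b) where
  one := trapReached_one b
  step := fun ε _ _ _ c hV ht => hV.mul (trapReached_exp b ε ht c)
  mem_unitary := fun _ _ _ hV => hV.2.2.1

/-- `4φ` is a multiple of `2π` of size below `4 < 2π`. This is why the phases were kept below `1`.
-/
theorem eq_zero_of_exp_four_mul_eq_one {φ : ℝ} (hφ : |φ| < 1)
    (h : Complex.exp (-(φ * Complex.I)) ^ 4 = 1) : φ = 0 := by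
  rw [← Complex.exp_nat_mul, Complex.exp_eq_one_iff] at h
  obtain ⟨n, hn⟩ := h
  have h1 : -(4 * φ) = n * (2 * Real.pi) := by
    have := congrArg Complex.im hn
    simpa using this
  have h2 : |(n : ℝ)| < 1 := by
    have h3 := congrArg abs h1
    rw [abs_neg, abs_mul, abs_mul, abs_of_pos Real.two_pi_pos, abs_of_pos (four_pos (α := ℝ))] at h3
    nlinarith [Real.pi_gt_three, abs_nonneg (n : ℝ)]
  have h4 : n = 0 := by
    have : |n| < 1 := by exact_mod_cast h2
    exact Int.abs_lt_one_iff.1 this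
  rw [h4] at h1
  simpa using h1

/-- Near `ε = 0`, a translate of a fixed neighbourhood of `1` in the special unitary group is
reached at a fixed time. -/
theorem exists_trapReached_translate {b : ℝ} (hb0 : b ≠ 0) (hb1 : b ≠ 1) (hb2 : b ≠ -1) :
    ∃ T ≥ 0, ∃ ρ > 0, ∃ ε₀ > 0, ∀ ε : ℝ, |ε| < ε₀ →
      ∃ g, TrapReached b ε T g ∧ ∀ v ∈ smallSU ρ, TrapReached b ε T (g * v) := by
  obtain ⟨T, g, hg, r, hr, ε₀, hε₀, hball⟩ := exists_reached_ball (isSelfAdjoint_trapH₀ 0)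
    isSelfAdjoint_driftPerturbation (isSelfAdjoint_trapH₁ b) (containsReachable_trap b)
    (fun W hW h0 h1 X => ⟨X.trace / 4, traceless_mem_of_ad_invariant hb0 hb1 hb2 hW h0 h1 (by
      rw [trace_sub, trace_smul, trace_one]
      simp)⟩)
  obtain ⟨hT, -, hgu, hgd⟩ := hg
  have hexact : ∀ ε : ℝ, |ε| < ε₀ → ∀ V ∈ unitary (Matrix (Fin 4) (Fin 4) ℂ), ‖V - g‖ < r →
      V.det = Complex.exp (-Complex.I * T * (trapH₀ ε).trace) → TrapReached b ε T V := by
    intro ε hε V hV hVg hdet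
    obtain ⟨φ, hφ, hφR⟩ := hball ε hε V hV hVg
    have h1 := hφR.2.2.2
    rw [det_smul, hdet, Fintype.card_fin] at h1
    have h2 : Complex.exp (-(φ * Complex.I)) ^ 4 = 1 :=
      (mul_eq_right₀ (Complex.exp_ne_zero _)).1 h1
    rw [eq_zero_of_exp_four_mul_eq_one hφ h2] at hφR
    simpa using hφR
  refine ⟨T, hT, r / 2, by positivity, min ε₀ (r / (T + 1)), by positivity, fun ε hε => ?_⟩
  -- The trace of the drift grows by `ε`, so this fourth root adjusts the determinant of `g`; the
  -- bound `r / (T + 1)` on `ε` keeps the shift small.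
  set z := Complex.exp (Complex.I * (-(T * ε / 4) : ℝ)) with hz
  have hzn : ‖z‖ = 1 := by rw [hz, mul_comm, Complex.norm_exp_ofReal_mul_I]
  have hz1 : ‖z - 1‖ < r / 2 := by
    refine Real.norm_exp_I_mul_ofReal_sub_one_le.trans_lt ?_
    rw [norm_neg, Real.norm_eq_abs, abs_div, abs_mul, abs_of_nonneg hT]
    have h1 := hε.trans_le (min_le_right _ _)
    rw [lt_div_iff₀ (by positivity)] at h1
    norm_num
    nlinarith [abs_nonneg ε]
  have hgu' : z • g ∈ unitary (Matrix (Fin 4) (Fin 4) ℂ) :=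
    smul_mem_unitary_of_norm_eq_one hzn hgu
  have hgd' : (z • g).det = Complex.exp (-Complex.I * T * (trapH₀ ε).trace) := by
    rw [det_smul, hgd, hz, ← Complex.exp_nat_mul, ← Complex.exp_add, trace_trapH₀, trace_trapH₀]
    congr 1
    simp
    ring
  have hmain : ∀ v ∈ smallSU (r / 2), TrapReached b ε T (z • g * v) := by
    rintro v ⟨hvu, hvd, hvn⟩
    refine hexact ε (hε.trans_le (min_le_left _ _)) _ (mul_mem hgu' hvu) ?_ (by
      rw [det_mul, hgd', hvd, mul_one])
    have h1 : z • g * v - g = z • g * (v - 1) + (z - 1) • g := by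
      rw [mul_sub, sub_smul, one_smul, mul_one]
      abel
    rw [h1]
    refine (norm_add_le _ _).trans_lt ?_
    have h2 : ‖z • g * (v - 1)‖ = ‖v - 1‖ := CStarRing.norm_coe_unitary_mul ⟨z • g, hgu'⟩ _
    have h3 : ‖(z - 1) • g‖ = ‖z - 1‖ := by
      rw [norm_smul, CStarRing.norm_of_mem_unitary hgu, mul_one]
    rw [h2, h3]
    linarith
  refine ⟨z • g, ?_, hmain⟩
  simpa using hmain 1 ⟨one_mem _, det_one, by simpa using hr⟩

/-- The operator norm is unitarily invariant. -/
theorem conj_mem_smallSU {ρ : ℝ} {v g : Matrix (Fin 4) (Fin 4) ℂ} (hv : v ∈ smallSU ρ)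
    (hg : g ∈ unitary (Matrix (Fin 4) (Fin 4) ℂ)) : g * v * star g ∈ smallSU ρ := by
  obtain ⟨hvu, hvd, hvn⟩ := hv
  have hgg := Unitary.mul_star_self_of_mem hg
  refine ⟨mul_mem (mul_mem hg hvu) (Unitary.star_mem hg), ?_, ?_⟩
  · rw [det_mul_right_comm, hgg, one_mul, hvd]
  · have h1 : g * v * star g - 1 = g * (v - 1) * star g := by
      rw [mul_sub, sub_mul, mul_one, hgg]
    rw [h1, CStarRing.norm_mul_coe_unitary _ ⟨star g, Unitary.star_mem hg⟩,
      CStarRing.norm_coe_unitary_mul ⟨g, hg⟩]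
    exact hvn

/-- Conjugation invariance of the neighbourhood lets the factors `g` of successive stages be
collected on the left. -/
theorem trapReached_pow_mul {b ε T ρ : ℝ} {g : Matrix (Fin 4) (Fin 4) ℂ}
    (hgT : TrapReached b ε T g)
    (hg : ∀ v ∈ smallSU ρ, TrapReached b ε T (g * v)) (m : ℕ) :
    ∀ w ∈ smallSU ρ ^ m, TrapReached b ε (m * T) (g ^ m * w) := by
  induction m with
  | zero =>
    intro w hw
    rw [pow_zero, Set.mem_one] at hw
    simpa [hw] using trapReached_one b ε
  | succ m ih =>
    intro w hw
    rw [pow_succ'] at hw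
    obtain ⟨v, hv, w', hw', rfl⟩ := Set.mem_mul.1 hw
    have hgm : g ^ m ∈ unitary (Matrix (Fin 4) (Fin 4) ℂ) := pow_mem hgT.2.2.1 m
    have h1 := (ih w' hw').mul (hg _ (conj_mem_smallSU hv hgm))
    have h2 := Unitary.star_mul_self_of_mem hgm
    have h3 : g * (g ^ m * v * star (g ^ m)) * (g ^ m * w') = g ^ (m + 1) * (v * w') := by
      calc g * (g ^ m * v * star (g ^ m)) * (g ^ m * w')
          = g * g ^ m * v * (star (g ^ m) * g ^ m) * w' := by noncomm_ring
        _ = g ^ (m + 1) * (v * w') := by rw [h2, mul_one, pow_succ', mul_assoc]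
    rw [h3] at h1
    convert h1 using 1
    push_cast
    ring

/-- The four-level system is controllable in all times beyond a bound that does not depend on the
perturbation, when that is small. -/
theorem exists_controllableInTime_trap {b : ℝ} (hb0 : b ≠ 0) (hb1 : b ≠ 1) (hb2 : b ≠ -1) :
    ∃ Tc, 0 < Tc ∧ ∃ ε₀, 0 < ε₀ ∧ ∀ ε ∈ Ico 0 ε₀,
      (∀ T, Tc < T → ControllableInTime (trapH₀ ε) (trapH₁ b) T) ∧
        (0 < ε → Tc < trapTime ε) := by
  obtain ⟨T₁, hT₁, ρ, hρ, ε₀, hε₀, hreach⟩ := exists_trapReached_translate hb0 hb1 hb2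
  obtain ⟨N, hN⟩ := exists_mem_smallSU_pow hρ
  have hTc : 0 < N * T₁ + 1 := by positivity
  -- The added `1` only makes the bound positive, as `T₁` may be zero; the second entry of the
  -- minimum puts it below `π/ε`.
  refine ⟨N * T₁ + 1, hTc, min ε₀ (Real.pi / (N * T₁ + 1)), by positivity,
    fun ε hε => ⟨fun T hT V hV hdet => ?_, fun hε0 => ?_⟩⟩
  · obtain ⟨g, hgT, hg⟩ := hreach ε (by
      rw [abs_of_nonneg hε.1]
      exact hε.2.trans_le (min_le_left _ _))
    have hgN : TrapReached b ε (N * T₁) (g ^ N) := by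
      simpa using trapReached_pow_mul hgT hg N 1 (Set.one_mem_pow (by
        exact ⟨one_mem _, det_one, by simpa using hρ⟩))
    -- The surplus time is spent first, with zero control; it then remains to reach `V h⁻¹` in time
    -- `N T₁`.
    obtain ⟨h, w⟩ : ∃ h, TrapReached b ε (T - N * T₁) h :=
      ⟨_, trapReached_exp b ε (by linarith) 0⟩
    have hu : star (g ^ N) * (V * star h) ∈ unitary (Matrix (Fin 4) (Fin 4) ℂ) :=
      mul_mem (Unitary.star_mem hgN.2.2.1) (mul_mem hV (Unitary.star_mem w.2.2.1))
    have hV' : g ^ N * (star (g ^ N) * (V * star h)) * h = V := by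
      rw [← mul_assoc, Unitary.mul_star_self_of_mem hgN.2.2.1, one_mul, mul_assoc,
        Unitary.star_mul_self_of_mem w.2.2.1, mul_one]
    have hd : (star (g ^ N) * (V * star h)).det = 1 := by
      have h1 := congrArg det hV'
      rw [det_mul, det_mul, hgN.2.2.2, w.2.2.2, hdet] at h1
      have h2 : Complex.exp (-Complex.I * T * (trapH₀ ε).trace) =
          Complex.exp (-Complex.I * (N * T₁ : ℝ) * (trapH₀ ε).trace) *
            Complex.exp (-Complex.I * (T - N * T₁ : ℝ) * (trapH₀ ε).trace) := by
        rw [← Complex.exp_add]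
        congr 1
        push_cast
        ring
      rw [h2, mul_right_comm] at h1
      exact (mul_eq_left₀ (mul_ne_zero (Complex.exp_ne_zero _) (Complex.exp_ne_zero _))).1 h1
    have h3 := w.mul (trapReached_pow_mul hgT hg N _ (hN _ hu hd))
    rw [hV', sub_add_cancel] at h3
    exact h3.2.1
  · rw [trapTime, lt_div_iff₀ hε0]
    have := hε.2.trans_le (min_le_right _ _)
    rw [lt_div_iff₀ hTc] at this
    linarith

end GlobalControllability

end

/-! ### The main theorem -/

theorem mainTheorem2 :
    (∀ ε : ℝ, 0 < ε → ∀ b θ : ℝ,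
      -- every control has exactly one propagator, and the fidelity is a `C²` functional
      (∀ f : ControlSpace (trapTime ε),
        ∃ U, IsPropagator (trapH₀ ε) (trapH₁ b) (trapTime ε) f U ∧
          ∀ U', IsPropagator (trapH₀ ε) (trapH₁ b) (trapTime ε) f U' →
            Set.EqOn U' U (Set.Icc 0 (trapTime ε))) ∧
      ContDiff ℝ 2 (trapFidelity ε b θ) ∧
      -- critical point with value `cos² θ`
      HasGradientAt (trapFidelity ε b θ) 0 0 ∧
      trapFidelity ε b θ 0 = Real.cos θ ^ 2 ∧
      -- the Hessian as an integral operator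
      (∀ α β : ControlSpace (trapTime ε),
        ⟪hessian (trapFidelity ε b θ) 0 α, β⟫_ℝ =
          ⟪(-(b ^ 2 * Real.cos θ ^ 2)) • unnormProj (trapTime ε) 1 α, β⟫_ℝ
          - ∫ τ in (0 : ℝ)..trapTime ε, ∫ σ in (0 : ℝ)..τ,
              Real.cos θ * (Real.cos θ * Real.cos (ε * (τ - σ))
                - Real.sin θ * Real.sin (ε * (τ - σ))) * (α σ * β τ + β σ * α τ)) ∧
      -- the eigen-expansion, convergent in operator norm
      Summable (fun k : ℕ => trapCoeff b θ (k + 1) •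
        (unnormProj (trapTime ε) (sinMap (2 * ((k + 1 : ℕ) : ℝ) * ε))
          + unnormProj (trapTime ε) (cosMap (2 * ((k + 1 : ℕ) : ℝ) * ε)))) ∧
      hessian (trapFidelity ε b θ) 0 =
        trapCoeff b θ 0 • unnormProj (trapTime ε) 1
        + (∑' k : ℕ, trapCoeff b θ (k + 1) •
            (unnormProj (trapTime ε) (sinMap (2 * ((k + 1 : ℕ) : ℝ) * ε))
              + unnormProj (trapTime ε) (cosMap (2 * ((k + 1 : ℕ) : ℝ) * ε))))
        - Real.cos θ ^ 2 •
            (unnormProj (trapTime ε) (sinMap ε) + unnormProj (trapTime ε) (cosMap ε)) ∧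
      -- negativity of all coefficients, and what it implies
      ((∀ k : ℕ, trapCoeff b θ k < 0) ↔
        (1 / Real.pi * Real.sin (2 * θ) < b ^ 2 * Real.cos θ ^ 2 ∧
          0 < 1 / Real.pi * Real.sin (2 * θ))) ∧
      ((∀ k : ℕ, trapCoeff b θ k < 0) →
        IsNegDef (hessian (trapFidelity ε b θ) 0) ∧
        IsStrictLocalMaxOnFinDim (trapFidelity ε b θ) ∧
        HasInfiniteRank (hessian (trapFidelity ε b θ) 0))) ∧
    -- the traps for `b = 3`
    (∀ θ ∈ Set.Ioc 0 (Real.pi / 3),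
      (∀ k : ℕ, trapCoeff 3 θ k < 0) ∧
      ∀ ε : ℝ, 0 < ε →
        IsNegDef (hessian (trapFidelity ε 3 θ) 0) ∧
        IsStrictLocalMaxOnFinDim (trapFidelity ε 3 θ) ∧
        HasInfiniteRank (hessian (trapFidelity ε 3 θ) 0) ∧
        trapFidelity ε 3 θ 0 ∈ Set.Ico (1 / 4 : ℝ) 1) ∧
    (∀ ε : ℝ, 0 < ε →
      (fun θ => trapFidelity ε 3 θ 0) '' Set.Ioc 0 (Real.pi / 3) = Set.Ico (1 / 4 : ℝ) 1) ∧
    -- exact-time controllability, uniformly near `ε = 0`, with `T = π/ε` above the critical time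
    (∀ b : ℝ, b ≠ 0 → b ≠ 1 → b ≠ -1 →
      ∃ Tc : ℝ, 0 < Tc ∧ ∃ ε₀ : ℝ, 0 < ε₀ ∧ ∀ ε ∈ Set.Ico 0 ε₀,
        (∀ T : ℝ, Tc < T → ControllableInTime (trapH₀ ε) (trapH₁ b) T) ∧
        (0 < ε → Tc < trapTime ε)) := by
  refine ⟨fun ε hε b θ => ?_, fun θ hθ => ⟨trapCoeff_three_neg hθ, fun ε hε => ?_⟩,
    fun ε hε => ?_, fun b hb0 hb1 hb2 => ?_⟩
  · have hT := (trapTime_pos hε).le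
    refine ⟨fun f => ?_, contDiff_trapFidelity hT b θ, hasGradientAt_trapFidelity_zero hT b θ,
      trapFidelity_zero hT b θ, inner_hessian_trapFidelity_triangle hT b θ,
      summable_trapCoeff_smul hT b θ _, hessian_trapFidelity_eq hε b θ, trapCoeff_neg_iff b θ,
      trap_of_trapCoeff_neg hε⟩
    obtain ⟨U, hU⟩ := exists_isPropagator (trapH₀ ε) (trapH₁ b) hT f
    exact ⟨U, hU, fun U' hU' => hU.eqOn _ _ hU'⟩
  · have hT := (trapTime_pos hε).le
    obtain ⟨h1, h2, h3⟩ := trap_of_trapCoeff_neg hε (trapCoeff_three_neg hθ)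
    exact ⟨h1, h2, h3, trapFidelity_zero hT 3 θ ▸ cos_sq_mem_Ico hθ⟩
  · simp only [trapFidelity_zero (trapTime_pos hε).le]
    exact image_cos_sq
  · exact exists_controllableInTime_trap hb0 hb1 hb2
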